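/- Let $Q:\mathbb C\to\mathbb R$ be lower semicontinuous and radially symmetric, with $Q(z)-2\log|z|\to\infty$ as $|z|\to\infty$. Write $\Delta=\partial\bar\partial=\frac14(\partial_{xx}+\partial_{yy})$ and $dA=\frac1\pi\,dx\,dy$. Let $\sigma$ be the equilibrium measure of $Q$, i.e. the minimizer of $$I_Q[\mu]=\iint\log\frac1{|z-w|}\,d\mu(z)\,d\mu(w)+\int Q\,d\mu$$ among compactly supported Borel probability measures on $\mathbb C$, let $S=\operatorname{supp}\sigma$ (the droplet), $U^\sigma(z)=\int\log\frac1{|z-w|}\,d\sigma(w)$, and let $\check Q=\gamma-2U^\sigma$ be the obstacle function, where $\gamma=\int(Q+2U^\sigma)\,d\sigma$ is Robin's constant (the constant value of $Q+2U^\sigma$ on $S$). Assume that $Q$ is $C^2$-smooth in a neighbourhood of $S$, that $\Delta Q>0$ on $\partial S$, that $\check Q<Q$ on $\mathbb C\setminus S$, and that $$S=\bigcup_{j=0}^N\{a_j\le|z|\le b_j\},\qquad 0\le a_0<b_0<a_1<b_1<\cdots<a_N<b_N,\quad N\ge1.$$ Fix $0\le j_0\le N-1$, put $r_1=b_{j_0}$,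 $r_2=a_{j_0+1}$, let $G=\{r_1<|z|<r_2\}$ be the corresponding gap, and assume that $Q$ is $C^6$-smooth in a neighbourhood of $\partial G$. For $n\ge1$ let $$K_n(z,w)=\sum_{j=0}^{n-1}\frac{p_j(z)\overline{p_j(w)}}{\|p_j\|^2},\qquad p_j(z)=z^je^{-\frac n2Q(z)},\qquad \|p_j\|^2=\int_{\mathbb C}|p_j|^2\,dA$$ (terms with $\|p_j\|=\infty$ being read as $0$), the reproducing kernel of the space of weighted polynomials $Pe^{-\frac n2Q}\in L^2(\mathbb C,dA)$ with $\deg P\le n-1$. Then there are constants $A$ and $B$ (necessarily unique) such that $\check Q(z)=A+B\log|z|$ for $r_1\le|z|\le r_2$, and the following holds with $$m=\lfloor Bn/2\rfloor,\qquad x=\{Bn/2\}=Bn/2-m,$$ $$\mathcal S^G(z,w;n)=\frac1{2\pi}\sum_{\ell=-\infty}^{\infty}\frac{(z\bar w)^\ell}{\frac{r_1^{2\ell+1-2x}}{\sqrt{\Delta Q(r_1)}}+\frac{r_2^{2\ell+1-2x}}{\sqrt{\Delta Q(r_2)}}},$$ the $n$-weighted Szegő kernel of $G$. For every $c>0$ there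 are constants $C$ and $n_0$ such that for all $n\ge n_0$ and all $z,w\in\mathbb C$ with $\operatorname{dist}(z,G)<\frac{\log n}{\sqrt n}$, $\operatorname{dist}(w,G)<\frac{\log n}{\sqrt n}$ and $\bigl||z|-|w|\bigr|>c$, the series defining $\mathcal S^G(z,w;n)$ converges absolutely and $$\Bigl|K_n(z,w)-\sqrt{2\pi n}\;\mathcal S^G(z,w;n)\,(z\bar w)^m\,(r_1r_2)^{-\frac{Bn}2}\,e^{\frac n2(Q(r_1)-Q(z))+\frac n2(Q(r_2)-Q(w))}\Bigr|\le C\log^3n .$$ -/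

import Mathlib

open MeasureTheory Set Filter Topology
open scoped ENNReal ComplexConjugate

namespace CoulombGap

/-- Integral of an extended-real-valued function: integral of the positive part minus integral of
the negative part. It is only used where the integral of the negative part is finite. -/
noncomputable def extIntegral {α : Type*} [MeasurableSpace α] (μ : Measure α) (f : α → EReal) :
    EReal :=
  ((∫⁻ x, (f x).toENNReal ∂μ : ℝ≥0∞) : EReal) - ((∫⁻ x, (-f x).toENNReal ∂μ : ℝ≥0∞) : EReal)

/-- Weighted logarithmic energy `I_Q[μ] = ∬ log (1 / |z - w|) dμ(z) dμ(w) + ∫ Q dμ`, where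
`log (1 / |z - w|) = +∞` on the diagonal. -/
noncomputable def weightedEnergy (Q : ℂ → ℝ) (μ : Measure ℂ) : EReal :=
  extIntegral (μ.prod μ) (fun p => -ENNReal.log ‖p.1 - p.2‖ₑ) +
    extIntegral μ (fun z => ((Q z : ℝ) : EReal))

/-- `σ` is an equilibrium measure in the external field `Q`: it minimizes the weighted logarithmic
energy among all compactly supported Borel probability measures on `ℂ`. -/
def IsEquilibriumMeasure (Q : ℂ → ℝ) (σ : Measure ℂ) : Prop :=
  IsProbabilityMeasure σ ∧ IsCompact σ.support ∧
    ∀ μ : Measure ℂ, IsProbabilityMeasure μ → IsCompact μ.support →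
      weightedEnergy Q σ ≤ weightedEnergy Q μ

/-- Logarithmic potential `U^μ(z) = ∫ log (1 / |z - w|) dμ(w)`. -/
noncomputable def logPotential (μ : Measure ℂ) (z : ℂ) : ℝ :=
  ∫ w, -Real.log ‖z - w‖ ∂μ

/-- Robin's constant: the `σ`-average of `Q + 2 U^σ`. For the equilibrium measure `σ`
the function `Q + 2 U^σ` is constant on the support of `σ`, so that this is its value there. -/
noncomputable def robinConstant (Q : ℂ → ℝ) (σ : Measure ℂ) : ℝ :=
  ∫ z, (Q z + 2 * logPotential σ z) ∂σ

/-- Obstacle function `γ - 2 U^σ`. -/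
noncomputable def obstacle (Q : ℂ → ℝ) (σ : Measure ℂ) (z : ℂ) : ℝ :=
  robinConstant Q σ - 2 * logPotential σ z

/-- The normalized Laplacian `∂ ∂̄ = (∂_xx + ∂_yy) / 4`. -/
noncomputable def lap (f : ℂ → ℝ) (z : ℂ) : ℝ :=
  (1 / 4 : ℝ) * Laplacian.laplacian f z

/-- `f` is `C^k`-smooth in some neighbourhood of the set `E`. -/
def SmoothNear (k : ℕ) (f : ℂ → ℝ) (E : Set ℂ) : Prop :=
  ∃ U : Set ℂ, IsOpen U ∧ E ⊆ U ∧ ContDiffOn ℝ (k : WithTop ℕ∞) f U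

/-- The normalized area measure `dA = dx dy / π`. -/
noncomputable def areaMeasure : Measure ℂ :=
  ENNReal.ofReal (1 / Real.pi) • (volume : Measure ℂ)

/-- The weighted monomial `z ^ j * exp (-n Q(z) / 2)`. -/
noncomputable def weightedMonomial (Q : ℂ → ℝ) (n j : ℕ) (z : ℂ) : ℂ :=
  z ^ j * ((Real.exp (-((n : ℝ) / 2) * Q z) : ℝ) : ℂ)

/-- The squared norm of the `j`-th weighted monomial in `L²(ℂ, dA)`. -/
noncomputable def weightedMonomialNormSq (Q : ℂ → ℝ) (n j : ℕ) : ℝ :=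
  ∫ z, ‖weightedMonomial Q n j z‖ ^ 2 ∂areaMeasure

/-- The canonical correlation kernel: the reproducing kernel of the space of weighted polynomials
`P e^{-nQ/2}`, `deg P ≤ n - 1`, in `L²(ℂ, dA)`, written in its orthogonal basis of weighted
monomials. (A monomial of infinite norm is not in `L²` and contributes nothing.) -/
noncomputable def corrKernel (Q : ℂ → ℝ) (n : ℕ) (z w : ℂ) : ℂ :=
  ∑ j ∈ Finset.range n, weightedMonomial Q n j z * conj (weightedMonomial Q n j w) /
    ((weightedMonomialNormSq Q n j : ℝ) : ℂ)

/-- The annulus `r₁ < |z| < r₂`. -/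
def annulus (r₁ r₂ : ℝ) : Set ℂ := {z | r₁ < ‖z‖ ∧ ‖z‖ < r₂}

/-- The `ℓ`-th term of the series defining the `n`-weighted Szegő kernel; here `x = {B n / 2}`. -/
noncomputable def szegoTerm (Q : ℂ → ℝ) (r₁ r₂ B : ℝ) (n : ℕ) (z w : ℂ) (l : ℤ) : ℂ :=
  (z * conj w) ^ l /
    ((r₁ ^ (2 * (l : ℝ) + 1 - 2 * Int.fract (B * n / 2)) / √(lap Q (r₁ : ℂ)) +
      r₂ ^ (2 * (l : ℝ) + 1 - 2 * Int.fract (B * n / 2)) / √(lap Q (r₂ : ℂ)) : ℝ) : ℂ)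

/-- The `n`-weighted Szegő kernel of the annulus `r₁ < |z| < r₂`. -/
noncomputable def szegoKernel (Q : ℂ → ℝ) (r₁ r₂ B : ℝ) (n : ℕ) (z w : ℂ) : ℂ :=
  (1 / (2 * (Real.pi : ℂ))) * ∑' l : ℤ, szegoTerm Q r₁ r₂ B n z w l

end CoulombGap

/-! Since `Q` is radial, the kernel is a sum over monomials and everything depends on their norms.
Let the obstacle function be A + B log|z| in the gap and put V(r) = Q(r) - A - B log r. In polar
coordinates the squared norm of p_j is 2 e^{-nA} ∫ r^{2j+1-nB} e^{-nV(r)} dr. With j = m + ℓ the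
exponent becomes 2ℓ + 1 - 2x, so n enters it only through the fractional part x. On the positive
axis V ≥ 0 vanishes exactly at r₁ and r₂, where its second derivative is 4ΔQ. Laplace's method gives
one Gaussian peak at each radius, and their sum is proportional to the ℓ-th denominator D_ℓ of the
Szegő kernel.

Quantitatively, e^{-nA}‖p_j‖^{-2} = √(2πn)/(2π D_ℓ) + O((1+|ℓ|)/D_ℓ) for every integer ℓ
(`IsTwoPeak.reciprocal`). For |ℓ| ≤ √n this is Laplace's method (`IsTwoPeak.laplace`). For |ℓ| > √n
both terms are O(√n/D_ℓ) by a crude lower bound (`IsTwoPeak.lower_bound`), and √n < |ℓ|.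

Two points near the gap whose moduli differ by more than c have |zw| between r₁²/ρ and ρr₂² for a
fixed ρ < 1 (`exists_separation`), so |zw|^{ℓ-x}/D_ℓ = O(ρ^{|ℓ|}), while the weights e^{-nV/2} are
at most 1. The two kernels therefore differ by at most a constant times Σ (1+|ℓ|)ρ^{|ℓ|}
(`norm_corrKernel_sub_le`). The indices with m + ℓ outside [0, n) fit the same bound, because 0 < B
< 2 forces |ℓ| to be at least of order √n there.

What remains is potential theory (`obstacle_gap`). Moving mass of σ to uniform measures on small
circles yields γ ≤ Q + 2U on the support; integration gives equality almost everywhere, and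
truncated potentials, which are continuous, carry it to every point of the support. Averages of U
over centred circles are explicit and logarithmic in the gap. A minimum principle identifies U with
its average there, so rotation invariance of σ itself is never needed. -/

namespace CoulombGap

/-! ### Uniform measures on circles and logarithmic kernels -/

/-- The uniform probability measure on the circle with centre `c` and radius `R`. -/
noncomputable def circleMeasure (c : ℂ) (R : ℝ) : Measure ℂ :=
  Measure.map (circleMap c R)
    (ENNReal.ofReal (2 * Real.pi)⁻¹ • (volume : Measure ℝ).restrict (Ioc 0 (2 * Real.pi)))

lemma measurable_circleMap (c : ℂ) (R : ℝ) : Measurable (circleMap c R) :=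
  (continuous_circleMap c R).measurable

instance isProbabilityMeasure_circleMeasure (c : ℂ) (R : ℝ) :
    IsProbabilityMeasure (circleMeasure c R) := by
  constructor
  rw [circleMeasure, Measure.map_apply (measurable_circleMap c R) MeasurableSet.univ]
  simp only [preimage_univ, Measure.smul_apply, Measure.restrict_apply MeasurableSet.univ,
    univ_inter, Real.volume_Ioc, smul_eq_mul, sub_zero]
  rw [← ENNReal.ofReal_mul (by positivity), inv_mul_cancel₀ (by positivity), ENNReal.ofReal_one]

lemma nullSingleton_circleMeasure (c : ℂ) {R : ℝ} (hR : R ≠ 0) :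
    NullSingletonClass (circleMeasure c R) := by
  constructor
  intro x
  rw [circleMeasure, Measure.map_apply (measurable_circleMap c R) (measurableSet_singleton x)]
  simp only [Measure.smul_apply, smul_eq_mul, mul_eq_zero]
  right
  exact ((countable_singleton x).preimage_circleMap c hR).measure_zero _

lemma integral_circleMeasure {f : ℂ → ℝ} (hf : Measurable f) (c : ℂ) (R : ℝ) :
    ∫ z, f z ∂circleMeasure c R = Real.circleAverage f c R := by
  rw [circleMeasure, integral_map (measurable_circleMap c R).aemeasurable
    hf.aestronglyMeasurable, integral_smul_measure, Real.circleAverage,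
    intervalIntegral.integral_of_le (by positivity), ENNReal.toReal_ofReal (by positivity)]

lemma integrable_circleMeasure_iff {f : ℂ → ℝ} (hf : Measurable f) (c : ℂ) (R : ℝ) :
    Integrable f (circleMeasure c R) ↔ CircleIntegrable f c R := by
  rw [circleMeasure, integrable_map_measure hf.aestronglyMeasurable
    (measurable_circleMap c R).aemeasurable, integrable_smul_measure (by simp [Real.pi_pos])
    (by simp), CircleIntegrable, intervalIntegrable_iff_integrableOn_Ioc_of_le (by positivity)]
  rfl

lemma ae_circleMeasure_mem_sphere (c : ℂ) {R : ℝ} (hR : 0 ≤ R) :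
    ∀ᵐ z ∂circleMeasure c R, z ∈ Metric.sphere c R := by
  rw [circleMeasure, ae_map_iff (p := fun z => z ∈ Metric.sphere c R)
    (measurable_circleMap c R).aemeasurable Metric.isClosed_sphere.measurableSet]
  exact Eventually.of_forall fun θ => circleMap_mem_sphere c hR θ

lemma measurable_log_norm_sub (a : ℂ) : Measurable fun z : ℂ => Real.log ‖z - a‖ :=
  Real.measurable_log.comp (measurable_id.sub_const a).norm

lemma measurable_log_norm_sub_prod : Measurable fun p : ℂ × ℂ => Real.log ‖p.1 - p.2‖ :=
  Real.measurable_log.comp (measurable_fst.sub measurable_snd).norm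

/-- Jensen's formula for a linear function. Averaging the logarithmic kernel over a circle amounts
to truncating it at the radius, which is why circles serve as test measures throughout. -/
lemma circleAverage_log_norm_sub (a c : ℂ) {R : ℝ} (hR : 0 < R) :
    Real.circleAverage (fun z => Real.log ‖z - a‖) c R = Real.log (max R ‖c - a‖) := by
  rw [circleAverage_log_norm_sub_const_eq_log_radius_add_posLog hR.ne',
    Real.posLog_eq_log_max_one (by positivity), ← Real.log_mul hR.ne'
      (by positivity), mul_max_of_nonneg _ _ hR.le, mul_one,
    mul_inv_cancel_left₀ hR.ne']

lemma integrable_log_circleMeasure (a c : ℂ) (R : ℝ) :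
    Integrable (fun z => Real.log ‖z - a‖) (circleMeasure c R) :=
  (integrable_circleMeasure_iff (measurable_log_norm_sub a) c R).2
    (circleIntegrable_log_norm_sub_const R)

lemma integral_log_circleMeasure (a c : ℂ) {R : ℝ} (hR : 0 < R) :
    ∫ z, Real.log ‖z - a‖ ∂circleMeasure c R = Real.log (max R ‖c - a‖) := by
  rw [integral_circleMeasure (measurable_log_norm_sub a), circleAverage_log_norm_sub a c hR]

/-- On bounded sets log⁺ is bounded, so this turns a bound for ∫ |log| into the explicit mean of
log. -/
lemma abs_log_eq (t : ℝ) : |Real.log t| = 2 * Real.posLog t - Real.log t := by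
  have hp : Real.posLog t = max 0 (Real.log t) := rfl
  rw [hp]
  rcases le_total 0 (Real.log t) with h | h
  · rw [abs_of_nonneg h, max_eq_right h]; ring
  · rw [abs_of_nonpos h, max_eq_left h]; ring

lemma posLog_norm_sub_le {M : ℝ} {z w : ℂ} (hz : ‖z‖ ≤ M) (hw : ‖w‖ ≤ M) :
    Real.posLog ‖z - w‖ ≤ Real.posLog (2 * M) := by
  apply Real.posLog_le_posLog (by positivity)
  linarith [norm_sub_le z w]

/-- The logarithmic kernel is integrable for the product of a circle measure and a finite
measure of bounded support. -/
lemma integrable_log_circleMeasure_prod {σ : Measure ℂ} [IsFiniteMeasure σ] {M : ℝ}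
    (hM : ∀ᵐ w ∂σ, ‖w‖ ≤ M) (c : ℂ) {R : ℝ} (hR : 0 < R) :
    Integrable (fun p : ℂ × ℂ => Real.log ‖p.1 - p.2‖) ((circleMeasure c R).prod σ) := by
  rw [integrable_prod_iff' measurable_log_norm_sub_prod.aestronglyMeasurable]
  refine ⟨Eventually.of_forall fun w => integrable_log_circleMeasure w c R, ?_⟩
  have hmeas : AEStronglyMeasurable
      (fun w => ∫ z, ‖Real.log ‖z - w‖‖ ∂circleMeasure c R) σ := by
    have : StronglyMeasurable fun p : ℂ × ℂ => ‖Real.log ‖p.2 - p.1‖‖ :=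
      ((Real.measurable_log.comp (measurable_snd.sub measurable_fst).norm).norm).stronglyMeasurable
    exact (this.integral_prod_right (ν := circleMeasure c R)).aestronglyMeasurable
  set M' := max M (‖c‖ + R)
  refine Integrable.mono' (integrable_const (2 * Real.posLog (2 * M') - Real.log R)) hmeas ?_
  filter_upwards [hM] with w hw
  rw [Real.norm_of_nonneg (integral_nonneg fun _ => norm_nonneg _)]
  calc ∫ z, ‖Real.log ‖z - w‖‖ ∂circleMeasure c R
      ≤ ∫ z, (2 * Real.posLog (2 * M') - Real.log ‖z - w‖) ∂circleMeasure c R := by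
        apply integral_mono_ae (integrable_log_circleMeasure w c R).norm
          ((integrable_const _).sub (integrable_log_circleMeasure w c R))
        filter_upwards [ae_circleMeasure_mem_sphere c hR.le] with z hz
        rw [Real.norm_eq_abs, abs_log_eq]
        have : Real.posLog ‖z - w‖ ≤ Real.posLog (2 * M') := by
          refine posLog_norm_sub_le ?_ (hw.trans (le_max_left _ _))
          have : ‖z - c‖ = R := by simpa using hz
          calc ‖z‖ = ‖c + (z - c)‖ := by congr 1; ring
            _ ≤ ‖c‖ + R := (norm_add_le _ _).trans (by rw [this])
            _ ≤ M' := le_max_right _ _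
        simp only [Pi.sub_apply]
        linarith
    _ = 2 * Real.posLog (2 * M') - Real.log (max R ‖c - w‖) := by
        rw [integral_sub (integrable_const _) (integrable_log_circleMeasure w c R),
          integral_log_circleMeasure w c hR]
        simp
    _ ≤ 2 * Real.posLog (2 * M') - Real.log R := by
        gcongr
        exact le_max_left _ _

lemma integrable_logPotential_circleMeasure {σ : Measure ℂ} [IsFiniteMeasure σ] {M : ℝ}
    (hM : ∀ᵐ w ∂σ, ‖w‖ ≤ M) (c : ℂ) {R : ℝ} (hR : 0 < R) :
    Integrable (logPotential σ) (circleMeasure c R) :=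
  (integrable_log_circleMeasure_prod hM c hR).neg.integral_prod_left

/-- The average of a logarithmic potential over a circle. -/
lemma integral_logPotential_circleMeasure {σ : Measure ℂ} [IsFiniteMeasure σ] {M : ℝ}
    (hM : ∀ᵐ w ∂σ, ‖w‖ ≤ M) (c : ℂ) {R : ℝ} (hR : 0 < R) :
    ∫ z, logPotential σ z ∂circleMeasure c R = -∫ w, Real.log (max R ‖c - w‖) ∂σ := by
  have h := (integrable_log_circleMeasure_prod hM c hR).neg
  unfold logPotential
  rw [integral_integral (f := fun z w => -Real.log ‖z - w‖) h]
  change ∫ p, (-fun p : ℂ × ℂ => Real.log ‖p.1 - p.2‖) p ∂_ = _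
  rw [integral_prod_symm _ h, ← integral_neg]
  congr 1
  ext w
  simp only [Pi.neg_apply]
  rw [integral_neg, integral_log_circleMeasure w c hR]

/-! ### Truncated logarithmic potentials. -/

lemma continuous_log_max {R : ℝ} (hR : 0 < R) :
    Continuous fun p : ℂ × ℂ => Real.log (max R ‖p.1 - p.2‖) :=
  Continuous.log (by fun_prop) fun p => (lt_max_of_lt_left hR).ne'

lemma abs_log_max_le {R M : ℝ} (hR : 0 < R) {z w : ℂ} (hz : ‖z‖ ≤ M) (hw : ‖w‖ ≤ M) :
    |Real.log (max R ‖z - w‖)| ≤ |Real.log R| + |Real.log (max R (2 * M))| := by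
  have h1 : Real.log R ≤ Real.log (max R ‖z - w‖) := Real.log_le_log hR (le_max_left _ _)
  have h2 : Real.log (max R ‖z - w‖) ≤ Real.log (max R (2 * M)) := by
    apply Real.log_le_log (lt_max_of_lt_left hR)
    apply max_le_max_left
    linarith [norm_sub_le z w]
  rw [abs_le]
  constructor
  · linarith [neg_abs_le (Real.log R), abs_nonneg (Real.log (max R (2 * M)))]
  · linarith [le_abs_self (Real.log (max R (2 * M))), abs_nonneg (Real.log R)]

lemma integrable_log_max {σ : Measure ℂ} [IsFiniteMeasure σ] {M : ℝ}
    (hM : ∀ᵐ w ∂σ, ‖w‖ ≤ M) (z : ℂ) {R : ℝ} (hR : 0 < R) :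
    Integrable (fun w => Real.log (max R ‖z - w‖)) σ := by
  refine Integrable.mono' (integrable_const
    (|Real.log R| + |Real.log (max R (2 * max M ‖z‖))|)) ?_ ?_
  · exact ((continuous_log_max hR).comp (by fun_prop : Continuous fun w : ℂ => (z, w))).aestronglyMeasurable
  · filter_upwards [hM] with w hw
    exact abs_log_max_le hR (le_max_right _ _) (hw.trans (le_max_left _ _))

lemma continuous_integral_log_max {σ : Measure ℂ} [IsFiniteMeasure σ] {M : ℝ}
    (hM : ∀ᵐ w ∂σ, ‖w‖ ≤ M) {R : ℝ} (hR : 0 < R) :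
    Continuous fun z => ∫ w, Real.log (max R ‖z - w‖) ∂σ := by
  rw [continuous_iff_continuousAt]
  intro z₀
  refine continuousAt_of_dominated (bound := fun _ =>
    |Real.log R| + |Real.log (max R (2 * max M (‖z₀‖ + 1)))|) ?_ ?_ (integrable_const _) ?_
  · exact Eventually.of_forall fun z => (integrable_log_max hM z hR).aestronglyMeasurable
  · filter_upwards [Metric.ball_mem_nhds z₀ one_pos] with z hz
    filter_upwards [hM] with w hw
    refine abs_log_max_le hR (le_trans ?_ (le_max_right _ _)) (hw.trans (le_max_left _ _))
    have : ‖z - z₀‖ < 1 := by simpa [dist_eq_norm] using hz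
    linarith [norm_sub_norm_le z z₀]
  · exact Eventually.of_forall fun w => ((continuous_log_max hR).comp
      (by fun_prop : Continuous fun z : ℂ => (z, w))).continuousAt

/-- Fatou's lemma applied to the nonnegative increments `f n - f 0`. It is needed because
integrability of the limit is the conclusion, not an assumption. -/
lemma integrable_of_monotone_of_integral_le {α : Type*} [MeasurableSpace α] {μ : Measure α}
    {f : ℕ → α → ℝ} {F : α → ℝ} {K : ℝ} (hf : ∀ n, Integrable (f n) μ)
    (hmono : ∀ x, Monotone fun n => f n x)
    (hlim : ∀ᵐ x ∂μ, Tendsto (fun n => f n x) atTop (𝓝 (F x)))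
    (hK : ∀ n, ∫ x, f n x ∂μ ≤ K) : Integrable F μ := by
  have hg : Integrable (fun x => F x - f 0 x) μ := by
    refine ⟨(aestronglyMeasurable_of_tendsto_ae atTop (fun n => (hf n).1) hlim).sub (hf 0).1, ?_⟩
    rw [HasFiniteIntegral]
    calc ∫⁻ x, ‖F x - f 0 x‖ₑ ∂μ
        = ∫⁻ x, liminf (fun n => ‖f n x - f 0 x‖ₑ) atTop ∂μ := by
          apply lintegral_congr_ae
          filter_upwards [hlim] with x hx
          exact ((hx.sub_const _).enorm.liminf_eq).symm
      _ ≤ liminf (fun n => ∫⁻ x, ‖f n x - f 0 x‖ₑ ∂μ) atTop :=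
          lintegral_liminf_le' fun n => ((hf n).sub (hf 0)).1.enorm
      _ ≤ ENNReal.ofReal (K - ∫ x, f 0 x ∂μ) := by
          refine liminf_le_of_frequently_le' (Frequently.of_forall fun n => ?_)
          have h0 : ∀ x, 0 ≤ f n x - f 0 x := fun x => sub_nonneg.2 (hmono x n.zero_le)
          calc ∫⁻ x, ‖f n x - f 0 x‖ₑ ∂μ = ∫⁻ x, ENNReal.ofReal (f n x - f 0 x) ∂μ := by
                congr 1; ext x; exact Real.enorm_of_nonneg (h0 x)
            _ = ENNReal.ofReal (∫ x, (f n x - f 0 x) ∂μ) :=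
                (ofReal_integral_eq_lintegral_ofReal ((hf n).sub (hf 0))
                  (Eventually.of_forall h0)).symm
            _ ≤ _ := by
                rw [integral_sub (hf n) (hf 0)]
                exact ENNReal.ofReal_le_ofReal (by linarith [hK n])
      _ < ⊤ := ENNReal.ofReal_lt_top
  exact (hg.add (hf 0)).congr (Eventually.of_forall fun x => by simp)

/-- If the truncated potentials at `z` are bounded above, then the logarithmic kernel is
integrable and the truncated potentials increase to the potential. -/
lemma integrable_log_of_bound {σ : Measure ℂ} [IsFiniteMeasure σ] {M : ℝ}
    (hM : ∀ᵐ w ∂σ, ‖w‖ ≤ M) (z : ℂ) (hz : σ {z} = 0) {K : ℝ}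
    (hK : ∀ R : ℝ, 0 < R → -∫ w, Real.log (max R ‖z - w‖) ∂σ ≤ K) :
    Integrable (fun w => Real.log ‖z - w‖) σ ∧ logPotential σ z ≤ K ∧
      Tendsto (fun n : ℕ => -∫ w, Real.log (max (1 / ((n : ℝ) + 1)) ‖z - w‖) ∂σ) atTop
        (𝓝 (logPotential σ z)) := by
  have hRn : ∀ n : ℕ, (0 : ℝ) < 1 / ((n : ℝ) + 1) := fun n => by positivity
  set f : ℕ → ℂ → ℝ := fun n w => -Real.log (max (1 / ((n : ℝ) + 1)) ‖z - w‖)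
  have hfi : ∀ n, Integrable (f n) σ := fun n => (integrable_log_max hM z (hRn n)).neg
  have hmono : ∀ w, Monotone fun n => f n w := by
    intro w m n hmn
    simp only [f, neg_le_neg_iff]
    apply Real.log_le_log (lt_max_of_lt_left (hRn n))
    apply max_le_max_right
    exact Nat.one_div_le_one_div hmn
  have hlim : ∀ᵐ w ∂σ, Tendsto (fun n => f n w) atTop (𝓝 (-Real.log ‖z - w‖)) := by
    have : ∀ᵐ w ∂σ, w ≠ z := by
      rw [ae_iff]; simpa using hz
    filter_upwards [this] with w hw
    have hpos : 0 < ‖z - w‖ := norm_pos_iff.2 (sub_ne_zero.2 hw.symm)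
    apply tendsto_const_nhds.congr'
    have := tendsto_one_div_add_atTop_nhds_zero_nat (𝕜 := ℝ)
    filter_upwards [this.eventually (gt_mem_nhds hpos)] with n hn
    simp only [f]
    rw [max_eq_right hn.le]
  have hbd : ∀ n, ∫ w, f n w ∂σ ≤ K := by
    intro n
    simp only [f]
    rw [integral_neg]
    exact hK _ (hRn n)
  have hint : Integrable (fun w => -Real.log ‖z - w‖) σ := by
    exact integrable_of_monotone_of_integral_le hfi hmono hlim hbd
  have hT := integral_tendsto_of_tendsto_of_monotone hfi hint (Eventually.of_forall hmono) hlim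
  refine ⟨by simpa using hint.neg, le_of_tendsto' hT hbd, ?_⟩
  refine hT.congr fun n => ?_
  simp only [f]
  rw [integral_neg]

/-! ### Energies as Bochner integrals -/

lemma extIntegral_of_integrable {α : Type*} [MeasurableSpace α] {μ : Measure α} {F : α → EReal}
    {f : α → ℝ} (hf : Integrable f μ) (hF : ∀ᵐ x ∂μ, F x = (f x : EReal)) :
    extIntegral μ F = ((∫ x, f x ∂μ : ℝ) : EReal) := by
  have h1 : ∫⁻ x, (F x).toENNReal ∂μ = ∫⁻ x, ENNReal.ofReal (f x) ∂μ := by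
    apply lintegral_congr_ae
    filter_upwards [hF] with x hx
    rw [hx, EReal.toENNReal_of_ne_top (EReal.coe_ne_top _), EReal.toReal_coe]
  have h2 : ∫⁻ x, (-F x).toENNReal ∂μ = ∫⁻ x, ENNReal.ofReal (-f x) ∂μ := by
    apply lintegral_congr_ae
    filter_upwards [hF] with x hx
    rw [hx, ← EReal.coe_neg, EReal.toENNReal_of_ne_top (EReal.coe_ne_top _), EReal.toReal_coe]
  have hp : ∫⁻ x, ENNReal.ofReal (f x) ∂μ ≠ ⊤ := hf.lintegral_lt_top.ne
  have hn : ∫⁻ x, ENNReal.ofReal (-f x) ∂μ ≠ ⊤ := hf.neg.lintegral_lt_top.ne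
  rw [extIntegral, h1, h2, integral_eq_lintegral_pos_part_sub_lintegral_neg_part hf,
    EReal.coe_sub, EReal.coe_ennreal_toReal hp, EReal.coe_ennreal_toReal hn]

lemma integrable_of_lintegral_lt_top {α : Type*} [MeasurableSpace α] {μ : Measure α}
    {f : α → ℝ} (hf : AEMeasurable f μ)
    (hp : ∫⁻ x, ENNReal.ofReal (f x) ∂μ ≠ ⊤) (hn : ∫⁻ x, ENNReal.ofReal (-f x) ∂μ ≠ ⊤) :
    Integrable f μ := by
  refine ⟨hf.aestronglyMeasurable, ?_⟩
  rw [HasFiniteIntegral]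
  calc ∫⁻ x, ‖f x‖ₑ ∂μ ≤ ∫⁻ x, (ENNReal.ofReal (f x) + ENNReal.ofReal (-f x)) ∂μ := by
        apply lintegral_mono
        intro x
        beta_reduce
        rw [Real.enorm_eq_ofReal_abs]
        rcases le_total 0 (f x) with h | h
        · rw [abs_of_nonneg h]; exact le_self_add
        · rw [abs_of_nonpos h]; exact le_add_self
    _ = _ := lintegral_add_left' hf.ennreal_ofReal _
    _ < ⊤ := ENNReal.add_lt_top.2 ⟨hp.lt_top, hn.lt_top⟩

lemma lintegral_toENNReal_neg_lt_top {α : Type*} [MeasurableSpace α] {μ : Measure α}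
    [IsFiniteMeasure μ] {F : α → EReal} {m : ℝ} (hF : ∀ᵐ x ∂μ, -(m : EReal) ≤ F x) :
    ∫⁻ x, (-F x).toENNReal ∂μ < ⊤ := by
  calc ∫⁻ x, (-F x).toENNReal ∂μ ≤ ∫⁻ _, ENNReal.ofReal m ∂μ := by
        apply lintegral_mono_ae
        filter_upwards [hF] with x hx
        have : -F x ≤ (m : EReal) := EReal.neg_le.1 hx
        calc (-F x).toENNReal ≤ (m : EReal).toENNReal := EReal.toENNReal_le_toENNReal this
          _ = ENNReal.ofReal m := by
            rw [EReal.toENNReal_of_ne_top (EReal.coe_ne_top _), EReal.toReal_coe]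
    _ < ⊤ := by
        rw [lintegral_const]
        exact ENNReal.mul_lt_top ENNReal.ofReal_lt_top (measure_lt_top _ _)

lemma neg_log_enorm_eq {z : ℂ} (hz : z ≠ 0) :
    -ENNReal.log ‖z‖ₑ = ((-Real.log ‖z‖ : ℝ) : EReal) := by
  rw [ENNReal.log_pos_real (by simpa using hz) (by simp), toReal_enorm, EReal.coe_neg]

lemma measurable_neg_log_enorm :
    Measurable fun p : ℂ × ℂ => -ENNReal.log ‖p.1 - p.2‖ₑ :=
  (ENNReal.measurable_log.comp (measurable_fst.sub measurable_snd).enorm).neg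

lemma measurableSet_diagonal_complex : MeasurableSet {p : ℂ × ℂ | p.1 = p.2} :=
  measurableSet_eq_fun measurable_fst measurable_snd

/-- The energy of a measure without mutual point masses is a Bochner integral. -/
lemma extIntegral_log_of_integrable {π : Measure (ℂ × ℂ)} (hd : ∀ᵐ p ∂π, p.1 ≠ p.2)
    (hi : Integrable (fun p : ℂ × ℂ => Real.log ‖p.1 - p.2‖) π) :
    extIntegral π (fun p => -ENNReal.log ‖p.1 - p.2‖ₑ) =
      ((-∫ p, Real.log ‖p.1 - p.2‖ ∂π : ℝ) : EReal) := by
  rw [← integral_neg]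
  apply extIntegral_of_integrable hi.neg
  filter_upwards [hd] with p hp
  exact neg_log_enorm_eq (sub_ne_zero.2 hp)

lemma ae_prod_ne_of_singleton {μ ν : Measure ℂ} [SFinite μ] [SFinite ν] (hμ : ∀ z, μ {z} = 0) :
    ∀ᵐ p ∂μ.prod ν, p.1 ≠ p.2 := by
  rw [ae_iff]
  have : {p : ℂ × ℂ | ¬ p.1 ≠ p.2} = {p : ℂ × ℂ | p.1 = p.2} := by ext; simp
  rw [this, Measure.prod_apply_symm measurableSet_diagonal_complex]
  have : ∀ y : ℂ, (fun x => (x, y)) ⁻¹' {p : ℂ × ℂ | p.1 = p.2} = {y} := by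
    intro y; ext; simp
  simp [this, hμ]

/-- An atom at z would give the diagonal point (z, z) positive mass in the product. -/
lemma singleton_of_ae_prod_ne {μ : Measure ℂ} [SFinite μ] (h : ∀ᵐ p ∂μ.prod μ, p.1 ≠ p.2) (z : ℂ) :
    μ {z} = 0 := by
  rw [ae_iff] at h
  have h2 : (μ.prod μ) ({z} ×ˢ {z}) = 0 := by
    refine measure_mono_null ?_ h
    rintro ⟨x, y⟩ ⟨hx, hy⟩
    simp only [mem_singleton_iff] at hx hy
    simp [hx, hy]
  rw [Measure.prod_prod] at h2
  simpa using h2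

/-- Finiteness of the extended integrals yields integrability. -/
lemma integrable_of_extIntegral_ne_top {α : Type*} [MeasurableSpace α] {μ : Measure α}
    [IsFiniteMeasure μ] {F : α → EReal} {m : ℝ} (hFm : Measurable F)
    (hF : ∀ᵐ x ∂μ, -(m : EReal) ≤ F x) (h : extIntegral μ F ≠ ⊤) :
    (∀ᵐ x ∂μ, F x ≠ ⊤) ∧
      ∀ f : α → ℝ, Measurable f → (∀ᵐ x ∂μ, F x ≠ ⊤ → F x = (f x : EReal)) → Integrable f μ := by
  have hn := lintegral_toENNReal_neg_lt_top hF
  have hp : ∫⁻ x, (F x).toENNReal ∂μ ≠ ⊤ := by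
    intro htop
    apply h
    rw [extIntegral, htop, EReal.coe_ennreal_top, EReal.top_sub (by simpa using hn.ne)]
  have hne : ∀ᵐ x ∂μ, F x ≠ ⊤ := by
    filter_upwards [ae_lt_top (measurable_ereal_toENNReal.comp hFm) hp] with x hx
    intro hx2
    simp [hx2] at hx
  refine ⟨hne, fun f hf hfF => ?_⟩
  have hEq : ∀ᵐ x ∂μ, F x = (f x : EReal) := by
    filter_upwards [hne, hfF] with x h1 h2 using h2 h1
  apply integrable_of_lintegral_lt_top hf.aemeasurable
  · rwa [lintegral_congr_ae (g := fun x => (F x).toENNReal)]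
    filter_upwards [hEq] with x hx
    rw [hx, EReal.toENNReal_of_ne_top (EReal.coe_ne_top _), EReal.toReal_coe]
  · rw [lintegral_congr_ae (g := fun x => (-F x).toENNReal)]
    · exact hn.ne
    filter_upwards [hEq] with x hx
    rw [hx, ← EReal.coe_neg, EReal.toENNReal_of_ne_top (EReal.coe_ne_top _), EReal.toReal_coe]

/-! ### The Euler–Lagrange conditions -/

lemma log_norm_sub_swap :
    (fun p : ℂ × ℂ => Real.log ‖p.1 - p.2‖) ∘ Prod.swap = fun p => Real.log ‖p.1 - p.2‖ := by
  ext p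
  simp [norm_sub_rev]

lemma isCompact_support_circleMeasure (c : ℂ) {R : ℝ} (hR : 0 ≤ R) :
    IsCompact (circleMeasure c R).support :=
  (isCompact_sphere c R).of_isClosed_subset Measure.isClosed_support
    (Measure.support_subset_of_isClosed Metric.isClosed_sphere (ae_circleMeasure_mem_sphere c hR))

lemma ae_norm_le_of_isCompact_support {σ : Measure ℂ} (h : IsCompact σ.support) :
    ∃ M : ℝ, ∀ᵐ w ∂σ, ‖w‖ ≤ M := by
  obtain ⟨M, hM⟩ := h.isBounded.exists_norm_le
  refine ⟨M, ?_⟩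
  filter_upwards [Measure.support_mem_ae (μ := σ)] with w hw using hM w hw

/-- The weighted energy of a measure of finite logarithmic energy. -/
lemma weightedEnergy_eq {Q : ℂ → ℝ} {μ : Measure ℂ} [IsFiniteMeasure μ] (hμ : ∀ z, μ {z} = 0)
    (hi : Integrable (fun p : ℂ × ℂ => Real.log ‖p.1 - p.2‖) (μ.prod μ)) (hQ : Integrable Q μ) :
    weightedEnergy Q μ =
      ((-∫ p, Real.log ‖p.1 - p.2‖ ∂μ.prod μ + ∫ z, Q z ∂μ : ℝ) : EReal) := by
  rw [weightedEnergy, extIntegral_log_of_integrable (ae_prod_ne_of_singleton hμ) hi,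
    extIntegral_of_integrable hQ (Eventually.of_forall fun _ => rfl), EReal.coe_add]

/-- A compactly supported measure whose weighted energy is not `+∞` has finite logarithmic energy
and no point masses. -/
lemma integrable_of_weightedEnergy_ne_top {Q : ℂ → ℝ} (hQ : LowerSemicontinuous Q)
    {σ : Measure ℂ} [IsProbabilityMeasure σ] (hc : IsCompact σ.support)
    (h : weightedEnergy Q σ ≠ ⊤) :
    (∀ z, σ {z} = 0) ∧ Integrable (fun p : ℂ × ℂ => Real.log ‖p.1 - p.2‖) (σ.prod σ) ∧
      Integrable Q σ := by
  obtain ⟨M, hM⟩ := ae_norm_le_of_isCompact_support hc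
  have hM2 : ∀ᵐ p ∂σ.prod σ, ‖p.1‖ ≤ M ∧ ‖p.2‖ ≤ M :=
    (Measure.quasiMeasurePreserving_fst.ae hM).and (Measure.quasiMeasurePreserving_snd.ae hM)
  have hlow1 : ∀ᵐ p ∂σ.prod σ,
      -((Real.posLog (2 * M) : ℝ) : EReal) ≤ -ENNReal.log ‖p.1 - p.2‖ₑ := by
    filter_upwards [hM2] with p hp
    rw [EReal.neg_le_neg_iff]
    by_cases h0 : p.1 - p.2 = 0
    · simp [h0]
    · rw [ENNReal.log_pos_real (by simpa using h0) (by simp), toReal_enorm, EReal.coe_le_coe_iff]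
      exact le_trans (le_max_right _ _) (posLog_norm_sub_le hp.1 hp.2)
  obtain ⟨m, hm⟩ := (hQ.lowerSemicontinuousOn _).bddBelow_of_isCompact hc
  have hlow2 : ∀ᵐ z ∂σ, -((-m : ℝ) : EReal) ≤ ((Q z : ℝ) : EReal) := by
    filter_upwards [Measure.support_mem_ae (μ := σ)] with z hz
    rw [← EReal.coe_neg, EReal.coe_le_coe_iff, neg_neg]
    exact hm (mem_image_of_mem _ hz)
  -- Neither integral may be -∞: in `EReal` one has ⊤ + ⊥ = ⊥, which would hide an infinite term.
  -- With both bounded below, a sum different from ⊤ forces both to be finite.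
  have hbot : ∀ {α : Type} [MeasurableSpace α] {μ : Measure α} [IsFiniteMeasure μ] {F : α → EReal}
      {m : ℝ}, (∀ᵐ x ∂μ, -(m : EReal) ≤ F x) → extIntegral μ F ≠ ⊥ := by
    intro α _ μ _ F m hF
    have := lintegral_toENNReal_neg_lt_top hF
    rw [extIntegral, sub_eq_add_neg]
    intro hb
    rw [EReal.add_eq_bot_iff] at hb
    rcases hb with hb | hb
    · exact EReal.coe_ennreal_ne_bot _ hb
    · rw [EReal.neg_eq_bot_iff] at hb
      exact this.ne (by simpa using hb)
  have hb1 := hbot hlow1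
  have hb2 := hbot hlow2
  have ht1 : extIntegral (σ.prod σ) (fun p => -ENNReal.log ‖p.1 - p.2‖ₑ) ≠ ⊤ := by
    intro ht
    rw [weightedEnergy, ht, EReal.top_add_of_ne_bot hb2] at h
    exact h rfl
  have ht2 : extIntegral σ (fun z => ((Q z : ℝ) : EReal)) ≠ ⊤ := by
    intro ht
    rw [weightedEnergy, ht, EReal.add_top_of_ne_bot hb1] at h
    exact h rfl
  obtain ⟨hne, hint⟩ := integrable_of_extIntegral_ne_top measurable_neg_log_enorm hlow1 ht1
  obtain ⟨-, hint2⟩ := integrable_of_extIntegral_ne_top hQ.measurable.coe_real_ereal hlow2 ht2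
  refine ⟨singleton_of_ae_prod_ne ?_, ?_, hint2 Q hQ.measurable (Eventually.of_forall fun _ _ => rfl)⟩
  · filter_upwards [hne] with p hp heq
    apply hp
    simp [heq]
  · have := hint _ measurable_log_norm_sub_prod.neg (Eventually.of_forall fun p hp => ?_)
    · simpa using this.neg
    · apply neg_log_enorm_eq
      intro h0
      apply hp
      simp [h0]

/-- Bilinearity of the energy; the symmetry `hf` merges the two mixed terms. -/
lemma integral_prod_convexCombination {σ μ : Measure ℂ} [IsFiniteMeasure σ] [IsFiniteMeasure μ]
    {f : ℂ × ℂ → ℝ} (hf : f ∘ Prod.swap = f) (h11 : Integrable f (σ.prod σ))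
    (h12 : Integrable f (μ.prod σ)) (h22 : Integrable f (μ.prod μ)) {s t : ℝ} (hs : 0 ≤ s)
    (ht : 0 ≤ t) :
    Integrable f ((ENNReal.ofReal s • σ + ENNReal.ofReal t • μ).prod
        (ENNReal.ofReal s • σ + ENNReal.ofReal t • μ)) ∧
      ∫ p, f p ∂((ENNReal.ofReal s • σ + ENNReal.ofReal t • μ).prod
        (ENNReal.ofReal s • σ + ENNReal.ofReal t • μ)) =
      s ^ 2 * ∫ p, f p ∂σ.prod σ + 2 * s * t * ∫ p, f p ∂μ.prod σ + t ^ 2 * ∫ p, f p ∂μ.prod μ := by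
  have h21 : Integrable f (σ.prod μ) := by
    have := h12.swap
    rwa [hf] at this
  have e21 : ∫ p, f p ∂σ.prod μ = ∫ p, f p ∂μ.prod σ := by
    rw [← integral_prod_swap]
    exact integral_congr_ae (Eventually.of_forall fun p => congrFun hf p)
  have fs : ENNReal.ofReal s ≠ ⊤ := ENNReal.ofReal_ne_top
  have ft : ENNReal.ofReal t ≠ ⊤ := ENNReal.ofReal_ne_top
  rw [Measure.prod_add, Measure.add_prod, Measure.add_prod]
  simp only [Measure.prod_smul_left, Measure.prod_smul_right]
  have i1 := (h11.smul_measure fs).smul_measure fs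
  have i2 := (h12.smul_measure ft).smul_measure fs
  have i3 := (h21.smul_measure fs).smul_measure ft
  have i4 := (h22.smul_measure ft).smul_measure ft
  refine ⟨(i1.add_measure i2).add_measure (i3.add_measure i4), ?_⟩
  rw [integral_add_measure (i1.add_measure i2) (i3.add_measure i4),
    integral_add_measure i1 i2, integral_add_measure i3 i4]
  simp only [integral_smul_measure, ENNReal.toReal_ofReal hs, ENNReal.toReal_ofReal ht, e21,
    smul_eq_mul]
  ring

/-- First variation of the energy towards the uniform measure on a circle. -/
lemma variation_circleMeasure {Q : ℂ → ℝ} {σ : Measure ℂ} (hσ : IsEquilibriumMeasure Q σ)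
    (hat : ∀ z, σ {z} = 0)
    (hlog : Integrable (fun p : ℂ × ℂ => Real.log ‖p.1 - p.2‖) (σ.prod σ))
    (hQ : Integrable Q σ) (c : ℂ) {R : ℝ} (hR : 0 < R) (hQc : Integrable Q (circleMeasure c R)) :
    ∫ z, Q z ∂σ - 2 * ∫ p, Real.log ‖p.1 - p.2‖ ∂σ.prod σ ≤
      ∫ z, Q z ∂circleMeasure c R - 2 * ∫ w, Real.log (max R ‖c - w‖) ∂σ := by
  obtain ⟨hprob, hcomp, hmin⟩ := hσ
  obtain ⟨M, hM⟩ := ae_norm_le_of_isCompact_support hcomp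
  set μ := circleMeasure c R with hμ
  obtain ⟨M', hM'⟩ := ae_norm_le_of_isCompact_support (isCompact_support_circleMeasure c hR.le)
  have h12 := integrable_log_circleMeasure_prod hM c hR
  have h22 := integrable_log_circleMeasure_prod hM' c hR
  rw [← hμ] at h12 h22
  have e12 : ∫ p, Real.log ‖p.1 - p.2‖ ∂μ.prod σ = ∫ w, Real.log (max R ‖c - w‖) ∂σ := by
    rw [integral_prod_symm _ h12]
    congr 1
    ext w
    exact integral_log_circleMeasure w c hR
  rw [← e12]
  set I := ∫ p, Real.log ‖p.1 - p.2‖ ∂σ.prod σ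
  set J := ∫ p, Real.log ‖p.1 - p.2‖ ∂μ.prod σ
  set K := ∫ p, Real.log ‖p.1 - p.2‖ ∂μ.prod μ
  set q := ∫ z, Q z ∂σ
  set q' := ∫ z, Q z ∂μ
  have hatμ : ∀ z, μ {z} = 0 := (nullSingleton_circleMeasure c hR.ne').measure_singleton
  -- Minimality is tested against (1-t)σ + tμ. The energy is quadratic in t, so its increment is t
  -- times the first variation plus t² times a fixed number.
  have key : ∀ t : ℝ, 0 < t → t ≤ 1 → 0 ≤ t * ((q' - 2 * J) - (q - 2 * I)) + t ^ 2 * (2 * J - I - K) := by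
    intro t ht0 ht1
    have hs : 0 ≤ 1 - t := by linarith
    set ν := ENNReal.ofReal (1 - t) • σ + ENNReal.ofReal t • μ with hν
    have hνp : IsProbabilityMeasure ν := by
      constructor
      simp only [hν, Measure.add_apply, Measure.smul_apply, measure_univ, smul_eq_mul, mul_one]
      rw [← ENNReal.ofReal_add hs ht0.le]
      simp
    have hνc : IsCompact ν.support := by
      refine (hcomp.union (isCompact_support_circleMeasure c hR.le)).of_isClosed_subset
        Measure.isClosed_support ?_
      rw [hν, Measure.support_add]
      exact union_subset_union (Measure.smul_absolutelyContinuous.support_mono)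
        (Measure.smul_absolutelyContinuous.support_mono)
    obtain ⟨hi, he⟩ := integral_prod_convexCombination log_norm_sub_swap hlog h12 h22 hs ht0.le
    rw [← hν] at hi he
    have hνa : ∀ z, ν {z} = 0 := by
      intro z
      simp [hν, hat, hatμ]
    have iq1 := hQ.smul_measure (ENNReal.ofReal_ne_top (r := 1 - t))
    have iq2 := hQc.smul_measure (ENNReal.ofReal_ne_top (r := t))
    have hQν : Integrable Q ν := iq1.add_measure iq2
    have hle := hmin ν hνp hνc
    rw [weightedEnergy_eq hνa hi hQν, weightedEnergy_eq hat hlog hQ, EReal.coe_le_coe_iff, he, hν,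
      integral_add_measure iq1 iq2, integral_smul_measure, integral_smul_measure,
      ENNReal.toReal_ofReal hs, ENNReal.toReal_ofReal ht0.le, smul_eq_mul, smul_eq_mul] at hle
    change -I + q ≤ -((1 - t) ^ 2 * I + 2 * (1 - t) * t * J + t ^ 2 * K) +
      ((1 - t) * q + t * q') at hle
    linarith
  by_contra! hlt
  set D := (q' - 2 * J) - (q - 2 * I) with hD
  have hD0 : D < 0 := by linarith
  set X := 2 * J - I - K
  -- Small enough that t|X| ≤ -D/2, hence D + tX < 0.
  set t := min 1 (-D / (2 * (|X| + 1)))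
  have hX : 0 < |X| + 1 := by positivity
  have ht0 : 0 < t := lt_min one_pos (div_pos (by linarith) (by positivity))
  have h1 := key t ht0 (min_le_left _ _)
  have h2 : t * (2 * (|X| + 1)) ≤ -D := by
    rw [← le_div_iff₀ (by positivity)]
    exact min_le_right _ _
  have h3 : t * X ≤ t * |X| := mul_le_mul_of_nonneg_left (le_abs_self X) ht0.le
  have h4 : 0 ≤ t * (D + t * X) := by linarith
  have h5 := (mul_nonneg_iff_of_pos_left ht0).1 h4
  nlinarith [abs_nonneg X]

lemma integrable_circleMeasure_of_continuousOn {Q : ℂ → ℝ} (hQ : Measurable Q) {c : ℂ} {R : ℝ}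
    (hR : 0 ≤ R) (hc : ContinuousOn Q (Metric.sphere c R)) : Integrable Q (circleMeasure c R) :=
  (integrable_circleMeasure_iff hQ c R).2 (hc.circleIntegrable hR)

/-- Existence of finite energy competitors forces finite energy of the equilibrium measure. -/
lemma IsEquilibriumMeasure.integrable {Q : ℂ → ℝ} (hQ : LowerSemicontinuous Q) {σ : Measure ℂ}
    (hσ : IsEquilibriumMeasure Q σ) {c : ℂ} {R : ℝ} (hR : 0 < R)
    (hc : ContinuousOn Q (Metric.sphere c R)) :
    (∀ z, σ {z} = 0) ∧ Integrable (fun p : ℂ × ℂ => Real.log ‖p.1 - p.2‖) (σ.prod σ) ∧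
      Integrable Q σ := by
  have hprob := hσ.1
  refine integrable_of_weightedEnergy_ne_top hQ hσ.2.1 ?_
  obtain ⟨M', hM'⟩ := ae_norm_le_of_isCompact_support (isCompact_support_circleMeasure c hR.le)
  have h := hσ.2.2 (circleMeasure c R) inferInstance (isCompact_support_circleMeasure c hR.le)
  rw [weightedEnergy_eq (nullSingleton_circleMeasure c hR.ne').measure_singleton
    (integrable_log_circleMeasure_prod hM' c hR)
    (integrable_circleMeasure_of_continuousOn hQ.measurable hR.le hc)] at h
  exact (h.trans_lt (EReal.coe_lt_top _)).ne

lemma neg_integral_log_max_le_logPotential {σ : Measure ℂ} [IsFiniteMeasure σ] {M : ℝ}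
    (hM : ∀ᵐ w ∂σ, ‖w‖ ≤ M) {z : ℂ} (hz : Integrable (fun w => Real.log ‖z - w‖) σ)
    (hat : σ {z} = 0) {R : ℝ} (hR : 0 < R) :
    -∫ w, Real.log (max R ‖z - w‖) ∂σ ≤ logPotential σ z := by
  rw [logPotential, integral_neg, neg_le_neg_iff]
  apply integral_mono_ae hz (integrable_log_max hM z hR)
  -- At w = z the default `Real.log 0 = 0` exceeds `Real.log R` for small R, so this point must be
  -- negligible.
  have : ∀ᵐ w ∂σ, w ≠ z := by rw [ae_iff]; simpa using hat
  filter_upwards [this] with w hw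
  exact Real.log_le_log (norm_pos_iff.2 (sub_ne_zero.2 hw.symm)) (le_max_right _ _)

/-- Potential-theoretic properties of the equilibrium measure when the external field is
continuous on a neighbourhood of the droplet. -/
lemma IsEquilibriumMeasure.eulerLagrange {Q : ℂ → ℝ} (hQ : LowerSemicontinuous Q) {σ : Measure ℂ}
    (hσ : IsEquilibriumMeasure Q σ) {U : Set ℂ} (hU : IsOpen U) (hSU : σ.support ⊆ U)
    (hQU : ContinuousOn Q U) :
    (∀ z, Integrable (fun w => Real.log ‖z - w‖) σ) ∧
    (∀ z, Tendsto (fun n : ℕ => -∫ w, Real.log (max (1 / ((n : ℝ) + 1)) ‖z - w‖) ∂σ) atTop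
        (𝓝 (logPotential σ z))) ∧
    (∀ z, σ {z} = 0) ∧
    (∀ z ∈ σ.support, obstacle Q σ z = Q z) := by
  have hprob := hσ.1
  have hcomp := hσ.2.1
  obtain ⟨M, hM⟩ := ae_norm_le_of_isCompact_support hcomp
  have hsmall : ∀ z ∈ σ.support, ∃ ε > 0, Metric.closedBall z ε ⊆ U := fun z hz =>
    Metric.nhds_basis_closedBall.mem_iff.1 (hU.mem_nhds (hSU hz))
  have hfin : (∀ z, σ {z} = 0) ∧
      Integrable (fun p : ℂ × ℂ => Real.log ‖p.1 - p.2‖) (σ.prod σ) ∧ Integrable Q σ := by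
    obtain ⟨z, hz⟩ := Measure.nonempty_support (μ := σ) (IsProbabilityMeasure.ne_zero σ)
    obtain ⟨ε, hε, hεU⟩ := hsmall z hz
    exact hσ.integrable hQ hε (hQU.mono (Metric.sphere_subset_closedBall.trans hεU))
  obtain ⟨hat, hlog, hQi⟩ := hfin
  set I := ∫ p, Real.log ‖p.1 - p.2‖ ∂σ.prod σ with hI
  set γ := ∫ z, Q z ∂σ - 2 * I with hγ
  -- almost everywhere statements on the support
  have hsec : ∀ᵐ z ∂σ, Integrable (fun w => Real.log ‖z - w‖) σ :=
    ((integrable_prod_iff measurable_log_norm_sub_prod.aestronglyMeasurable).1 hlog).1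
  have hmaxle : ∀ z, Integrable (fun w => Real.log ‖z - w‖) σ → ∀ R : ℝ, 0 < R →
      -∫ w, Real.log (max R ‖z - w‖) ∂σ ≤ logPotential σ z :=
    fun z hz R hR => neg_integral_log_max_le_logPotential hM hz (hat z) hR
  -- Variation towards a small circle about z: the mean of Q is at most Q(z) + e by continuity, and
  -- the mean of the potential is a truncated potential, which is at most U(z).
  have hlower : ∀ z ∈ σ.support, Integrable (fun w => Real.log ‖z - w‖) σ →
      γ ≤ Q z + 2 * logPotential σ z := by
    intro z hz hzi
    refine le_of_forall_pos_le_add fun e he => ?_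
    have hcont : ContinuousAt Q z := hQU.continuousAt (hU.mem_nhds (hSU hz))
    obtain ⟨ε, hε, hεU⟩ := Metric.nhds_basis_closedBall.mem_iff.1
      (inter_mem (hU.mem_nhds (hSU hz)) (hcont.preimage_mem_nhds (Iio_mem_nhds (lt_add_of_pos_right _ he))))
    have hsub := Metric.sphere_subset_closedBall.trans hεU
    have hQc := integrable_circleMeasure_of_continuousOn hQ.measurable hε.le
      (hQU.mono (hsub.trans inter_subset_left))
    have hvar := variation_circleMeasure hσ hat hlog hQi z hε hQc
    have h1 : ∫ y, Q y ∂circleMeasure z ε ≤ Q z + e := by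
      calc ∫ y, Q y ∂circleMeasure z ε ≤ ∫ _, (Q z + e) ∂circleMeasure z ε := by
            apply integral_mono_ae hQc (integrable_const _)
            filter_upwards [ae_circleMeasure_mem_sphere z hε.le] with y hy
            exact (hsub hy).2.le
        _ = Q z + e := by simp
    have h2 := hmaxle z hzi ε hε
    linarith
  have hUi : Integrable (logPotential σ) σ := hlog.neg.integral_prod_left
  have hUint : ∫ z, logPotential σ z ∂σ = -I := by
    unfold logPotential
    rw [integral_integral (f := fun z w => -Real.log ‖z - w‖) hlog.neg, integral_neg]
  have hγ' : robinConstant Q σ = γ := by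
    rw [robinConstant, integral_add hQi (hUi.const_mul 2), integral_const_mul, hUint, hγ]
    ring
  -- Q + 2U - γ is nonnegative almost everywhere and has σ-integral zero, since γ is the integral of
  -- Q + 2U.
  have hae : ∀ᵐ z ∂σ, Q z + 2 * logPotential σ z = γ := by
    have hnn : 0 ≤ᵐ[σ] fun z => Q z + 2 * logPotential σ z - γ := by
      filter_upwards [hsec, Measure.support_mem_ae (μ := σ)] with z hz hzS
      simpa using hlower z hzS hz
    have hint : Integrable (fun z => Q z + 2 * logPotential σ z - γ) σ :=
      (hQi.add (hUi.const_mul 2)).sub (integrable_const _)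
    have h0 : ∫ z, (Q z + 2 * logPotential σ z - γ) ∂σ = 0 := by
      have hsum : Integrable (fun z => Q z + 2 * logPotential σ z) σ := hQi.add (hUi.const_mul 2)
      have := hγ'
      rw [robinConstant] at this
      rw [integral_sub hsum (integrable_const _), this]
      simp
    have := (integral_eq_zero_iff_of_nonneg_ae hnn hint).1 h0
    filter_upwards [this] with z hz
    simpa [sub_eq_zero] using hz
  -- truncated potentials are bounded on the support
  have hupper : ∀ z ∈ σ.support, ∀ R : ℝ, 0 < R →
      -∫ w, Real.log (max R ‖z - w‖) ∂σ ≤ (γ - Q z) / 2 := by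
    intro z hz R hR
    by_contra! hlt
    -- Both sides are continuous, so a strict failure at a support point persists on a
    -- neighbourhood, which has positive σ-measure. But almost everywhere the truncated potential is
    -- at most U = (γ - Q)/2.
    have hcont : ContinuousAt (fun z => (γ - Q z) / 2 + ∫ w, Real.log (max R ‖z - w‖) ∂σ) z :=
      ((continuousAt_const.sub (hQU.continuousAt (hU.mem_nhds (hSU hz)))).div_const 2).add
        (continuous_integral_log_max hM hR).continuousAt
    have hnb : ∀ᶠ y in 𝓝 z, (γ - Q y) / 2 + ∫ w, Real.log (max R ‖y - w‖) ∂σ < 0 :=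
      hcont.eventually (gt_mem_nhds (by linarith))
    have hpos := (Measure.mem_support_iff_forall z).1 hz _ hnb
    have hnull : σ {y | (γ - Q y) / 2 + ∫ w, Real.log (max R ‖y - w‖) ∂σ < 0} = 0 := by
      have : ∀ᵐ y ∂σ, ¬ ((γ - Q y) / 2 + ∫ w, Real.log (max R ‖y - w‖) ∂σ < 0) := by
        filter_upwards [hae, hsec] with y hy1 hy2
        have := hmaxle y hy2 R hR
        linarith
      simpa [ae_iff] using this
    exact hpos.ne' hnull
  have hoff : ∀ z ∉ σ.support, ∃ K : ℝ, ∀ R : ℝ, 0 < R →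
      -∫ w, Real.log (max R ‖z - w‖) ∂σ ≤ K := by
    intro z hz
    obtain ⟨ε, hε, hεS⟩ := Metric.nhds_basis_ball.mem_iff.1
      (Measure.isOpen_compl_support.mem_nhds (show z ∈ σ.supportᶜ from hz))
    refine ⟨-Real.log ε, fun R hR => ?_⟩
    rw [neg_le_neg_iff]
    calc Real.log ε = ∫ _, Real.log ε ∂σ := by simp
      _ ≤ _ := by
        apply integral_mono_ae (integrable_const _) (integrable_log_max hM z hR)
        filter_upwards [Measure.support_mem_ae (μ := σ)] with w hw
        apply Real.log_le_log hε
        apply le_max_of_le_right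
        by_contra! hlt
        exact hεS (by rwa [Metric.mem_ball, dist_eq_norm, norm_sub_rev] : w ∈ Metric.ball z ε) hw
  have hall : ∀ z, ∃ K : ℝ, ∀ R : ℝ, 0 < R → -∫ w, Real.log (max R ‖z - w‖) ∂σ ≤ K := by
    intro z
    by_cases hz : z ∈ σ.support
    · exact ⟨_, hupper z hz⟩
    · exact hoff z hz
  refine ⟨fun z => ?_, fun z => ?_, hat, fun z hz => ?_⟩
  · obtain ⟨K, hK⟩ := hall z
    exact (integrable_log_of_bound hM z (hat z) hK).1
  · obtain ⟨K, hK⟩ := hall z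
    exact (integrable_log_of_bound hM z (hat z) hK).2.2
  · have h := integrable_log_of_bound hM z (hat z) (hupper z hz)
    have h1 := hlower z hz h.1
    rw [obstacle, hγ']
    linarith [h.2.1]

/-! ### The obstacle function in a gap -/

/-- The potential is the increasing limit of continuous truncated potentials. -/
lemma lowerSemicontinuous_logPotential {σ : Measure ℂ} [IsFiniteMeasure σ] {M : ℝ}
    (hM : ∀ᵐ w ∂σ, ‖w‖ ≤ M) (hi : ∀ z, Integrable (fun w => Real.log ‖z - w‖) σ)
    (hat : ∀ z, σ {z} = 0)
    (hlim : ∀ z, Tendsto (fun n : ℕ => -∫ w, Real.log (max (1 / ((n : ℝ) + 1)) ‖z - w‖) ∂σ) atTop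
        (𝓝 (logPotential σ z))) :
    LowerSemicontinuous (logPotential σ) := by
  intro z y hy
  obtain ⟨n, hn⟩ := ((hlim z).eventually (lt_mem_nhds hy)).exists
  have hpos : (0 : ℝ) < 1 / ((n : ℝ) + 1) := by positivity
  filter_upwards [(continuous_integral_log_max hM hpos).neg.continuousAt.eventually
    (lt_mem_nhds hn)] with x hx
  exact hx.trans_le (neg_integral_log_max_le_logPotential hM (hi x) (hat x) hpos)

lemma circleMeasure_pos_of_isOpen {c : ℂ} {R : ℝ} {V : Set ℂ} (hV : IsOpen V) {z : ℂ}
    (hz : z ∈ V) (hzc : z ∈ Metric.sphere c R) (hR : 0 ≤ R) : 0 < circleMeasure c R V := by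
  obtain ⟨θ, hθ, rfl⟩ : ∃ θ ∈ Ioc 0 (2 * Real.pi), circleMap c R θ = z := by
    have := image_circleMap_Ioc c R
    rw [abs_of_nonneg hR] at this
    rw [← this] at hzc
    exact hzc
  have hO : IsOpen (circleMap c R ⁻¹' V) := hV.preimage (continuous_circleMap c R)
  -- The angle may be the endpoint 2π; openness moves it into the open interval.
  have hne : (circleMap c R ⁻¹' V ∩ Ioo 0 (2 * Real.pi)).Nonempty := by
    have hcl : θ ∈ closure (Ioo 0 (2 * Real.pi)) := by
      rw [closure_Ioo (by positivity)]
      exact Ioc_subset_Icc_self hθ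
    exact mem_closure_iff.1 hcl _ hO hz
  have hpos : 0 < volume (circleMap c R ⁻¹' V ∩ Ioo 0 (2 * Real.pi)) :=
    (hO.inter isOpen_Ioo).measure_pos _ hne
  rw [circleMeasure, Measure.map_apply (measurable_circleMap c R) hV.measurableSet,
    Measure.smul_apply, Measure.restrict_apply hO.measurableSet, smul_eq_mul]
  refine ENNReal.mul_pos (by simp [Real.pi_pos]) ?_
  exact (hpos.trans_le (measure_mono (inter_subset_inter_right _ Ioo_subset_Ioc_self))).ne'

lemma integral_pos_of_pos_on {α : Type*} [MeasurableSpace α] {μ : Measure α} {f : α → ℝ}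
    (hf : 0 ≤ᵐ[μ] f) (hi : Integrable f μ) {s : Set α} (hs : ∀ x ∈ s, 0 < f x) (hμ : 0 < μ s) :
    0 < ∫ x, f x ∂μ := by
  rw [integral_pos_iff_support_of_nonneg_ae hf hi]
  exact hμ.trans_le (measure_mono fun x hx => (hs x hx).ne')

/-- The minimum principle in a closed annulus for a lower semicontinuous function dominating its
averages over small circles. -/
lemma nonneg_of_superharmonic_annulus {h : ℂ → ℝ} {r₁ r₂ : ℝ} (h12 : r₁ < r₂) (h0 : 0 < r₁)
    (hl : LowerSemicontinuousOn h {z | r₁ ≤ ‖z‖ ∧ ‖z‖ ≤ r₂})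
    (hb : ∀ z, ‖z‖ = r₁ ∨ ‖z‖ = r₂ → 0 ≤ h z)
    (hi : ∀ z R, 0 < R → Integrable h (circleMeasure z R))
    (hs : ∀ z R, 0 < R → R < ‖z‖ → ∫ y, h y ∂circleMeasure z R ≤ h z) :
    ∀ z, r₁ ≤ ‖z‖ → ‖z‖ ≤ r₂ → 0 ≤ h z := by
  set K : Set ℂ := {z | r₁ ≤ ‖z‖ ∧ ‖z‖ ≤ r₂} with hK
  have hKcl : IsClosed K :=
    (isClosed_le continuous_const continuous_norm).inter (isClosed_le continuous_norm continuous_const)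
  have hKc : IsCompact K := (isCompact_closedBall (0 : ℂ) r₂).of_isClosed_subset hKcl
    (fun z hz => by simpa using hz.2)
  have hKne : K.Nonempty := ⟨(r₁ : ℂ), by simp [hK, abs_of_pos h0, h12.le]⟩
  obtain ⟨z₀, hz₀, hmin⟩ := hl.exists_isMinOn hKne hKc
  set m := h z₀
  suffices 0 ≤ m from fun z hz1 hz2 => this.trans (hmin ⟨hz1, hz2⟩)
  by_contra! hm
  have hKm : IsCompact (K ∩ h ⁻¹' Iic m) := by
    obtain ⟨v, hv, hveq⟩ := lowerSemicontinuousOn_iff_preimage_Iic.1 hl m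
    rw [hveq]
    exact hKc.inter_right hv
  -- Among the minimum points choose one of largest modulus: on the part of a surrounding circle
  -- with larger modulus h exceeds m strictly, so the mean is greater than m.
  obtain ⟨z₁, hz₁, hmax⟩ := hKm.exists_isMaxOn ⟨z₀, hz₀, le_refl m⟩ continuous_norm.continuousOn
  have hz1m : h z₁ ≤ m := hz₁.2
  have hne1 : ‖z₁‖ ≠ r₁ := fun he => by linarith [hb z₁ (Or.inl he)]
  have hne2 : ‖z₁‖ ≠ r₂ := fun he => by linarith [hb z₁ (Or.inr he)]
  have hlt1 : r₁ < ‖z₁‖ := lt_of_le_of_ne hz₁.1.1 hne1.symm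
  have hlt2 : ‖z₁‖ < r₂ := lt_of_le_of_ne hz₁.1.2 hne2
  set R := min (‖z₁‖ - r₁) (r₂ - ‖z₁‖) with hR
  have hR0 : 0 < R := lt_min (by linarith) (by linarith)
  have hR1 : R ≤ ‖z₁‖ - r₁ := min_le_left _ _
  have hR2 : R ≤ r₂ - ‖z₁‖ := min_le_right _ _
  have hz1pos : 0 < ‖z₁‖ := by linarith
  have hsub : ∀ y ∈ Metric.sphere z₁ R, y ∈ K := by
    intro y hy
    have hy' : ‖y - z₁‖ = R := by simpa using hy
    constructor
    · have := norm_sub_norm_le z₁ y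
      rw [norm_sub_rev] at this
      linarith
    · linarith [norm_sub_norm_le y z₁]
  have hpos : 0 < ∫ y, (h y - m) ∂circleMeasure z₁ R := by
    have hV : IsOpen {y : ℂ | ‖z₁‖ < ‖y‖} := isOpen_lt continuous_const continuous_norm
    have hae := ae_circleMeasure_mem_sphere z₁ hR0.le
    refine integral_pos_of_pos_on (s := {y : ℂ | ‖z₁‖ < ‖y‖} ∩ Metric.sphere z₁ R) ?_
      ((hi z₁ R hR0).sub (integrable_const _)) ?_ ?_
    · filter_upwards [hae] with y hy
      simpa using hmin (hsub y hy)
    · rintro y ⟨hy1, hy2⟩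
      rw [sub_pos]
      by_contra! hle
      have : ‖y‖ ≤ ‖z₁‖ := hmax ⟨hsub y hy2, hle⟩
      exact absurd hy1 (not_lt.2 this)
    · rw [inter_comm, Measure.measure_inter_eq_of_ae hae]
      -- The witness is the point of the circle farthest from the origin.
      refine circleMeasure_pos_of_isOpen hV (z := z₁ + ((R / ‖z₁‖ : ℝ) : ℂ) * z₁) ?_ ?_ hR0.le
      · have : z₁ + ((R / ‖z₁‖ : ℝ) : ℂ) * z₁ = ((1 + R / ‖z₁‖ : ℝ) : ℂ) * z₁ := by
          push_cast; ring
        rw [mem_ofPred_eq, this, norm_mul, Complex.norm_real, Real.norm_of_nonneg (by positivity),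
          add_mul, one_mul, div_mul_cancel₀ _ hz1pos.ne']
        linarith
      · rw [mem_sphere_iff_norm, add_sub_cancel_left, norm_mul, Complex.norm_real,
          Real.norm_of_nonneg (by positivity), div_mul_cancel₀ _ hz1pos.ne']
  rw [integral_sub (hi z₁ R hR0) (integrable_const _)] at hpos
  simp only [integral_const, probReal_univ, one_smul] at hpos
  linarith [hs z₁ R hR0 (by linarith)]

/-- Description of the obstacle function in a gap `r₁ < |z| < r₂` of a radially symmetric
droplet. -/
theorem obstacle_gap {Q : ℂ → ℝ} (hQ : LowerSemicontinuous Q)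
    (hrad : ∀ z : ℂ, Q z = Q ((‖z‖ : ℝ) : ℂ)) {σ : Measure ℂ} (hσ : IsEquilibriumMeasure Q σ)
    {U : Set ℂ} (hU : IsOpen U) (hSU : σ.support ⊆ U) (hQU : ContinuousOn Q U)
    (hcontact : ∀ z ∉ σ.support, obstacle Q σ z < Q z)
    (hSrad : ∀ z w : ℂ, ‖z‖ = ‖w‖ → z ∈ σ.support → w ∈ σ.support)
    {r₁ r₂ : ℝ} (h0 : 0 < r₁) (h12 : r₁ < r₂)
    (hgap : ∀ z ∈ σ.support, ¬ (r₁ < ‖z‖ ∧ ‖z‖ < r₂))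
    (hS1 : (r₁ : ℂ) ∈ σ.support) (hS2 : (r₂ : ℂ) ∈ σ.support)
    (hin : ∀ r < r₁, ∃ z ∈ σ.support, r < ‖z‖ ∧ ‖z‖ < r₁)
    (hout : ∀ r > r₂, ∃ z ∈ σ.support, r₂ < ‖z‖ ∧ ‖z‖ < r) :
    ∃ A B : ℝ, 0 < B ∧ B < 2 ∧
      (∀ z : ℂ, r₁ ≤ ‖z‖ → ‖z‖ ≤ r₂ → obstacle Q σ z = A + B * Real.log ‖z‖) ∧
      (Q (r₁ : ℂ) = A + B * Real.log r₁) ∧ (Q (r₂ : ℂ) = A + B * Real.log r₂) ∧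
      ∀ r : ℝ, 0 < r → r ≠ r₁ → r ≠ r₂ → A + B * Real.log r < Q (r : ℂ) := by
  have hprob := hσ.1
  obtain ⟨M, hM⟩ := ae_norm_le_of_isCompact_support hσ.2.1
  have hSae := Measure.support_mem_ae (μ := σ)
  obtain ⟨hi, hlim, hat, hobs⟩ := hσ.eulerLagrange hQ hU hSU hQU
  have hlsc := lowerSemicontinuous_logPotential hM hi hat hlim
  have h02 : 0 < r₂ := h0.trans h12
  set γ := robinConstant Q σ with hγ
  set P : ℝ → ℝ := fun r => ∫ w, Real.log (max r ‖w‖) ∂σ with hP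
  have hPi : ∀ r, 0 < r → Integrable (fun w => Real.log (max r ‖w‖)) σ := by
    intro r hr
    simpa using integrable_log_max hM 0 hr
  have hPavg : ∀ r, 0 < r → ∫ z, logPotential σ z ∂circleMeasure 0 r = -P r := by
    intro r hr
    rw [integral_logPotential_circleMeasure hM 0 hr]
    simp [hP]
  have hUint : ∀ (c : ℂ) (r : ℝ), 0 < r → Integrable (logPotential σ) (circleMeasure c r) :=
    fun c r hr => integrable_logPotential_circleMeasure hM c hr
  have hsph : ∀ {r : ℝ}, 0 < r → ∀ᵐ z ∂circleMeasure 0 r, ‖z‖ = r := by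
    intro r hr
    filter_upwards [ae_circleMeasure_mem_sphere 0 hr.le] with z hz
    simpa using hz
  have hQle : ∀ z, obstacle Q σ z ≤ Q z := by
    intro z
    by_cases hz : z ∈ σ.support
    · exact (hobs z hz).le
    · exact (hcontact z hz).le
  -- Average the inequality between obstacle and field over |z| = r, where Q is constant.
  have hQP : ∀ r, 0 < r → γ + 2 * P r ≤ Q (r : ℂ) := by
    intro r hr
    have h1 : ∫ z, obstacle Q σ z ∂circleMeasure 0 r ≤ ∫ _, Q (r : ℂ) ∂circleMeasure 0 r := by
      apply integral_mono_ae ((integrable_const _).sub ((hUint 0 r hr).const_mul 2))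
        (integrable_const _)
      filter_upwards [hsph hr] with z hz
      rw [← hz, ← hrad z]
      exact hQle z
    unfold obstacle at h1
    rw [integral_sub (integrable_const _) ((hUint 0 r hr).const_mul 2), integral_const_mul,
      hPavg r hr] at h1
    simp only [integral_const, probReal_univ, one_smul] at h1
    linarith
  -- The whole circle through z lies in the support, and Q is constant on it; hence so is the
  -- potential, which then equals its mean.
  have hUS : ∀ z ∈ σ.support, 0 < ‖z‖ → logPotential σ z = -P ‖z‖ := by
    intro z hz hr
    rw [← hPavg _ hr]
    have hc : ∀ᵐ y ∂circleMeasure 0 ‖z‖, logPotential σ y = logPotential σ z := by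
      filter_upwards [hsph hr] with y hy
      have h1 := hobs y (hSrad z y hy.symm hz)
      have h2 := hobs z hz
      rw [obstacle, hrad] at h1 h2
      rw [hy] at h1
      linarith
    rw [integral_congr_ae hc]
    simp
  -- the explicit form of the averaged potential
  set ind : ℂ → ℝ := fun w => if ‖w‖ ≤ r₁ then 1 else 0
  set out : ℂ → ℝ := fun w => if ‖w‖ ≤ r₁ then 0 else Real.log ‖w‖
  have hms : MeasurableSet {w : ℂ | ‖w‖ ≤ r₁} := (isClosed_le continuous_norm continuous_const).measurableSet
  have hindm : Measurable ind := Measurable.ite hms measurable_const measurable_const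
  have houtm : Measurable out := Measurable.ite hms measurable_const (Real.measurable_log.comp measurable_norm)
  have hindi : Integrable ind σ := by
    refine Integrable.mono' (integrable_const (1 : ℝ)) hindm.aestronglyMeasurable
      (Eventually.of_forall fun w => ?_)
    simp only [ind]
    split_ifs <;> simp
  have houti : Integrable out σ := by
    refine Integrable.mono' ((hPi r₁ h0).norm) houtm.aestronglyMeasurable
      (Eventually.of_forall fun w => ?_)
    simp only [out]
    split_ifs with hw
    · simp
    · rw [max_eq_right (not_le.1 hw).le]
  set b := ∫ w, ind w ∂σ with hb
  set a := ∫ w, out w ∂σ with ha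
  -- The excess of log max(r, |w|) over the expression it equals for σ-almost every w when r lies in
  -- the closed gap. For r outside, it is positive on an annulus adjacent to the gap that σ charges.
  set g : ℝ → ℂ → ℝ := fun r w => Real.log (max r ‖w‖) - (ind w * Real.log r + out w) with hg
  have hgi : ∀ r, 0 < r → Integrable (g r) σ := fun r hr =>
    (hPi r hr).sub ((hindi.mul_const _).add houti)
  have hgint : ∀ r, 0 < r → ∫ w, g r w ∂σ = P r - (b * Real.log r + a) := by
    intro r hr
    have e : Integrable (fun w => ind w * Real.log r + out w) σ := (hindi.mul_const _).add houti
    simp only [hg]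
    rw [integral_sub (hPi r hr) e, integral_add (hindi.mul_const _) houti, integral_mul_const]
  have hgnn : ∀ r, 0 < r → ∀ w, 0 ≤ g r w := by
    intro r hr w
    simp only [hg, ind, out, sub_nonneg]
    split_ifs with hw
    · rw [one_mul, add_zero]
      exact Real.log_le_log hr (le_max_left _ _)
    · rw [zero_mul, zero_add]
      exact Real.log_le_log (h0.trans (not_le.1 hw)) (le_max_right _ _)
  have hPge : ∀ r, 0 < r → b * Real.log r + a ≤ P r := by
    intro r hr
    have := integral_nonneg (μ := σ) (f := g r) (hgnn r hr)
    rw [hgint r hr] at this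
    linarith
  have hPeq : ∀ r, r₁ ≤ r → r ≤ r₂ → P r = b * Real.log r + a := by
    intro r hr1 hr2
    have hr : 0 < r := h0.trans_le hr1
    have h1 : ∫ w, g r w ∂σ = 0 := by
      apply integral_eq_zero_of_ae
      filter_upwards [hSae] with w hw
      simp only [hg, ind, out, Pi.zero_apply]
      split_ifs with hw1
      · rw [max_eq_left (hw1.trans hr1)]; ring
      · have : r₂ ≤ ‖w‖ := by
          by_contra! hlt
          exact hgap w hw ⟨not_le.1 hw1, hlt⟩
        rw [max_eq_right (hr2.trans this)]; ring
    rw [hgint r hr] at h1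
    linarith
  have hpos_open : ∀ O : Set ℂ, IsOpen O → (∃ z ∈ σ.support, z ∈ O) → 0 < σ O := by
    rintro O hO ⟨z, hz, hzO⟩
    exact (Measure.mem_support_iff_forall z).1 hz O (hO.mem_nhds hzO)
  have hPlt : ∀ r, 0 < r → (r < r₁ ∨ r₂ < r) → b * Real.log r + a < P r := by
    intro r hr hcase
    have : 0 < ∫ w, g r w ∂σ := by
      rcases hcase with hlt | hlt
      · obtain ⟨z, hz, hz1, hz2⟩ := hin r hlt
        refine integral_pos_of_pos_on (s := {w | r < ‖w‖ ∧ ‖w‖ < r₁})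
          (Eventually.of_forall (hgnn r hr)) (hgi r hr) ?_ (hpos_open _ ?_ ⟨z, hz, hz1, hz2⟩)
        · rintro w ⟨hw1, hw2⟩
          simp only [hg, ind, out, if_pos hw2.le, one_mul, add_zero, sub_pos]
          exact Real.log_lt_log hr (lt_max_of_lt_right hw1)
        · exact (isOpen_lt continuous_const continuous_norm).inter
            (isOpen_lt continuous_norm continuous_const)
      · obtain ⟨z, hz, hz1, hz2⟩ := hout r hlt
        refine integral_pos_of_pos_on (s := {w | r₂ < ‖w‖ ∧ ‖w‖ < r})
          (Eventually.of_forall (hgnn r hr)) (hgi r hr) ?_ (hpos_open _ ?_ ⟨z, hz, hz1, hz2⟩)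
        · rintro w ⟨hw1, hw2⟩
          simp only [hg, ind, out, if_neg (not_le.2 (h12.trans hw1)), zero_mul, zero_add, sub_pos]
          exact Real.log_lt_log (h02.trans hw1) (lt_max_of_lt_left hw2)
        · exact (isOpen_lt continuous_const continuous_norm).inter
            (isOpen_lt continuous_norm continuous_const)
    rw [hgint r hr] at this
    linarith
  have hb0 : 0 < b := by
    obtain ⟨z, hz, -, hz2⟩ := hin 0 h0
    refine integral_pos_of_pos_on (s := {w | ‖w‖ < r₁}) (Eventually.of_forall fun w => ?_) hindi ?_
      (hpos_open _ (isOpen_lt continuous_norm continuous_const) ⟨z, hz, hz2⟩)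
    · simp only [ind, Pi.zero_apply]
      split_ifs <;> norm_num
    · intro w hw
      simp only [ind]
      rw [if_pos (le_of_lt hw)]
      exact one_pos
  have hb1 : b < 1 := by
    obtain ⟨z, hz, hz1, -⟩ := hout (r₂ + 1) (by simp)
    have : 0 < ∫ w, (1 - ind w) ∂σ := by
      refine integral_pos_of_pos_on (s := {w | r₂ < ‖w‖}) (Eventually.of_forall fun w => ?_)
        ((integrable_const _).sub hindi) ?_
        (hpos_open _ (isOpen_lt continuous_const continuous_norm) ⟨z, hz, hz1⟩)
      · simp only [ind, Pi.zero_apply]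
        split_ifs <;> norm_num
      · intro w hw
        simp only [ind]
        rw [if_neg (not_le.2 (h12.trans hw))]
        norm_num
    rw [integral_sub (integrable_const _) hindi] at this
    simp only [integral_const, probReal_univ, one_smul] at this
    linarith
  -- the potential in the gap
  set h : ℂ → ℝ := fun z => logPotential σ z + (b * Real.log ‖z‖ + a) with hh
  have hhl : LowerSemicontinuousOn h {z | r₁ ≤ ‖z‖ ∧ ‖z‖ ≤ r₂} := by
    apply (hlsc.lowerSemicontinuousOn _).add
    apply ContinuousOn.lowerSemicontinuousOn
    apply ContinuousOn.add _ continuousOn_const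
    apply continuousOn_const.mul
    apply ContinuousOn.log continuous_norm.continuousOn
    rintro z ⟨hz, -⟩
    exact (h0.trans_le hz).ne'
  have hlogi : ∀ (c : ℂ) (r : ℝ), Integrable (fun z : ℂ => b * Real.log ‖z‖ + a) (circleMeasure c r) := by
    intro c r
    have := integrable_log_circleMeasure 0 c r
    simp only [sub_zero] at this
    exact (this.const_mul b).add (integrable_const _)
  have hlogint : ∀ (c : ℂ) (r : ℝ), 0 < r → ∫ z, (b * Real.log ‖z‖ + a) ∂circleMeasure c r =
      b * Real.log (max r ‖c‖) + a := by
    intro c r hr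
    have h1 := integrable_log_circleMeasure 0 c r
    have h2 := integral_log_circleMeasure 0 c hr
    simp only [sub_zero] at h1 h2
    rw [integral_add (h1.const_mul b) (integrable_const _), integral_const_mul, h2]
    simp
  have hhi : ∀ z R, 0 < R → Integrable h (circleMeasure z R) := fun z R hR =>
    (hUint z R hR).add (hlogi z R)
  -- A circle of radius less than |z| does not enclose 0, so b log|·| + a has the mean value
  -- property there, while the potential dominates its means. On the two boundary circles h = 0.
  have hnn : ∀ z, r₁ ≤ ‖z‖ → ‖z‖ ≤ r₂ → 0 ≤ h z := by
    apply nonneg_of_superharmonic_annulus h12 h0 hhl _ hhi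
    · intro z R hR hRz
      simp only [hh]
      rw [integral_add (hUint z R hR) (hlogi z R), hlogint z R hR, max_eq_right hRz.le,
        integral_logPotential_circleMeasure hM z hR]
      linarith [neg_integral_log_max_le_logPotential hM (hi z) (hat z) hR]
    · intro z hz
      have hzS : z ∈ σ.support := by
        rcases hz with hz | hz
        · exact hSrad _ z (by rw [hz]; simp [abs_of_pos h0]) hS1
        · exact hSrad _ z (by rw [hz]; simp [abs_of_pos h02]) hS2
      have hzr : r₁ ≤ ‖z‖ ∧ ‖z‖ ≤ r₂ := by
        rcases hz with hz | hz <;> rw [hz] <;> constructor <;> linarith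
      simp only [hh]
      rw [hUS z hzS (h0.trans_le hzr.1), hPeq _ hzr.1 hzr.2]
      linarith
  -- The mean of h over a centred circle in the gap is -P + P = 0; a nonnegative lower
  -- semicontinuous function with mean zero vanishes on the circle.
  have hzero : ∀ z, r₁ ≤ ‖z‖ → ‖z‖ ≤ r₂ → h z = 0 := by
    intro z hz1 hz2
    have hz0 : 0 < ‖z‖ := h0.trans_le hz1
    by_contra hne
    have hpos : 0 < h z := lt_of_le_of_ne (hnn z hz1 hz2) (Ne.symm hne)
    have hev : ∀ᶠ y in 𝓝 z, 0 < h y := by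
      have hlog : ContinuousAt (fun z : ℂ => b * Real.log ‖z‖ + a) z :=
        (continuousAt_const.mul (continuous_norm.continuousAt.log hz0.ne')).add continuousAt_const
      exact (LowerSemicontinuousAt.add (hlsc z) hlog.lowerSemicontinuousAt) 0 hpos
    obtain ⟨V, hV, hVo, hzV⟩ := eventually_nhds_iff.1 hev
    have hpos2 : 0 < ∫ y, h y ∂circleMeasure 0 ‖z‖ := by
      refine integral_pos_of_pos_on (s := V) ?_ (hhi 0 _ hz0) hV
        (circleMeasure_pos_of_isOpen hVo hzV (by simp) hz0.le)
      filter_upwards [hsph hz0] with y hy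
      exact hnn y (by rwa [hy]) (by rwa [hy])
    simp only [hh] at hpos2
    rw [integral_add (hUint 0 _ hz0) (hlogi 0 _), hPavg _ hz0, hlogint 0 _ hz0] at hpos2
    rw [norm_zero, max_eq_left hz0.le, hPeq _ hz1 hz2] at hpos2
    linarith
  have hobsgap : ∀ z : ℂ, r₁ ≤ ‖z‖ → ‖z‖ ≤ r₂ →
      obstacle Q σ z = γ + 2 * a + 2 * b * Real.log ‖z‖ := by
    intro z hz1 hz2
    have := hzero z hz1 hz2
    simp only [hh] at this
    rw [obstacle]
    linarith
  -- B is twice the σ-mass of |w| ≤ r₁, a mass strictly between 0 and 1 because the droplet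
  -- continues on both sides of the gap.
  refine ⟨γ + 2 * a, 2 * b, by linarith, by linarith, hobsgap, ?_, ?_, ?_⟩
  · have e : ‖(r₁ : ℂ)‖ = r₁ := by simp [abs_of_pos h0]
    have := hobsgap r₁ (by rw [e]) (by rw [e]; exact h12.le)
    rw [hobs _ hS1, e] at this
    exact this
  · have e : ‖(r₂ : ℂ)‖ = r₂ := by simp [abs_of_pos h02]
    have := hobsgap r₂ (by rw [e]; exact h12.le) (by rw [e])
    rw [hobs _ hS2, e] at this
    exact this
  · intro r hr hne1 hne2
    -- Off [r₁, r₂] strictness comes from the averaged potential exceeding its logarithmic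
    -- continuation; inside the gap it comes from `hcontact`.
    by_cases hcase : r < r₁ ∨ r₂ < r
    · linarith [hPlt r hr hcase, hQP r hr]
    · push Not at hcase
      have e : ‖(r : ℂ)‖ = r := by simp [abs_of_pos hr]
      have hlt1 : r₁ < r := lt_of_le_of_ne hcase.1 hne1.symm
      have hlt2 : r < r₂ := lt_of_le_of_ne hcase.2 hne2
      have h1 := hobsgap r (by rw [e]; exact hcase.1) (by rw [e]; exact hcase.2)
      rw [e] at h1
      rw [← h1]
      apply hcontact
      intro hS
      exact hgap _ hS (by rw [e]; exact ⟨hlt1, hlt2⟩)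

/-! ### Laplace's method -/

lemma abs_log_one_add_le {u : ℝ} (hu : |u| ≤ 1 / 2) : |Real.log (1 + u)| ≤ 2 * |u| := by
  have h1 := abs_le.1 hu
  have hpos : 0 < 1 + u := by linarith
  rw [abs_le]
  constructor
  · have h2 := Real.one_sub_inv_le_log_of_pos hpos
    have h3 : 1 - (1 + u)⁻¹ = u / (1 + u) := by field_simp; ring
    rw [h3] at h2
    refine le_trans ?_ h2
    rw [le_div_iff₀ hpos]
    rcases le_total 0 u with h | h
    · rw [abs_of_nonneg h]; nlinarith
    · rw [abs_of_nonpos h]; nlinarith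
  · have h2 := Real.log_le_sub_one_of_pos hpos
    linarith [le_abs_self u, abs_nonneg u]

lemma abs_exp_sub_one_le_mul (x : ℝ) : |Real.exp x - 1| ≤ |x| * Real.exp |x| := by
  rcases le_total 0 x with h | h
  · rw [abs_of_nonneg h, abs_of_nonneg (by linarith [Real.add_one_le_exp x])]
    have h1 := Real.add_one_le_exp (-x)
    have h2 : Real.exp (-x) * Real.exp x = 1 := by rw [← Real.exp_add]; simp
    nlinarith [Real.exp_pos x]
  · rw [abs_of_nonpos h, abs_of_nonpos (by simpa using h)]
    have h1 := Real.add_one_le_exp x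
    have h2 : 1 ≤ Real.exp (-x) := Real.one_le_exp (by linarith)
    nlinarith

lemma mul_exp_neg_le {b x : ℝ} (hb : 0 < b) : x * Real.exp (-(b * x)) ≤ 1 / b := by
  rw [le_div_iff₀ hb, Real.exp_neg]
  have h1 := Real.add_one_le_exp (b * x)
  have h2 := Real.exp_pos (b * x)
  have h3 : x * (Real.exp (b * x))⁻¹ * b = (b * x) / Real.exp (b * x) := by field_simp
  rw [h3, div_le_one h2]
  linarith

/-- `V` has a nondegenerate quadratic zero at `r₀`, with quantitative control on an interval of
radius `δ`. -/
structure IsPeak (V : ℝ → ℝ) (r₀ κ δ M : ℝ) : Prop where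
  pos : 0 < r₀
  kappa_pos : 0 < κ
  delta_pos : 0 < δ
  delta_le : δ ≤ r₀ / 2
  M_nonneg : 0 ≤ M
  delta_mul_le : δ * M ≤ κ / 4
  bound : ∀ s, |s| ≤ δ → |V (r₀ + s) - κ * s ^ 2| ≤ M * |s| ^ 3

/-- Pointwise comparison of the Laplace integrand with a Gaussian. -/
lemma IsPeak.pointwise {V : ℝ → ℝ} {r₀ κ δ M : ℝ} (h : IsPeak V r₀ κ δ M) {K : ℝ} {n p : ℝ}
    (hn : 1 ≤ n) (hp : p ^ 2 ≤ K * n) {s : ℝ} (hs : |s| ≤ δ) :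
    |(1 + s / r₀) ^ p * Real.exp (-n * V (r₀ + s)) - Real.exp (-(κ * n) * s ^ 2)| ≤
      Real.exp (4 * K / (r₀ ^ 2 * κ)) * (2 / r₀ + 4 * M / κ) * (1 + |p|) *
        (|s| * Real.exp (-(κ / 4 * n) * s ^ 2)) := by
  obtain ⟨hr, hκ, hδ, hδr, hM, hδM, hV⟩ := h
  have hn0 : 0 < n := by linarith
  have hu : |s / r₀| ≤ 1 / 2 := by
    rw [abs_div, abs_of_pos hr, div_le_iff₀ hr]
    linarith
  have hpos : 0 < 1 + s / r₀ := by linarith [(abs_le.1 hu).1]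
  -- E is the logarithm of the ratio of the integrand to its Gaussian. It is at most κns²/2 plus a
  -- constant: κns²/4 pays for the cubic Taylor error, by `delta_mul_le`, and κns²/4 for the power,
  -- by the arithmetic-geometric inequality and p² ≤ Kn.
  set E := p * Real.log (1 + s / r₀) - n * (V (r₀ + s) - κ * s ^ 2) with hE
  have e1 : (1 + s / r₀) ^ p * Real.exp (-n * V (r₀ + s)) =
      Real.exp (-(κ * n) * s ^ 2) * Real.exp E := by
    rw [Real.rpow_def_of_pos hpos, ← Real.exp_add, ← Real.exp_add, hE]
    congr 1
    ring
  have hE1 : |E| ≤ 2 * |p| / r₀ * |s| + n * M * |s| ^ 3 := by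
    calc |E| ≤ |p * Real.log (1 + s / r₀)| + |n * (V (r₀ + s) - κ * s ^ 2)| := abs_sub _ _
      _ ≤ |p| * (2 * |s / r₀|) + n * (M * |s| ^ 3) := by
        rw [abs_mul, abs_mul, abs_of_pos hn0]
        gcongr
        · exact abs_log_one_add_le hu
        · exact hV s hs
      _ = _ := by rw [abs_div, abs_of_pos hr]; ring
  have hs2 : |s| ^ 2 = s ^ 2 := sq_abs s
  have hcub : n * M * |s| ^ 3 ≤ κ / 4 * n * s ^ 2 := by
    have : M * |s| ≤ κ / 4 := by
      calc M * |s| ≤ M * δ := by gcongr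
        _ = δ * M := by ring
        _ ≤ _ := hδM
    calc n * M * |s| ^ 3 = (M * |s|) * (n * s ^ 2) := by rw [← hs2]; ring
      _ ≤ κ / 4 * (n * s ^ 2) := by gcongr
      _ = _ := by ring
  have hlin : 2 * |p| / r₀ * |s| ≤ κ / 4 * n * s ^ 2 + 4 * K / (r₀ ^ 2 * κ) := by
    have h1 : (2 * |p| / r₀) ^ 2 / (κ * n) ≤ 4 * K / (r₀ ^ 2 * κ) := by
      rw [div_pow, mul_pow, sq_abs, div_div, div_le_div_iff₀ (by positivity) (by positivity)]
      calc 2 ^ 2 * p ^ 2 * (r₀ ^ 2 * κ) = 4 * (r₀ ^ 2 * κ) * p ^ 2 := by ring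
        _ ≤ 4 * (r₀ ^ 2 * κ) * (K * n) := by gcongr
        _ = 4 * K * (r₀ ^ 2 * (κ * n)) := by ring
    have h2 : 2 * |p| / r₀ * |s| ≤ κ / 4 * n * s ^ 2 + (2 * |p| / r₀) ^ 2 / (κ * n) := by
      obtain ⟨x, hx⟩ : ∃ x, x = 2 * |p| / r₀ := ⟨_, rfl⟩
      rw [← hx]
      have h3 : 0 < κ * n := by positivity
      have h4 : x ^ 2 / (κ * n) * (κ * n) = x ^ 2 := div_mul_cancel₀ _ h3.ne'
      have h5 : 0 ≤ (κ * n * |s| / 2 - x) ^ 2 := sq_nonneg _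
      have h6 : κ * n * (x * |s|) ≤ κ * n * (κ / 4 * n * s ^ 2 + x ^ 2 / (κ * n)) := by
        rw [← hs2]; linarith
      exact le_of_mul_le_mul_left h6 h3
    linarith
  have hEexp : Real.exp |E| ≤ Real.exp (4 * K / (r₀ ^ 2 * κ)) * Real.exp (κ / 2 * n * s ^ 2) := by
    rw [← Real.exp_add]
    apply Real.exp_le_exp.2
    linarith
  obtain ⟨K', hK'e⟩ : ∃ K', Real.exp (4 * K / (r₀ ^ 2 * κ)) = K' := ⟨_, rfl⟩
  have hK' : 0 < K' := by rw [← hK'e]; exact Real.exp_pos _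
  rw [hK'e] at hEexp ⊢
  have hquad : n * s ^ 2 * Real.exp (-(κ / 4 * (n * s ^ 2))) ≤ 4 / κ := by
    have := mul_exp_neg_le (b := κ / 4) (x := n * s ^ 2) (by positivity)
    rwa [one_div_div] at this
  -- Of the Gaussian left after the loss e^{|E|}, one half absorbs the factor ns² and the other half
  -- remains as integrable majorant.
  have hg1 : Real.exp (-(κ * n) * s ^ 2) * Real.exp (κ / 2 * n * s ^ 2) =
      Real.exp (-(κ / 4 * (n * s ^ 2))) * Real.exp (-(κ / 4 * n) * s ^ 2) := by
    rw [← Real.exp_add, ← Real.exp_add]; congr 1; ring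
  have hle1 : Real.exp (-(κ / 4 * (n * s ^ 2))) ≤ 1 := Real.exp_le_one_iff.2 (by
    have : 0 ≤ κ / 4 * (n * s ^ 2) := by positivity
    linarith)
  obtain ⟨W, hWe⟩ : ∃ W, Real.exp (-(κ / 4 * n) * s ^ 2) = W := ⟨_, rfl⟩
  obtain ⟨X, hXe⟩ : ∃ X, Real.exp (-(κ / 4 * (n * s ^ 2))) = X := ⟨_, rfl⟩
  have hW : 0 < W := by rw [← hWe]; exact Real.exp_pos _
  have hX : 0 < X := by rw [← hXe]; exact Real.exp_pos _
  rw [hWe] at hg1 ⊢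
  rw [hXe] at hg1 hle1 hquad
  calc |(1 + s / r₀) ^ p * Real.exp (-n * V (r₀ + s)) - Real.exp (-(κ * n) * s ^ 2)|
      = Real.exp (-(κ * n) * s ^ 2) * |Real.exp E - 1| := by
        rw [e1, ← abs_of_pos (Real.exp_pos (-(κ * n) * s ^ 2)), ← abs_mul,
          abs_of_pos (Real.exp_pos _)]
        congr 1; ring
    _ ≤ Real.exp (-(κ * n) * s ^ 2) * ((2 * |p| / r₀ * |s| + n * M * |s| ^ 3) *
          (K' * Real.exp (κ / 2 * n * s ^ 2))) := by
        gcongr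
        exact (abs_exp_sub_one_le_mul E).trans (by gcongr)
    _ = K' * |s| * W * (2 * |p| / r₀ * X + M * (n * s ^ 2 * X)) := by
        linear_combination (2 * |p| / r₀ * |s| + n * M * |s| ^ 3) * K' * hg1 +
          K' * X * W * n * M * |s| * hs2
    _ ≤ K' * |s| * W * (2 * |p| / r₀ * 1 + M * (4 / κ)) := by gcongr
    _ ≤ K' * |s| * W * ((2 / r₀ + 4 * M / κ) * (1 + |p|)) := by
        gcongr
        have h1 : 0 ≤ 2 / r₀ := by positivity
        have h2 : 0 ≤ 4 * M / κ * |p| := by positivity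
        have h3 : 2 * |p| / r₀ * 1 + M * (4 / κ) = 2 / r₀ * |p| + 4 * M / κ := by ring
        have h4 : (2 / r₀ + 4 * M / κ) * (1 + |p|) =
            2 / r₀ * |p| + 4 * M / κ + 2 / r₀ + 4 * M / κ * |p| := by ring
        rw [h3, h4]
        linarith
    _ = _ := by ring

lemma integrable_abs_mul_exp_neg_mul_sq {b : ℝ} (hb : 0 < b) :
    Integrable fun s : ℝ => |s| * Real.exp (-b * s ^ 2) := by
  refine (integrable_mul_exp_neg_mul_sq hb).norm.congr (Eventually.of_forall fun s => ?_)
  simp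

lemma integral_abs_mul_exp_neg_mul_sq_scale {b n : ℝ} (hn : 0 < n) :
    ∫ s : ℝ, |s| * Real.exp (-(b * n) * s ^ 2) =
      (∫ s : ℝ, |s| * Real.exp (-b * s ^ 2)) / n := by
  have hsq : 0 < √n := Real.sqrt_pos.2 hn
  have h := Measure.integral_comp_mul_left (fun s : ℝ => |s| * Real.exp (-b * s ^ 2)) (√n)
  have e : ∀ s : ℝ, |√n * s| * Real.exp (-b * (√n * s) ^ 2) =
      √n * (|s| * Real.exp (-(b * n) * s ^ 2)) := by
    intro s
    rw [abs_mul, abs_of_pos hsq, mul_pow, Real.sq_sqrt hn.le]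
    ring_nf
  simp only [e] at h
  rw [integral_const_mul, smul_eq_mul, abs_of_pos (inv_pos.2 hsq)] at h
  rw [eq_div_iff hn.ne']
  have h2 : √n * √n = n := Real.mul_self_sqrt hn.le
  calc _ = √n * (√n * ∫ s : ℝ, |s| * Real.exp (-(b * n) * s ^ 2)) := by
        rw [← mul_assoc, h2, mul_comm]
    _ = _ := by rw [h, mul_inv_cancel_left₀ hsq.ne']

/-- Extends the comparison to the whole line, so that the full Gaussian integral can be used. Off
the interval only the Gaussian is left, and 1 ≤ |s|/δ there, whence the term 1/δ. -/
lemma IsPeak.pointwise_indicator {V : ℝ → ℝ} {r₀ κ δ M : ℝ} (h : IsPeak V r₀ κ δ M) {K n p : ℝ}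
    (hn : 1 ≤ n) (hp : p ^ 2 ≤ K * n) (s : ℝ) :
    |(Icc (r₀ - δ) (r₀ + δ)).indicator (fun r => r ^ p * Real.exp (-n * V r)) (r₀ + s) -
        r₀ ^ p * Real.exp (-(κ * n) * s ^ 2)| ≤
      r₀ ^ p * ((Real.exp (4 * K / (r₀ ^ 2 * κ)) * (2 / r₀ + 4 * M / κ) + 1 / δ) * (1 + |p|) *
        (|s| * Real.exp (-(κ / 4 * n) * s ^ 2))) := by
  have hr := h.pos
  have hκ := h.kappa_pos
  have hδ := h.delta_pos
  have hδr := h.delta_le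
  have hM := h.M_nonneg
  have hn0 : 0 < n := by linarith
  have hr0p : 0 < r₀ ^ p := Real.rpow_pos_of_pos hr p
  have hmemI : r₀ + s ∈ Icc (r₀ - δ) (r₀ + δ) ↔ |s| ≤ δ := by
    rw [mem_Icc, abs_le]
    constructor <;> rintro ⟨h1, h2⟩ <;> constructor <;> linarith
  have hpw := h.pointwise (s := s) hn hp
  obtain ⟨c, hc⟩ : ∃ c, Real.exp (4 * K / (r₀ ^ 2 * κ)) * (2 / r₀ + 4 * M / κ) = c := ⟨_, rfl⟩
  have hc0 : 0 ≤ c := by rw [← hc]; positivity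
  rw [hc] at hpw ⊢
  obtain ⟨W, hW⟩ : ∃ W, Real.exp (-(κ / 4 * n) * s ^ 2) = W := ⟨_, rfl⟩
  have hW0 : 0 < W := by rw [← hW]; exact Real.exp_pos _
  have hδ' : 0 < 1 / δ := by positivity
  have hp1 : 1 ≤ 1 + |p| := by linarith [abs_nonneg p]
  by_cases hs : |s| ≤ δ
  · rw [indicator_of_mem (hmemI.2 hs)]
    have hsp : 0 ≤ 1 + s / r₀ := by
      have h1 := (abs_le.1 hs).1
      have h2 : -(1 / 2) ≤ s / r₀ := by rw [le_div_iff₀ hr]; linarith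
      linarith
    have e : r₀ + s = r₀ * (1 + s / r₀) := by field_simp
    have e2 : (r₀ + s) ^ p = r₀ ^ p * (1 + s / r₀) ^ p := by rw [e, Real.mul_rpow hr.le hsp]
    rw [e2, mul_assoc, ← mul_sub, abs_mul, abs_of_pos hr0p]
    refine mul_le_mul_of_nonneg_left ((hpw hs).trans ?_) hr0p.le
    rw [hW]
    refine mul_le_mul_of_nonneg_right ?_ (by positivity)
    refine mul_le_mul_of_nonneg_right ?_ (by positivity)
    linarith
  · rw [indicator_of_notMem (fun hmem => hs (hmemI.1 hmem)), zero_sub, abs_neg, abs_mul,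
      abs_of_pos hr0p, abs_of_pos (Real.exp_pos _)]
    push Not at hs
    refine mul_le_mul_of_nonneg_left ?_ hr0p.le
    have h1 : 1 ≤ 1 / δ * |s| := by rw [one_div, ← div_eq_inv_mul, le_div_iff₀ hδ]; linarith
    have h2 : Real.exp (-(κ * n) * s ^ 2) ≤ W := by
      rw [← hW]
      apply Real.exp_le_exp.2
      have : 0 ≤ κ * n * s ^ 2 := by positivity
      linarith
    rw [hW]
    calc Real.exp (-(κ * n) * s ^ 2) ≤ 1 * W := by rw [one_mul]; exact h2
      _ ≤ (1 / δ * |s|) * W := mul_le_mul_of_nonneg_right h1 hW0.le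
      _ = 1 / δ * 1 * (|s| * W) := by ring
      _ ≤ (c + 1 / δ) * (1 + |p|) * (|s| * W) := by
          refine mul_le_mul_of_nonneg_right ?_ (by positivity)
          exact mul_le_mul (by linarith) hp1 (by norm_num) (by linarith)

/-- Laplace asymptotics of the integral over a neighbourhood of a peak. -/
lemma IsPeak.laplace {V : ℝ → ℝ} (hVm : Measurable V) {r₀ κ δ M : ℝ} (h : IsPeak V r₀ κ δ M)
    (K : ℝ) :
    ∃ C : ℝ, 0 ≤ C ∧ ∀ n p : ℝ, 1 ≤ n → p ^ 2 ≤ K * n →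
      IntegrableOn (fun r => r ^ p * Real.exp (-n * V r)) (Icc (r₀ - δ) (r₀ + δ)) ∧
      |(∫ r in Icc (r₀ - δ) (r₀ + δ), r ^ p * Real.exp (-n * V r)) -
        r₀ ^ p * √(Real.pi / (κ * n))| ≤ C * (1 + |p|) / n * r₀ ^ p := by
  have hr := h.pos
  have hκ := h.kappa_pos
  have hδ := h.delta_pos
  have hδr := h.delta_le
  have hM := h.M_nonneg
  obtain ⟨C₁, hC₁⟩ : ∃ C₁, C₁ = Real.exp (4 * K / (r₀ ^ 2 * κ)) * (2 / r₀ + 4 * M / κ) + 1 / δ :=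
    ⟨_, rfl⟩
  set J := ∫ s : ℝ, |s| * Real.exp (-(κ / 4) * s ^ 2) with hJ
  have hC₁0 : 0 ≤ C₁ := by rw [hC₁]; positivity
  have hJ0 : 0 ≤ J := integral_nonneg fun s => by positivity
  refine ⟨C₁ * J, by positivity, fun n p hn hp => ?_⟩
  have hn0 : 0 < n := by linarith
  set I := Icc (r₀ - δ) (r₀ + δ) with hI
  set F : ℝ → ℝ := fun r => r ^ p * Real.exp (-n * V r) with hF
  have hFm : Measurable F := by
    apply Measurable.mul
    · exact measurable_id.pow_const p
    · exact Real.measurable_exp.comp (hVm.const_mul _)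
  set H : ℝ → ℝ := fun s => I.indicator F (r₀ + s) with hH
  have hHm : Measurable H := (hFm.indicator measurableSet_Icc).comp (measurable_const.add measurable_id)
  have hr0p : 0 < r₀ ^ p := Real.rpow_pos_of_pos hr p
  set D : ℝ → ℝ := fun s => |s| * Real.exp (-(κ / 4 * n) * s ^ 2) with hD
  have hDi : Integrable D := integrable_abs_mul_exp_neg_mul_sq (by positivity)
  have hgi : Integrable fun s : ℝ => Real.exp (-(κ * n) * s ^ 2) :=
    integrable_exp_neg_mul_sq (by positivity)
  have hpt : ∀ s, |H s - r₀ ^ p * Real.exp (-(κ * n) * s ^ 2)| ≤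
      r₀ ^ p * (C₁ * (1 + |p|) * D s) := by
    intro s
    rw [hC₁]
    exact h.pointwise_indicator hn hp s
  have hdiff : Integrable fun s => H s - r₀ ^ p * Real.exp (-(κ * n) * s ^ 2) := by
    refine Integrable.mono' ((hDi.const_mul (C₁ * (1 + |p|))).const_mul (r₀ ^ p)) ?_
      (Eventually.of_forall hpt)
    exact (hHm.sub ((Real.measurable_exp.comp (by fun_prop)).const_mul _)).aestronglyMeasurable
  have hHi : Integrable H :=
    (hdiff.add (hgi.const_mul (r₀ ^ p))).congr (Eventually.of_forall fun s => by simp)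
  have hIi : Integrable (I.indicator F) := by
    have h2 := hHi.comp_add_left (-r₀)
    refine h2.congr (Eventually.of_forall fun s => ?_)
    simp [hH]
  refine ⟨(integrable_indicator_iff measurableSet_Icc).1 hIi, ?_⟩
  have hint : ∫ r in I, F r = ∫ s, H s := by
    rw [← integral_indicator measurableSet_Icc]
    exact (integral_add_left_eq_self (I.indicator F) r₀).symm
  have hgauss : r₀ ^ p * √(Real.pi / (κ * n)) = ∫ s : ℝ, r₀ ^ p * Real.exp (-(κ * n) * s ^ 2) := by
    rw [integral_const_mul, integral_gaussian]
  rw [hint, hgauss, ← integral_sub hHi (hgi.const_mul _)]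
  calc |∫ s, (H s - r₀ ^ p * Real.exp (-(κ * n) * s ^ 2))|
      ≤ ∫ s, r₀ ^ p * (C₁ * (1 + |p|) * D s) :=
        (Real.norm_eq_abs _).symm.trans_le (norm_integral_le_of_norm_le
          ((hDi.const_mul (C₁ * (1 + |p|))).const_mul (r₀ ^ p)) (Eventually.of_forall hpt))
    _ = C₁ * J * (1 + |p|) / n * r₀ ^ p := by
        rw [integral_const_mul, integral_const_mul]
        simp only [hD]
        rw [integral_abs_mul_exp_neg_mul_sq_scale hn0]
        ring

/-! ### Integrals with two peaks. -/

/-- Two nondegenerate peaks of `e^{-nV}` on the positive half-line, and a lower bound for `V`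
away from them. -/
structure IsTwoPeak (V : ℝ → ℝ) (r₁ κ₁ r₂ κ₂ δ M η : ℝ) : Prop where
  meas : Measurable V
  left : IsPeak V r₁ κ₁ δ M
  right : IsPeak V r₂ κ₂ δ M
  sep : r₁ + δ < r₂ - δ
  eta_pos : 0 < η
  lower : ∀ r, 0 < r → δ < |r - r₁| → δ < |r - r₂| → η * (1 + |Real.log r|) ≤ V r

/-- Gives the tail an integrable majorant whose integral over the line is explicit. -/
lemma exp_neg_two_mul_abs_log_le {r : ℝ} (hr : 0 < r) :
    Real.exp (-(2 * |Real.log r|)) ≤ 2 * (1 + r ^ 2)⁻¹ := by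
  rw [← div_eq_mul_inv, le_div_iff₀ (by positivity)]
  have e : Real.exp (2 * Real.log r) = r ^ 2 := by
    rw [mul_comm, Real.exp_mul, Real.exp_log hr]; norm_num
  rcases le_total 0 (Real.log r) with h | h
  · rw [abs_of_nonneg h, Real.exp_neg, e]
    have h1 : 1 ≤ r := (Real.log_nonneg_iff hr).1 h
    rw [inv_mul_le_iff₀ (by positivity)]
    nlinarith
  · rw [abs_of_nonpos h, mul_neg, neg_neg, e]
    have h1 : r ≤ 1 := (Real.log_nonpos_iff hr.le).1 h
    have h2 : r ^ 2 ≤ 1 := pow_le_one₀ hr.le h1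
    nlinarith [sq_nonneg r]

/-- Laplace asymptotics with two peaks. -/
lemma IsTwoPeak.laplace {V : ℝ → ℝ} {r₁ κ₁ r₂ κ₂ δ M η : ℝ}
    (h : IsTwoPeak V r₁ κ₁ r₂ κ₂ δ M η) (K : ℝ) :
    ∃ C n₀ : ℝ, 0 ≤ C ∧ 1 ≤ n₀ ∧ ∀ n p : ℝ, n₀ ≤ n → p ^ 2 ≤ K * n →
      IntegrableOn (fun r => r ^ p * Real.exp (-n * V r)) (Ioi 0) ∧
      |(∫ r in Ioi 0, r ^ p * Real.exp (-n * V r)) -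
        (r₁ ^ p * √(Real.pi / (κ₁ * n)) + r₂ ^ p * √(Real.pi / (κ₂ * n)))| ≤
        C * (1 + |p|) / n * (r₁ ^ p + r₂ ^ p) := by
  obtain ⟨C₁, hC₁, hL₁⟩ := h.left.laplace h.meas K
  obtain ⟨C₂, hC₂, hL₂⟩ := h.right.laplace h.meas K
  have hη := h.eta_pos
  have hr1 := h.left.pos
  have hr2 := h.right.pos
  have hδ := h.left.delta_pos
  set L := |Real.log r₂| with hL
  have hL0 : 0 ≤ L := abs_nonneg _
  -- Ensures nη/2 ≥ 2 and |p|(|log r₂| + 1) ≤ nη/2 whenever p² ≤ Kn. The logarithmic growth of V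
  -- then dominates r^p with e^{-2|log r|} to spare.
  set n₀ := max 1 (max (4 / η) (4 * K * (L + 1) ^ 2 / η ^ 2))
  refine ⟨C₁ + C₂ + 2 * Real.pi * (2 / η), n₀, by positivity, le_max_left _ _, fun n p hn hp => ?_⟩
  have hn1 : 1 ≤ n := (le_max_left _ _).trans hn
  have hn0 : 0 < n := by linarith
  have hn2 : 2 ≤ n * η / 2 := by
    have : 4 / η ≤ n := ((le_max_left _ _).trans (le_max_right _ _)).trans hn
    rw [div_le_iff₀ hη] at this
    linarith
  have hn3 : |p| * (L + 1) ≤ n * η / 2 := by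
    have h1 : 4 * K * (L + 1) ^ 2 / η ^ 2 ≤ n := ((le_max_right _ _).trans (le_max_right _ _)).trans hn
    rw [div_le_iff₀ (by positivity)] at h1
    apply abs_le_of_sq_le_sq' _ (by positivity) |>.2
    calc (|p| * (L + 1)) ^ 2 = p ^ 2 * (L + 1) ^ 2 := by rw [mul_pow, sq_abs]
      _ ≤ K * n * (L + 1) ^ 2 := by gcongr
      _ ≤ (n * η / 2) ^ 2 := by nlinarith
  obtain ⟨i1, e1⟩ := hL₁ n p hn1 hp
  obtain ⟨i2, e2⟩ := hL₂ n p hn1 hp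
  set F : ℝ → ℝ := fun r => r ^ p * Real.exp (-n * V r) with hF
  have hFm : Measurable F :=
    (measurable_id.pow_const p).mul (Real.measurable_exp.comp (h.meas.const_mul _))
  set I₁ := Icc (r₁ - δ) (r₁ + δ) with hI₁
  set I₂ := Icc (r₂ - δ) (r₂ + δ) with hI₂
  set T := Ioi (0 : ℝ) \ (I₁ ∪ I₂) with hT
  have hTm : MeasurableSet T := measurableSet_Ioi.diff (measurableSet_Icc.union measurableSet_Icc)
  have hsub : I₁ ∪ I₂ ⊆ Ioi (0 : ℝ) := by
    rintro r (hr | hr)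
    · have := h.left.delta_le
      exact lt_of_lt_of_le (by linarith) hr.1
    · have := h.right.delta_le
      exact lt_of_lt_of_le (by linarith) hr.1
  have hdisj : Disjoint I₁ I₂ := by
    rw [Set.disjoint_left]
    rintro r hr hr'
    have := h.sep
    linarith [hr.2, hr'.1]
  have hTb : ∀ r ∈ T, |F r| ≤ Real.exp (-(n * η)) * (2 * (1 + r ^ 2)⁻¹) := by
    rintro r ⟨hr, hrn⟩
    rw [mem_Ioi] at hr
    have h1 : δ < |r - r₁| := by
      by_contra! hle
      rw [abs_le] at hle
      exact hrn (Or.inl ⟨by linarith, by linarith⟩)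
    have h2 : δ < |r - r₂| := by
      by_contra! hle
      rw [abs_le] at hle
      exact hrn (Or.inr ⟨by linarith, by linarith⟩)
    have hV := h.lower r hr h1 h2
    have hF0 : 0 ≤ F r := mul_nonneg (Real.rpow_nonneg hr.le _) (Real.exp_pos _).le
    rw [abs_of_nonneg hF0]
    calc F r = Real.exp (Real.log r * p + -n * V r) := by
          simp only [hF]
          rw [Real.rpow_def_of_pos hr, ← Real.exp_add]
      _ ≤ Real.exp (-(n * η) + -(2 * |Real.log r|)) := by
          apply Real.exp_le_exp.2
          have h3 : Real.log r * p ≤ |Real.log r| * |p| := by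
            rw [← abs_mul]; exact le_abs_self _
          have h4 : n * (η * (1 + |Real.log r|)) ≤ n * V r := by gcongr
          have h5 : |p| + 2 ≤ n * η := by nlinarith [abs_nonneg p]
          nlinarith [abs_nonneg (Real.log r)]
      _ = Real.exp (-(n * η)) * Real.exp (-(2 * |Real.log r|)) := Real.exp_add _ _
      _ ≤ _ := by
          gcongr
          exact exp_neg_two_mul_abs_log_le hr
  have hbi : Integrable fun r : ℝ => Real.exp (-(n * η)) * (2 * (1 + r ^ 2)⁻¹) :=
    (integrable_inv_one_add_sq.const_mul 2).const_mul _
  have iT : IntegrableOn F T := by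
    refine Integrable.mono' hbi.integrableOn hFm.aestronglyMeasurable ?_
    exact (ae_restrict_iff' hTm).2 (Eventually.of_forall hTb)
  have eT : |∫ r in T, F r| ≤ 2 * Real.pi * (2 / η) / n * r₂ ^ p := by
    calc |∫ r in T, F r| ≤ ∫ r in T, Real.exp (-(n * η)) * (2 * (1 + r ^ 2)⁻¹) :=
          (Real.norm_eq_abs _).symm.trans_le (norm_integral_le_of_norm_le hbi.integrableOn
            ((ae_restrict_iff' hTm).2 (Eventually.of_forall hTb)))
      _ ≤ ∫ r, Real.exp (-(n * η)) * (2 * (1 + r ^ 2)⁻¹) :=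
          setIntegral_le_integral hbi (Eventually.of_forall fun r => by
            simp only [Pi.zero_apply]; positivity)
      _ = 2 * Real.pi * Real.exp (-(n * η)) := by
          rw [integral_const_mul, integral_const_mul, integral_univ_inv_one_add_sq]; ring
      _ ≤ 2 * Real.pi * ((2 / η) / n * r₂ ^ p) := by
          gcongr
          -- Half of the decay e^{-nη} supplies 1/n; the other half beats r₂^p, which may be as
          -- small as e^{-|p||log r₂|}.
          have h1 : Real.exp (-(η / 2 * n)) ≤ 2 / η / n := by
            rw [le_div_iff₀ hn0, mul_comm]
            have := mul_exp_neg_le (b := η / 2) (x := n) (by positivity)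
            rwa [one_div_div] at this
          have h2 : Real.exp (-(η / 2 * n)) ≤ r₂ ^ p := by
            rw [Real.rpow_def_of_pos hr2]
            apply Real.exp_le_exp.2
            have h3 : -(L * |p|) ≤ Real.log r₂ * p := by
              rw [hL, ← abs_mul]; exact neg_abs_le _
            nlinarith [abs_nonneg p]
          calc Real.exp (-(n * η)) = Real.exp (-(η / 2 * n)) * Real.exp (-(η / 2 * n)) := by
                rw [← Real.exp_add]; congr 1; ring
            _ ≤ _ := by gcongr
      _ = _ := by ring
  have hun : Ioi (0 : ℝ) = (I₁ ∪ I₂) ∪ T := (union_sdiff_cancel hsub).symm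
  have hd2 : Disjoint (I₁ ∪ I₂) T := disjoint_sdiff_right
  refine ⟨by rw [hun]; exact (i1.union i2).union iT, ?_⟩
  rw [hun, setIntegral_union hd2 hTm (i1.union i2) iT,
    setIntegral_union hdisj measurableSet_Icc i1 i2]
  have hp1 : 0 < r₁ ^ p := Real.rpow_pos_of_pos hr1 p
  have hp2 : 0 < r₂ ^ p := Real.rpow_pos_of_pos hr2 p
  set x₁ := ∫ r in I₁, F r
  set x₂ := ∫ r in I₂, F r
  set x₃ := ∫ r in T, F r
  calc |x₁ + x₂ + x₃ - (r₁ ^ p * √(Real.pi / (κ₁ * n)) + r₂ ^ p * √(Real.pi / (κ₂ * n)))|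
      = |(x₁ - r₁ ^ p * √(Real.pi / (κ₁ * n))) + (x₂ - r₂ ^ p * √(Real.pi / (κ₂ * n))) + x₃| := by
        congr 1; ring
    _ ≤ C₁ * (1 + |p|) / n * r₁ ^ p + C₂ * (1 + |p|) / n * r₂ ^ p +
          2 * Real.pi * (2 / η) / n * r₂ ^ p :=
        (abs_add_le _ _).trans (add_le_add ((abs_add_le _ _).trans (add_le_add e1 e2)) eT)
    _ ≤ C₁ * (1 + |p|) / n * (r₁ ^ p + r₂ ^ p) + C₂ * (1 + |p|) / n * (r₁ ^ p + r₂ ^ p) +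
          2 * Real.pi * (2 / η) * (1 + |p|) / n * (r₁ ^ p + r₂ ^ p) := by
        have hπ : 2 * Real.pi * (2 / η) ≤ 2 * Real.pi * (2 / η) * (1 + |p|) :=
          le_mul_of_one_le_right (by positivity) (by linarith [abs_nonneg p])
        refine add_le_add (add_le_add ?_ ?_) ?_
        · gcongr
          linarith
        · gcongr
          linarith
        · refine mul_le_mul ?_ (by linarith) hp2.le (by positivity)
          gcongr
    _ = _ := by ring

/-- A crude lower bound for the integral with two peaks, valid for all exponents. -/
lemma IsTwoPeak.lower_bound {V : ℝ → ℝ} {r₁ κ₁ r₂ κ₂ δ M η : ℝ}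
    (h : IsTwoPeak V r₁ κ₁ r₂ κ₂ δ M η) :
    ∃ c n₀ : ℝ, 0 < c ∧ 1 ≤ n₀ ∧ ∀ n p : ℝ, n₀ ≤ n →
      IntegrableOn (fun r => r ^ p * Real.exp (-n * V r)) (Ioi 0) →
      c / √n * (r₁ ^ p + r₂ ^ p) ≤ ∫ r in Ioi 0, r ^ p * Real.exp (-n * V r) := by
  have hr1 := h.left.pos
  have hr2 := h.right.pos
  have hδ := h.left.delta_pos
  have hδ1 := h.left.delta_le
  have hδ2 := h.right.delta_le
  have h12 : r₁ < r₂ := by linarith [h.sep]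
  set c₁ := Real.exp (-(2 * κ₁)) / 2
  set c₂ := Real.exp (-(2 * κ₂)) / 2 / (r₂ / r₁ + 1)
  have hc1 : 0 < c₁ := by positivity
  have hc2 : 0 < c₂ := by positivity
  refine ⟨min c₁ c₂, max 1 (1 / δ ^ 2), lt_min hc1 hc2, le_max_left _ _, fun n p hn hi => ?_⟩
  have hn1 : 1 ≤ n := (le_max_left _ _).trans hn
  have hn0 : 0 < n := by linarith
  have hsq : 0 < √n := Real.sqrt_pos.2 hn0
  -- Within distance n^{-1/2} of a peak, nV is at most 2κ.
  set u := 1 / √n with hu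
  have hu0 : 0 < u := by positivity
  have hu2 : n * u ^ 2 = 1 := by
    rw [hu, div_pow, Real.sq_sqrt hn0.le]; field_simp
  have huδ : u ≤ δ := by
    have h1 : 1 / δ ^ 2 ≤ n := (le_max_right _ _).trans hn
    rw [div_le_iff₀ (by positivity)] at h1
    rw [hu, div_le_iff₀ hsq]
    have h2 : (1 : ℝ) ^ 2 ≤ (δ * √n) ^ 2 := by
      rw [mul_pow, Real.sq_sqrt hn0.le]
      linarith
    exact abs_le_of_sq_le_sq' h2 (by positivity) |>.2
  have hp1 : 0 < r₁ ^ p := Real.rpow_pos_of_pos hr1 p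
  have hp2 : 0 < r₂ ^ p := Real.rpow_pos_of_pos hr2 p
  have hexp : ∀ {r₀ κ : ℝ}, IsPeak V r₀ κ δ M → ∀ s, |s| ≤ u →
      Real.exp (-(2 * κ)) ≤ Real.exp (-n * V (r₀ + s)) := by
    intro r₀ κ hpk s hs
    apply Real.exp_le_exp.2
    have hb := (abs_le.1 (hpk.bound s (hs.trans huδ))).2
    have h1 : M * |s| ^ 3 ≤ κ / 4 * s ^ 2 := by
      have : M * |s| ≤ κ / 4 := by
        calc M * |s| ≤ M * δ := mul_le_mul_of_nonneg_left (hs.trans huδ) hpk.M_nonneg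
          _ = δ * M := by ring
          _ ≤ _ := hpk.delta_mul_le
      calc M * |s| ^ 3 = (M * |s|) * s ^ 2 := by rw [← sq_abs s]; ring
        _ ≤ _ := by gcongr
    have h2 : s ^ 2 ≤ u ^ 2 := by rw [← sq_abs s]; gcongr
    have hκ := hpk.kappa_pos
    have h3 : V (r₀ + s) ≤ 2 * κ * u ^ 2 := by nlinarith [sq_nonneg s]
    have h4 : n * V (r₀ + s) ≤ n * (2 * κ * u ^ 2) := by gcongr
    nlinarith
  have hgen : ∀ {a y : ℝ}, 0 < a → (∀ r ∈ Icc a (a + u), y ≤ r ^ p * Real.exp (-n * V r)) →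
      y * u ≤ ∫ r in Ioi 0, r ^ p * Real.exp (-n * V r) := by
    intro a y ha hy
    have hs : Icc a (a + u) ⊆ Ioi (0 : ℝ) := fun r hr => lt_of_lt_of_le ha hr.1
    calc y * u = ∫ _ in Icc a (a + u), y := by
          rw [setIntegral_const, measureReal_def, Real.volume_Icc, add_sub_cancel_left,
            ENNReal.toReal_ofReal hu0.le, smul_eq_mul, mul_comm]
      _ ≤ ∫ r in Icc a (a + u), r ^ p * Real.exp (-n * V r) :=
          setIntegral_mono_on (integrableOn_const (by simp)) (hi.mono_set hs)
            measurableSet_Icc hy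
      _ ≤ _ := by
          apply setIntegral_mono_set hi _ (Eventually.of_forall hs)
          exact (ae_restrict_iff' measurableSet_Ioi).2 (Eventually.of_forall fun r hr =>
            mul_nonneg (Real.rpow_nonneg (le_of_lt hr) _) (Real.exp_pos _).le)
  -- For p ≥ -1 the power r₂^p dominates up to the factor r₂/r₁, and an interval to the right of r₂
  -- suffices, at the cost of 1/2 when p < 0. For p ≤ -1 the power r₁^p dominates, and an interval
  -- to the left of r₁ is used.
  rcases le_total (-1) p with hp | hp
  · have hle : r₁ ^ p ≤ r₂ / r₁ * r₂ ^ p := by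
      have h1 : (r₁ / r₂) ^ p ≤ (r₁ / r₂) ^ (-1 : ℝ) :=
        Real.rpow_le_rpow_of_exponent_ge (by positivity) ((div_le_one hr2).2 h12.le) hp
      rw [Real.rpow_neg_one, inv_div, Real.div_rpow hr1.le hr2.le, div_le_iff₀ hp2] at h1
      exact h1
    have hy : ∀ r ∈ Icc r₂ (r₂ + u), Real.exp (-(2 * κ₂)) / 2 * r₂ ^ p ≤
        r ^ p * Real.exp (-n * V r) := by
      intro r hr
      have he := hexp h.right (r - r₂) (by
        rw [abs_of_nonneg (by linarith [hr.1])]; linarith [hr.2])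
      rw [add_sub_cancel] at he
      have hr0 : 0 < r := lt_of_lt_of_le hr2 hr.1
      have hrp : r₂ ^ p / 2 ≤ r ^ p := by
        rcases le_total 0 p with h0 | h0
        · have := Real.rpow_le_rpow hr2.le hr.1 h0
          linarith
        · have h1 : (2 * r₂) ^ p ≤ r ^ p :=
            Real.rpow_le_rpow_of_nonpos hr0 (by linarith [hr.2]) h0
          rw [Real.mul_rpow (by norm_num) hr2.le] at h1
          have h2 : (2 : ℝ) ^ (-1 : ℝ) ≤ 2 ^ p := Real.rpow_le_rpow_of_exponent_le (by norm_num) hp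
          rw [Real.rpow_neg_one] at h2
          nlinarith
      calc Real.exp (-(2 * κ₂)) / 2 * r₂ ^ p = r₂ ^ p / 2 * Real.exp (-(2 * κ₂)) := by ring
        _ ≤ _ := by gcongr
    refine le_trans ?_ (hgen hr2 hy)
    calc min c₁ c₂ / √n * (r₁ ^ p + r₂ ^ p) ≤ c₂ / √n * ((r₂ / r₁ + 1) * r₂ ^ p) := by
          gcongr
          · exact min_le_right _ _
          · linarith
      _ = Real.exp (-(2 * κ₂)) / 2 * r₂ ^ p * u := by
          rw [hu]
          simp only [c₂]
          field_simp
  · have hle : r₂ ^ p ≤ r₁ ^ p := Real.rpow_le_rpow_of_nonpos hr1 h12.le (by linarith)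
    have hy : ∀ r ∈ Icc (r₁ - u) (r₁ - u + u), Real.exp (-(2 * κ₁)) * r₁ ^ p ≤
        r ^ p * Real.exp (-n * V r) := by
      intro r hr
      rw [sub_add_cancel] at hr
      have he := hexp h.left (r - r₁) (by
        rw [abs_of_nonpos (by linarith [hr.2])]; linarith [hr.1])
      rw [add_sub_cancel] at he
      have hr0 : 0 < r := lt_of_lt_of_le (by linarith) hr.1
      have hrp : r₁ ^ p ≤ r ^ p := Real.rpow_le_rpow_of_nonpos hr0 hr.2 (by linarith)
      calc Real.exp (-(2 * κ₁)) * r₁ ^ p = r₁ ^ p * Real.exp (-(2 * κ₁)) := by ring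
        _ ≤ _ := by gcongr
    refine le_trans ?_ (hgen (by linarith) hy)
    calc min c₁ c₂ / √n * (r₁ ^ p + r₂ ^ p) ≤ c₁ / √n * (2 * r₁ ^ p) := by
          gcongr
          · exact min_le_left _ _
          · linarith
      _ = Real.exp (-(2 * κ₁)) * r₁ ^ p * u := by
          rw [hu]
          simp only [c₁]
          field_simp

/-! ### Radial functions and their Laplacian -/

/-- Q is constant along θ ↦ z e^{iθ}, whose velocity at 0 is iz. -/
lemma fderiv_tangential {Q : ℂ → ℝ} (hrad : ∀ z : ℂ, Q z = Q ((‖z‖ : ℝ) : ℂ)) {z : ℂ}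
    (hd : DifferentiableAt ℝ Q z) : fderiv ℝ Q z (Complex.I * z) = 0 := by
  have h1 : HasDerivAt (fun θ : ℝ => z * Complex.exp (θ * Complex.I)) (Complex.I * z) 0 := by
    have h2 : HasDerivAt (fun θ : ℝ => (θ : ℂ) * Complex.I) Complex.I 0 := by
      simpa using (Complex.ofRealCLM.hasDerivAt (x := (0 : ℝ))).mul_const Complex.I
    have h3 := (h2.cexp).const_mul z
    simpa [mul_comm] using h3
  have h4 : HasDerivAt (fun θ : ℝ => Q (z * Complex.exp (θ * Complex.I)))
      (fderiv ℝ Q z (Complex.I * z)) 0 := by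
    have hd' : HasFDerivAt Q (fderiv ℝ Q z) (z * Complex.exp ((0 : ℝ) * Complex.I)) := by
      simpa using hd.hasFDerivAt
    exact hd'.comp_hasDerivAt (0 : ℝ) h1
  have h5 : (fun θ : ℝ => Q (z * Complex.exp (θ * Complex.I))) = fun _ => Q z := by
    ext θ
    rw [hrad, hrad z, norm_mul, Complex.norm_exp_ofReal_mul_I, mul_one]
  rw [h5] at h4
  exact h4.unique (hasDerivAt_const _ _)

lemma hasDerivAt_radial {Q : ℂ → ℝ} {r : ℝ} (hd : DifferentiableAt ℝ Q (r : ℂ)) :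
    HasDerivAt (fun t : ℝ => Q (t : ℂ)) (fderiv ℝ Q (r : ℂ) 1) r := by
  have h := Complex.ofRealCLM.hasDerivAt (x := r)
  simp only [Complex.ofRealCLM_apply, Complex.ofReal_one] at h
  exact hd.hasFDerivAt.comp_hasDerivAt r h

/-- The Laplacian of a radial function. -/
lemma lap_radial {Q : ℂ → ℝ} (hrad : ∀ z : ℂ, Q z = Q ((‖z‖ : ℝ) : ℂ)) {r : ℝ} (hr : 0 < r)
    (hd : ContDiffAt ℝ 2 Q (r : ℂ)) :
    4 * lap Q (r : ℂ) = deriv (deriv fun t : ℝ => Q (t : ℂ)) r +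
      deriv (fun t : ℝ => Q (t : ℂ)) r / r := by
  have hev : ∀ᶠ z in 𝓝 (r : ℂ), DifferentiableAt ℝ Q z := by
    have := hd.eventually (by simp)
    filter_upwards [this] with z hz using hz.differentiableAt (by simp)
  have hD : DifferentiableAt ℝ (fderiv ℝ Q) (r : ℂ) :=
    (hd.fderiv_right (m := 1) (by norm_num)).differentiableAt (by simp)
  have hcast : ContinuousAt (fun t : ℝ => (t : ℂ)) r := Complex.continuous_ofReal.continuousAt
  have hev' : ∀ᶠ t : ℝ in 𝓝 r, DifferentiableAt ℝ Q (t : ℂ) := hcast.eventually hev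
  have hd1 : deriv (fun t : ℝ => Q (t : ℂ)) r = fderiv ℝ Q (r : ℂ) 1 :=
    (hasDerivAt_radial hev'.self_of_nhds).deriv
  have hd2 : deriv (deriv fun t : ℝ => Q (t : ℂ)) r = fderiv ℝ (fderiv ℝ Q) (r : ℂ) 1 1 := by
    have e : (deriv fun t : ℝ => Q (t : ℂ)) =ᶠ[𝓝 r] fun t => fderiv ℝ Q (t : ℂ) 1 := by
      filter_upwards [hev'] with t ht using (hasDerivAt_radial ht).deriv
    rw [e.deriv_eq]
    have h := Complex.ofRealCLM.hasDerivAt (x := r)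
    simp only [Complex.ofRealCLM_apply, Complex.ofReal_one] at h
    have h2 := (hD.hasFDerivAt.comp_hasDerivAt r h).clm_apply (hasDerivAt_const r (1 : ℂ))
    simpa using h2.deriv
  -- Differentiate DQ(z)(iz) = 0 at z = r in the direction i: D²Q(i, ir) + DQ(-1) = 0.
  have htan : fderiv ℝ (fderiv ℝ Q) (r : ℂ) Complex.I Complex.I * r = fderiv ℝ Q (r : ℂ) 1 := by
    have h1 : HasFDerivAt (fun z : ℂ => Complex.I * z) (Complex.I • ContinuousLinearMap.id ℝ ℂ) (r : ℂ) :=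
      (hasFDerivAt_id (r : ℂ)).const_mul Complex.I
    have h2 := hD.hasFDerivAt.clm_apply h1
    have e : (fun z => fderiv ℝ Q z (Complex.I * z)) =ᶠ[𝓝 (r : ℂ)] fun _ => 0 := by
      filter_upwards [hev] with z hz using fderiv_tangential hrad hz
    have h3 := (h2.congr_of_eventuallyEq e.symm).unique (hasFDerivAt_const (0 : ℝ) (r : ℂ))
    have h4 := congrArg (fun L => L Complex.I) h3
    simp only [add_apply, ContinuousLinearMap.comp_apply,
      smul_apply, ContinuousLinearMap.flip_apply,
      ContinuousLinearMap.id_apply, smul_eq_mul, Complex.I_mul_I, map_neg,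
      zero_apply] at h4
    have h5 : Complex.I * (r : ℂ) = r • Complex.I := by rw [Complex.real_smul, mul_comm]
    rw [h5, map_smul, smul_eq_mul] at h4
    linarith
  have hlap : 4 * lap Q (r : ℂ) = fderiv ℝ (fderiv ℝ Q) (r : ℂ) 1 1 +
      fderiv ℝ (fderiv ℝ Q) (r : ℂ) Complex.I Complex.I := by
    rw [lap, InnerProductSpace.laplacian_eq_iteratedFDeriv_complexPlane]
    simp only [iteratedFDeriv_two_apply, Matrix.cons_val_zero, Matrix.cons_val_one]
    ring
  rw [hlap, hd2, hd1, ← htan]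
  field_simp

/-- Mean value inequality on [-|s|, |s|]. Dropping the optimal factor 1/(k+1) keeps the same
constant under iteration. -/
lemma abs_le_pow_succ_of_deriv {g g' : ℝ → ℝ} {δ C : ℝ} {k : ℕ} (hC : 0 ≤ C) (h0 : g 0 = 0)
    (hg : ∀ t, |t| ≤ δ → HasDerivAt g (g' t) t) (hb : ∀ t, |t| ≤ δ → |g' t| ≤ C * |t| ^ k) {s : ℝ}
    (hs : |s| ≤ δ) : |g s| ≤ C * |s| ^ (k + 1) := by
  have hle : ∀ t ∈ Icc (-|s|) |s|, |t| ≤ |s| := fun t ht => abs_le.2 ht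
  have h := Convex.norm_image_sub_le_of_norm_hasDerivWithin_le (f := g) (f' := g')
    (s := Icc (-|s|) |s|) (C := C * |s| ^ k) (x := 0) (y := s)
    (fun t ht => (hg t ((hle t ht).trans hs)).hasDerivWithinAt)
    (fun t ht => (hb t ((hle t ht).trans hs)).trans (mul_le_mul_of_nonneg_left
      (pow_le_pow_left₀ (abs_nonneg t) (hle t ht) k) hC))
    (convex_Icc _ _) ⟨by simp, by simp⟩ ⟨neg_abs_le s, le_abs_self s⟩
  rw [h0, sub_zero, sub_zero, Real.norm_eq_abs, Real.norm_eq_abs] at h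
  rw [pow_succ, ← mul_assoc]
  exact h

/-- Second order Taylor expansion at a zero of a function together with its derivative. -/
lemma exists_taylor_quadratic {V : ℝ → ℝ} {r₀ : ℝ} (hV : ContDiffAt ℝ 3 V r₀) (h0 : V r₀ = 0)
    (h1 : deriv V r₀ = 0) :
    ∃ δ M : ℝ, 0 < δ ∧ 0 ≤ M ∧ ∀ s, |s| ≤ δ →
      |V (r₀ + s) - deriv (deriv V) r₀ / 2 * s ^ 2| ≤ M * |s| ^ 3 := by
  have hD1 : ContDiffAt ℝ 2 (deriv V) r₀ := hV.derivWithin (by norm_num)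
  have hD2 : ContDiffAt ℝ 1 (deriv (deriv V)) r₀ := hD1.derivWithin (by norm_num)
  obtain ⟨L, t, ht, hL⟩ := hD2.exists_lipschitzOnWith
  have hev1 : ∀ᶠ x in 𝓝 r₀, HasDerivAt V (deriv V x) x := by
    filter_upwards [hV.eventually (by simp)] with x hx
      using (hx.differentiableAt (by simp)).hasDerivAt
  have hev2 : ∀ᶠ x in 𝓝 r₀, HasDerivAt (deriv V) (deriv (deriv V) x) x := by
    filter_upwards [hD1.eventually (by simp)] with x hx
      using (hx.differentiableAt (by simp)).hasDerivAt
  obtain ⟨δ, hδ, hball⟩ := Metric.nhds_basis_closedBall.mem_iff.1 (inter_mem (inter_mem hev1 hev2) ht)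
  have hmem : ∀ s, |s| ≤ δ → r₀ + s ∈ Metric.closedBall r₀ δ := by
    intro s hs
    simpa [Real.dist_eq] using hs
  set W := deriv (deriv V) r₀ with hW
  have hshift : ∀ s, HasDerivAt (fun s : ℝ => r₀ + s) 1 s := fun s => (hasDerivAt_id s).const_add r₀
  refine ⟨δ, L, hδ, L.2, fun s hs => ?_⟩
  -- The second derivative is locally Lipschitz; this bound is then integrated twice.
  have b1 : ∀ s, |s| ≤ δ → |deriv (deriv V) (r₀ + s) - W| ≤ (L : ℝ) * |s| ^ 1 := by
    intro s hs
    have := hL.dist_le_mul _ (hball (hmem s hs)).2 _ (hball (hmem 0 (by simpa using hδ.le))).2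
    simpa [Real.dist_eq] using this
  have b2 : ∀ s, |s| ≤ δ → |deriv V (r₀ + s) - W * s| ≤ (L : ℝ) * |s| ^ 2 := by
    intro s hs
    refine abs_le_pow_succ_of_deriv (g := fun s => deriv V (r₀ + s) - W * s)
      (g' := fun s => deriv (deriv V) (r₀ + s) - W) L.2 (by simp [h1]) (fun t ht => ?_) b1 hs
    have h2 : HasDerivAt (deriv V) (deriv (deriv V) (r₀ + t)) (r₀ + t) := (hball (hmem t ht)).1.2
    have h3 := h2.comp t (hshift t)
    have h4 : HasDerivAt (fun s => deriv V (r₀ + s) - W * s)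
        (deriv (deriv V) (r₀ + t) * 1 - W * 1) t := h3.sub ((hasDerivAt_id t).const_mul W)
    simpa using h4
  refine abs_le_pow_succ_of_deriv (g := fun s => V (r₀ + s) - W / 2 * s ^ 2)
    (g' := fun s => deriv V (r₀ + s) - W * s) L.2 (by simp [h0]) (fun t ht => ?_) b2 hs
  have h2 : HasDerivAt V (deriv V (r₀ + t)) (r₀ + t) := (hball (hmem t ht)).1.1
  have h3 := h2.comp t (hshift t)
  have h4 : HasDerivAt (fun s => V (r₀ + s) - W / 2 * s ^ 2)
      (deriv V (r₀ + t) * 1 - W / 2 * ((2 : ℕ) * t ^ (2 - 1))) t :=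
    h3.sub ((hasDerivAt_pow 2 t).const_mul (W / 2))
  convert h4 using 1
  push_cast
  ring

/-- At a zero of the nonnegative function `Q - A - B log`, with `Q` radial, smooth and strictly
subharmonic, one has a nondegenerate peak. -/
lemma exists_isPeak {Q : ℂ → ℝ} (hrad : ∀ z : ℂ, Q z = Q ((‖z‖ : ℝ) : ℂ)) {r₀ : ℝ} (hr : 0 < r₀)
    (hd : ContDiffAt ℝ 3 Q (r₀ : ℂ)) (hlap : 0 < lap Q (r₀ : ℂ)) {A B : ℝ}
    (h0 : Q (r₀ : ℂ) = A + B * Real.log r₀)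
    (hge : ∀ r : ℝ, 0 < r → A + B * Real.log r ≤ Q (r : ℂ)) :
    ∃ δ M : ℝ, 0 < δ ∧ ∀ δ', 0 < δ' → δ' ≤ δ → ∀ M', M ≤ M' → δ' * M' ≤ 2 * lap Q (r₀ : ℂ) / 4 →
      IsPeak (fun r => Q (r : ℂ) - A - B * Real.log r) r₀ (2 * lap Q (r₀ : ℂ)) δ' M' := by
  set q : ℝ → ℝ := fun r => Q (r : ℂ) with hq
  set V : ℝ → ℝ := fun r => Q (r : ℂ) - A - B * Real.log r with hVdef
  have hqd : ContDiffAt ℝ 3 q r₀ :=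
    ContDiffAt.comp r₀ (g := Q) (f := fun r : ℝ => (r : ℂ)) hd
      Complex.ofRealCLM.contDiff.contDiffAt
  have hVd : ContDiffAt ℝ 3 V r₀ :=
    (hqd.sub contDiffAt_const).sub (contDiffAt_const.mul (Real.contDiffAt_log.2 hr.ne'))
  have hV0 : V r₀ = 0 := by simp only [hVdef]; linarith
  have hpos : ∀ᶠ r in 𝓝 r₀, 0 < r := lt_mem_nhds hr
  have hmin : IsLocalMin V r₀ := by
    filter_upwards [hpos] with r hr'
    rw [hV0]
    simp only [hVdef]
    linarith [hge r hr']
  have hV1 : deriv V r₀ = 0 := hmin.deriv_eq_zero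
  have hqev : ∀ᶠ r in 𝓝 r₀, HasDerivAt q (deriv q r) r := by
    filter_upwards [hqd.eventually (by simp)] with r hr'
      using (hr'.differentiableAt (by simp)).hasDerivAt
  have hVev : deriv V =ᶠ[𝓝 r₀] fun r => deriv q r - B * r⁻¹ := by
    filter_upwards [hqev, hpos] with r h1 h2
    exact ((h1.sub_const A).sub ((Real.hasDerivAt_log h2.ne').const_mul B)).deriv
  have hq1 : deriv q r₀ = B * r₀⁻¹ := by
    have := hVev.self_of_nhds
    rw [hV1] at this
    linarith
  have hq2 : HasDerivAt (deriv q) (deriv (deriv q) r₀) r₀ :=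
    ((hqd.derivWithin (m := 2) (by norm_num)).differentiableAt (by simp)).hasDerivAt
  -- V' vanishes at r₀, so B = r₀q'(r₀), and the term B/r₀² of V'' is the q'/r₀ of the radial
  -- Laplacian.
  have hV2 : deriv (deriv V) r₀ = 4 * lap Q (r₀ : ℂ) := by
    rw [hVev.deriv_eq, lap_radial hrad hr (hd.of_le (by norm_num))]
    have h1 : HasDerivAt (fun r => deriv q r - B * r⁻¹)
        (deriv (deriv q) r₀ - B * (-(r₀ ^ 2)⁻¹)) r₀ :=
      hq2.sub ((hasDerivAt_inv hr.ne').const_mul B)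
    rw [h1.deriv]
    change _ = deriv (deriv q) r₀ + deriv q r₀ / r₀
    rw [hq1]
    field_simp
    ring
  obtain ⟨δ, M, hδ, hM, hb⟩ := exists_taylor_quadratic hVd hV0 hV1
  -- The bound survives shrinking δ and enlarging M, so that two peaks can share their constants.
  refine ⟨min δ (r₀ / 2), M, lt_min hδ (by linarith), fun δ' h1 h2 M' hM' h3 => ?_⟩
  refine ⟨hr, by linarith, h1, h2.trans (min_le_right _ _), hM.trans hM', h3, fun s hs => ?_⟩
  have h4 := hb s (hs.trans (h2.trans (min_le_left _ _)))
  rw [hV2] at h4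
  calc |V (r₀ + s) - 2 * lap Q (r₀ : ℂ) * s ^ 2|
      = |V (r₀ + s) - 4 * lap Q (r₀ : ℂ) / 2 * s ^ 2| := by congr 2; ring
    _ ≤ M * |s| ^ 3 := h4
    _ ≤ M' * |s| ^ 3 := by gcongr

/-- The weight `e^{-n(Q - A - B log)}` of a gap has two peaks. -/
lemma exists_isTwoPeak {Q : ℂ → ℝ} (hQ : LowerSemicontinuous Q)
    (hQ_inf : Tendsto (fun z : ℂ => Q z - 2 * Real.log ‖z‖) (cocompact ℂ) atTop)
    (hrad : ∀ z : ℂ, Q z = Q ((‖z‖ : ℝ) : ℂ)) {r₁ r₂ : ℝ} (hr1 : 0 < r₁) (h12 : r₁ < r₂)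
    (hd1 : ContDiffAt ℝ 3 Q (r₁ : ℂ)) (hd2 : ContDiffAt ℝ 3 Q (r₂ : ℂ))
    (hlap1 : 0 < lap Q (r₁ : ℂ)) (hlap2 : 0 < lap Q (r₂ : ℂ)) {A B : ℝ} (hB0 : 0 < B) (hB2 : B < 2)
    (h01 : Q (r₁ : ℂ) = A + B * Real.log r₁) (h02 : Q (r₂ : ℂ) = A + B * Real.log r₂)
    (hgt : ∀ r : ℝ, 0 < r → r ≠ r₁ → r ≠ r₂ → A + B * Real.log r < Q (r : ℂ)) :
    ∃ δ M η : ℝ, IsTwoPeak (fun r => Q (r : ℂ) - A - B * Real.log r)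
      r₁ (2 * lap Q (r₁ : ℂ)) r₂ (2 * lap Q (r₂ : ℂ)) δ M η := by
  have hr2 : 0 < r₂ := hr1.trans h12
  have hge : ∀ r : ℝ, 0 < r → A + B * Real.log r ≤ Q (r : ℂ) := by
    intro r hr
    by_cases e1 : r = r₁
    · rw [e1, h01]
    by_cases e2 : r = r₂
    · rw [e2, h02]
    exact (hgt r hr e1 e2).le
  obtain ⟨δ₁, M₁, hδ1, hp1⟩ := exists_isPeak hrad hr1 hd1 hlap1 h01 hge
  obtain ⟨δ₂, M₂, hδ2, hp2⟩ := exists_isPeak hrad hr2 hd2 hlap2 h02 hge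
  set M := max 1 (max M₁ M₂)
  have hM : 0 < M := lt_max_of_lt_left one_pos
  have hM1 : M₁ ≤ M := (le_max_left _ _).trans (le_max_right _ _)
  have hM2 : M₂ ≤ M := (le_max_right _ _).trans (le_max_right _ _)
  set l := min (lap Q (r₁ : ℂ)) (lap Q (r₂ : ℂ))
  have hl : 0 < l := lt_min hlap1 hlap2
  -- (r₂ - r₁)/4 separates the two intervals; l/(2M) gives δM ≤ l/2, the smallness condition of a
  -- peak with κ = 2ΔQ.
  set δ := min (min δ₁ δ₂) (min ((r₂ - r₁) / 4) (l / (2 * M)))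
  have hδ : 0 < δ := lt_min (lt_min hδ1 hδ2) (lt_min (by linarith) (by positivity))
  have hδM : δ * M ≤ l / 2 := by
    have : δ ≤ l / (2 * M) := (min_le_right _ _).trans (min_le_right _ _)
    rw [le_div_iff₀ (by positivity)] at this
    linarith
  have hδ4 : δ ≤ (r₂ - r₁) / 4 := (min_le_right _ _).trans (min_le_left _ _)
  have hl1 : l ≤ lap Q (r₁ : ℂ) := min_le_left _ _
  have hl2 : l ≤ lap Q (r₂ : ℂ) := min_le_right _ _
  set V : ℝ → ℝ := fun r => Q (r : ℂ) - A - B * Real.log r with hVdef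
  have hqlsc : LowerSemicontinuous fun r : ℝ => Q (r : ℂ) := hQ.comp Complex.continuous_ofReal
  have hVm : Measurable V :=
    (hqlsc.measurable.sub_const A).sub (Real.measurable_log.const_mul B)
  -- growth at infinity
  obtain ⟨R, hR1, hR⟩ : ∃ R : ℝ, 1 ≤ R ∧ ∀ r, R ≤ r → (2 - B) / 2 * (1 + |Real.log r|) ≤ V r := by
    obtain ⟨R, hR⟩ : ∃ R : ℝ, ∀ r, R ≤ r → (2 - B) + A ≤ Q (r : ℂ) - 2 * Real.log r := by
      have h1 : Tendsto (fun r : ℝ => (r : ℂ)) atTop (cocompact ℂ) :=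
        Complex.isometry_ofReal.isClosedEmbedding.tendsto_cocompact.mono_left atTop_le_cocompact
      have h2 := (hQ_inf.comp h1).eventually_ge_atTop ((2 - B) + A)
      obtain ⟨R, hR⟩ := eventually_atTop.1 h2
      refine ⟨max R 0, fun r hr => ?_⟩
      have := hR r ((le_max_left _ _).trans hr)
      simpa [abs_of_nonneg ((le_max_right _ _).trans hr)] using this
    refine ⟨max 1 R, le_max_left _ _, fun r hr => ?_⟩
    have h1 := hR r ((le_max_right _ _).trans hr)
    have hl0 : 0 ≤ Real.log r := Real.log_nonneg ((le_max_left _ _).trans hr)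
    rw [abs_of_nonneg hl0]
    simp only [hVdef]
    nlinarith
  -- behaviour at the origin
  obtain ⟨ε, hε0, hε1, hε⟩ : ∃ ε : ℝ, 0 < ε ∧ ε ≤ 1 ∧
      ∀ r, 0 < r → r ≤ ε → B / 2 * (1 + |Real.log r|) ≤ V r := by
    obtain ⟨m, hm⟩ := (hqlsc.lowerSemicontinuousOn (Icc 0 1)).bddBelow_of_isCompact isCompact_Icc
    -- The second entry is the solution of m - A - B log r ≥ (B/2)(1 - log r) for log r.
    set y := min 0 ((2 * m - 2 * A) / B - 1)
    refine ⟨Real.exp y, Real.exp_pos _, Real.exp_le_one_iff.2 (min_le_left _ _), fun r hr hre => ?_⟩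
    have hlog : Real.log r ≤ y := (Real.log_le_iff_le_exp hr).2 hre
    have hl0 : Real.log r ≤ 0 := hlog.trans (min_le_left _ _)
    have hl1 : Real.log r ≤ (2 * m - 2 * A) / B - 1 := hlog.trans (min_le_right _ _)
    have hr1 : r ≤ 1 := (Real.log_nonpos_iff hr.le).1 hl0
    have hQm : m ≤ Q (r : ℂ) := hm (mem_image_of_mem _ ⟨hr.le, hr1⟩)
    rw [abs_of_nonpos hl0]
    have h1 : (Real.log r + 1) * B ≤ 2 * m - 2 * A := by
      rw [← le_div_iff₀ hB0]; linarith
    simp only [hVdef]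
    linarith
  -- the compact part
  obtain ⟨η₀, hη0, hηc⟩ : ∃ η₀ : ℝ, 0 < η₀ ∧ ∀ r ∈ Icc ε R, δ < |r - r₁| → δ < |r - r₂| →
      η₀ * (1 + |Real.log r|) ≤ V r := by
    set K : Set ℝ := Icc ε R ∩ {r | δ ≤ |r - r₁| ∧ δ ≤ |r - r₂|} with hK
    have hKc : IsCompact K := by
      apply isCompact_Icc.inter_right
      exact (isClosed_le continuous_const (continuous_id.sub continuous_const).abs).inter
        (isClosed_le continuous_const (continuous_id.sub continuous_const).abs)
    rcases K.eq_empty_or_nonempty with he | hne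
    · refine ⟨1, one_pos, fun r hr h1 h2 => ?_⟩
      have : r ∈ K := ⟨hr, h1.le, h2.le⟩
      rw [he] at this
      exact absurd this (notMem_empty r)
    have hcont : ContinuousOn (fun r => Real.log r) (Icc ε R) := by
      apply Real.continuousOn_log.mono
      intro r hr
      exact (hε0.trans_le hr.1).ne'
    have hl : LowerSemicontinuousOn V K := by
      have h1 : LowerSemicontinuousOn (fun r : ℝ => Q (r : ℂ) + (-A - B * Real.log r)) K := by
        apply (hqlsc.lowerSemicontinuousOn K).add
        apply ContinuousOn.lowerSemicontinuousOn
        exact (continuousOn_const.sub (continuousOn_const.mul hcont)).mono inter_subset_left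
      convert h1 using 2
      simp only [hVdef]
      ring
    obtain ⟨x, hxK, hx⟩ := hl.exists_isMinOn hne hKc
    have hx0 : 0 < x := hε0.trans_le hxK.1.1
    have hVx : 0 < V x := by
      have := hgt x hx0 (fun e => by
        have := hxK.2.1; rw [e, sub_self, abs_zero] at this; linarith) (fun e => by
        have := hxK.2.2; rw [e, sub_self, abs_zero] at this; linarith)
      simp only [hVdef]
      linarith
    obtain ⟨D, hD⟩ := isCompact_Icc.exists_bound_of_continuousOn hcont
    have hD0 : 0 ≤ D := (norm_nonneg _).trans (hD x hxK.1)
    refine ⟨V x / (1 + D), by positivity, fun r hr h1 h2 => ?_⟩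
    calc V x / (1 + D) * (1 + |Real.log r|) ≤ V x / (1 + D) * (1 + D) := by
          gcongr
          exact hD r hr
      _ = V x := div_mul_cancel₀ _ (by positivity)
      _ ≤ V r := hx ⟨hr, h1.le, h2.le⟩
  refine ⟨δ, M, min η₀ (min ((2 - B) / 2) (B / 2)), hVm, hp1 δ hδ ?_ M hM1 ?_, hp2 δ hδ ?_ M hM2 ?_,
    by linarith, lt_min hη0 (lt_min (by linarith) (by linarith)), fun r hr h1 h2 => ?_⟩
  · exact (min_le_left _ _).trans (min_le_left _ _)
  · linarith
  · exact (min_le_left _ _).trans (min_le_right _ _)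
  · linarith
  · have hfac : 0 ≤ 1 + |Real.log r| := by positivity
    rcases le_total r ε with hrε | hrε
    · refine le_trans ?_ (hε r hr hrε)
      gcongr
      exact (min_le_right _ _).trans (min_le_right _ _)
    rcases le_total R r with hrR | hrR
    · refine le_trans ?_ (hR r hrR)
      gcongr
      exact (min_le_right _ _).trans (min_le_left _ _)
    · refine le_trans ?_ (hηc r ⟨hrε, hrR⟩ h1 h2)
      gcongr
      exact min_le_left _ _

/-! ### Norms of weighted monomials -/

/-- Polar coordinates, with 2 = 2π/π from the normalization of the area. The integrands agree
pointwise, so the identity also holds for a monomial of infinite norm, where both integrals default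
to 0. -/
lemma weightedMonomialNormSq_eq {Q : ℂ → ℝ} (hrad : ∀ z : ℂ, Q z = Q ((‖z‖ : ℝ) : ℂ)) (A B : ℝ)
    (n j : ℕ) :
    weightedMonomialNormSq Q n j = 2 * Real.exp (-(n * A)) *
      ∫ r in Ioi (0 : ℝ), r ^ (2 * (j : ℝ) + 1 - n * B) *
        Real.exp (-(n : ℝ) * (Q (r : ℂ) - A - B * Real.log r)) := by
  have h1 : ∀ z : ℂ, ‖weightedMonomial Q n j z‖ ^ 2 =
      (fun r : ℝ => r ^ (2 * j) * Real.exp (-(n : ℝ) * Q (r : ℂ))) ‖z‖ := by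
    intro z
    simp only [weightedMonomial]
    rw [norm_mul, norm_pow, Complex.norm_real, Real.norm_of_nonneg (Real.exp_pos _).le, mul_pow,
      ← pow_mul, mul_comm j 2, ← Real.exp_nat_mul, hrad z]
    congr 2
    push_cast
    ring
  simp only [weightedMonomialNormSq, h1]
  rw [areaMeasure, integral_smul_measure, integral_fun_norm_addHaar volume
    (fun r : ℝ => r ^ (2 * j) * Real.exp (-(n : ℝ) * Q (r : ℂ)))]
  have hvol : (volume : Measure ℂ).real (Metric.ball 0 1) = Real.pi := by
    rw [measureReal_def, Complex.volume_ball]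
    simp
  rw [hvol, Complex.finrank_real_complex, ENNReal.toReal_ofReal (by positivity)]
  have h2 : ∫ r in Ioi (0 : ℝ), r ^ (2 - 1) • (r ^ (2 * j) * Real.exp (-(n : ℝ) * Q (r : ℂ))) =
      Real.exp (-(n * A)) * ∫ r in Ioi (0 : ℝ), r ^ (2 * (j : ℝ) + 1 - n * B) *
        Real.exp (-(n : ℝ) * (Q (r : ℂ) - A - B * Real.log r)) := by
    rw [← integral_const_mul]
    apply setIntegral_congr_fun measurableSet_Ioi
    intro r hr
    have hr0 : 0 < r := hr
    simp only [smul_eq_mul]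
    rw [Real.rpow_sub hr0, Real.rpow_add hr0, Real.rpow_one,
      show (2 * (j : ℝ)) = ((2 * j : ℕ) : ℝ) by push_cast; ring, Real.rpow_natCast]
    have h3 : Real.exp (-(n : ℝ) * (Q (r : ℂ) - A - B * Real.log r)) =
        Real.exp (-(n : ℝ) * Q (r : ℂ)) * Real.exp (n * A) * r ^ (n * B) := by
      rw [Real.rpow_def_of_pos hr0, ← Real.exp_add, ← Real.exp_add]
      congr 1
      ring
    have h4 : Real.exp (-(n * A)) * Real.exp (n * A) = 1 := by rw [← Real.exp_add]; simp
    have h5 : r ^ ((n : ℝ) * B) ≠ 0 := (Real.rpow_pos_of_pos hr0 _).ne'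
    rw [h3]
    field_simp
    linear_combination (-r) * h4
  rw [h2]
  simp only [nsmul_eq_mul, smul_eq_mul, Nat.cast_ofNat]
  field_simp

/-! ### Coefficients of the weighted Szegő kernel. -/

/-- The denominators of the weighted Szegő kernel. -/
noncomputable def szegoDenom (r₁ r₂ Δ₁ Δ₂ p : ℝ) : ℝ := r₁ ^ p / √Δ₁ + r₂ ^ p / √Δ₂

lemma szegoDenom_pos {r₁ r₂ Δ₁ Δ₂ : ℝ} (hr1 : 0 < r₁) (hr2 : 0 < r₂) (h1 : 0 < Δ₁) (h2 : 0 < Δ₂)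
    (p : ℝ) : 0 < szegoDenom r₁ r₂ Δ₁ Δ₂ p := by
  have := Real.rpow_pos_of_pos hr1 p
  have := Real.rpow_pos_of_pos hr2 p
  have := Real.sqrt_pos.2 h1
  have := Real.sqrt_pos.2 h2
  unfold szegoDenom
  positivity

lemma sqrt_two_pi_mul_div_le {n : ℝ} : √(2 * Real.pi * n) / (2 * Real.pi) ≤ √n := by
  have h1 : 0 < 2 * Real.pi := by positivity
  rw [Real.sqrt_mul h1.le, div_le_iff₀ h1, mul_comm]
  apply mul_le_mul_of_nonneg_left _ (Real.sqrt_nonneg _)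
  rw [Real.sqrt_le_left h1.le]
  nlinarith [Real.pi_gt_three]

/-- Comparison of the reciprocal norms with the coefficients of the weighted Szegő kernel. -/
lemma IsTwoPeak.reciprocal {V : ℝ → ℝ} {r₁ Δ₁ r₂ Δ₂ δ M η : ℝ} (hΔ1 : 0 < Δ₁) (hΔ2 : 0 < Δ₂)
    (h : IsTwoPeak V r₁ (2 * Δ₁) r₂ (2 * Δ₂) δ M η) :
    ∃ C n₀ : ℝ, 0 ≤ C ∧ 1 ≤ n₀ ∧ ∀ n x : ℝ, n₀ ≤ n → 0 ≤ x → x ≤ 1 → ∀ l : ℤ,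
      |1 / (2 * ∫ r in Ioi 0, r ^ (2 * (l : ℝ) + 1 - 2 * x) * Real.exp (-n * V r)) -
        √(2 * Real.pi * n) / (2 * Real.pi) / szegoDenom r₁ r₂ Δ₁ Δ₂ (2 * (l : ℝ) + 1 - 2 * x)| ≤
      C * (1 + |(l : ℝ)|) / szegoDenom r₁ r₂ Δ₁ Δ₂ (2 * (l : ℝ) + 1 - 2 * x) := by
  have hr1 := h.left.pos
  have hr2 := h.right.pos
  -- For |ℓ| ≤ √n one has |p| ≤ 2|ℓ| + 1 ≤ 3√n, hence p² ≤ 9n.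
  obtain ⟨C₁, n₁, hC1, hn1, hL⟩ := h.laplace 9
  obtain ⟨c, n₂, hc, -, hlow⟩ := h.lower_bound
  have s1 := Real.sqrt_pos.2 hΔ1
  have s2 := Real.sqrt_pos.2 hΔ2
  set d := √Δ₁ + √Δ₂ with hd
  set e := 1 / √Δ₁ + 1 / √Δ₂ with he
  have hd0 : 0 < d := by positivity
  have he0 : 0 < e := by positivity
  set C₂ := 4 * (C₁ * d / (c / e))
  set C₃ := 1 / (2 * (c / e)) + 1
  refine ⟨C₂ + C₃, max n₁ n₂, by positivity, hn1.trans (le_max_left _ _), fun n x hn hx0 hx1 l => ?_⟩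
  have hnn1 : n₁ ≤ n := (le_max_left _ _).trans hn
  have hnn2 : n₂ ≤ n := (le_max_right _ _).trans hn
  have hn1' : 1 ≤ n := hn1.trans hnn1
  have hn0 : 0 < n := by linarith
  have hsn : 1 ≤ √n := Real.one_le_sqrt.2 hn1'
  have hsn0 : 0 < √n := by linarith
  set p := 2 * (l : ℝ) + 1 - 2 * x with hp
  set I := ∫ r in Ioi 0, r ^ p * Real.exp (-n * V r) with hI
  set D := szegoDenom r₁ r₂ Δ₁ Δ₂ p with hD
  set g := √(2 * Real.pi * n) / (2 * Real.pi) with hg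
  have hD0 : 0 < D := szegoDenom_pos hr1 hr2 hΔ1 hΔ2 p
  have hg0 : 0 < g := by positivity
  have hgn : g ≤ √n := sqrt_two_pi_mul_div_le
  have hp1 : 0 < r₁ ^ p := Real.rpow_pos_of_pos hr1 p
  have hp2 : 0 < r₂ ^ p := Real.rpow_pos_of_pos hr2 p
  have hl0 : 0 ≤ |(l : ℝ)| := abs_nonneg _
  have hpl : |p| ≤ 2 * |(l : ℝ)| + 1 := by
    calc |p| = |2 * (l : ℝ) + (1 - 2 * x)| := by rw [hp]; congr 1; ring
      _ ≤ |2 * (l : ℝ)| + |1 - 2 * x| := abs_add_le _ _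
      _ ≤ 2 * |(l : ℝ)| + 1 := by
          rw [abs_mul, abs_of_pos (by norm_num : (0 : ℝ) < 2)]
          have : |1 - 2 * x| ≤ 1 := abs_le.2 ⟨by linarith, by linarith⟩
          linarith
  have hsumD : r₁ ^ p + r₂ ^ p ≤ d * D := by
    have e1 : r₁ ^ p = √Δ₁ * (r₁ ^ p / √Δ₁) := by field_simp
    have e2 : r₂ ^ p = √Δ₂ * (r₂ ^ p / √Δ₂) := by field_simp
    have q1 : 0 < r₁ ^ p / √Δ₁ := by positivity
    have q2 : 0 < r₂ ^ p / √Δ₂ := by positivity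
    have e3 : d * D = √Δ₁ * (r₁ ^ p / √Δ₁) + √Δ₁ * (r₂ ^ p / √Δ₂) + √Δ₂ * (r₁ ^ p / √Δ₁) +
        √Δ₂ * (r₂ ^ p / √Δ₂) := by
      simp only [hd, hD, szegoDenom]; ring
    rw [e3, ← e1, ← e2]
    have := mul_pos s1 q2
    have := mul_pos s2 q1
    linarith
  have hDsum : D ≤ e * (r₁ ^ p + r₂ ^ p) := by
    have e3 : e * (r₁ ^ p + r₂ ^ p) = D + (r₂ ^ p / √Δ₁ + r₁ ^ p / √Δ₂) := by
      simp only [he, hD, szegoDenom]; ring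
    rw [e3]
    have : 0 < r₂ ^ p / √Δ₁ + r₁ ^ p / √Δ₂ := by positivity
    linarith
  have hIlow : IntegrableOn (fun r => r ^ p * Real.exp (-n * V r)) (Ioi 0) →
      c / e / √n * D ≤ I := by
    intro hi
    refine le_trans ?_ (hlow n p hnn2 hi)
    calc c / e / √n * D ≤ c / e / √n * (e * (r₁ ^ p + r₂ ^ p)) := by gcongr
      _ = c / √n * (r₁ ^ p + r₂ ^ p) := by field_simp
  rcases le_or_gt |(l : ℝ)| (√n) with hln | hln
  · have hp9 : p ^ 2 ≤ 9 * n := by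
      have h1 : |p| ≤ 3 * √n := by linarith
      calc p ^ 2 = |p| ^ 2 := (sq_abs p).symm
        _ ≤ (3 * √n) ^ 2 := by gcongr
        _ = 9 * n := by rw [mul_pow, Real.sq_sqrt hn0.le]; norm_num
    obtain ⟨hi, hap⟩ := hL n p hnn1 hp9
    have hIl := hIlow hi
    have hI0 : 0 < I := lt_of_lt_of_le (by positivity) hIl
    set G := √(Real.pi / (2 * n)) with hG
    -- The Laplace main term of I is G·D, so this identity makes g/D the main term of 1/(2I).
    have hgG : 2 * g * G = 1 := by
      have h1 : √(2 * Real.pi * n) * G = Real.pi := by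
        rw [hG, ← Real.sqrt_mul (by positivity)]
        have : 2 * Real.pi * n * (Real.pi / (2 * n)) = Real.pi ^ 2 := by field_simp
        rw [this, Real.sqrt_sq Real.pi_pos.le]
      have h2 : 2 * g * G = (√(2 * Real.pi * n) * G) / Real.pi := by
        rw [hg]; field_simp
      rw [h2, h1, div_self Real.pi_pos.ne']
    have hGD : r₁ ^ p * √(Real.pi / (2 * Δ₁ * n)) + r₂ ^ p * √(Real.pi / (2 * Δ₂ * n)) = G * D := by
      have h1 : ∀ Δ : ℝ, 0 < Δ → √(Real.pi / (2 * Δ * n)) = G / √Δ := by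
        intro Δ hΔ
        rw [hG, ← Real.sqrt_div (by positivity)]
        congr 1
        field_simp
      rw [h1 _ hΔ1, h1 _ hΔ2]
      simp only [hD, szegoDenom]
      ring
    rw [hGD] at hap
    have hid : 1 / (2 * I) - g / D = g * (G * D - I) / (I * D) := by
      have h1 : g * (G * D - I) / (I * D) = (2 * g * G) / (2 * I) - g / D := by
        field_simp
      rw [h1, hgG]
    rw [hid, abs_div, abs_mul, abs_of_pos hg0, abs_of_pos (mul_pos hI0 hD0), abs_sub_comm]
    have hce : 0 < c / e := by positivity
    calc g * |I - G * D| / (I * D)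
        ≤ √n * (C₁ * (1 + |p|) / n * (d * D)) / (c / e / √n * D * D) := by
          gcongr
          exact hap.trans (by gcongr)
      _ = C₁ * d / (c / e) * (1 + |p|) / D := by
          have : √n * √n = n := Real.mul_self_sqrt hn0.le
          generalize c / e = ce at *
          field_simp
          rw [sq, this]
          field_simp
      _ ≤ C₁ * d / (c / e) * (4 * (1 + |(l : ℝ)|)) / D := by
          gcongr
          linarith
      _ ≤ (C₂ + C₃) * (1 + |(l : ℝ)|) / D := by
          refine div_le_div_of_nonneg_right ?_ hD0.le
          have : 0 ≤ C₃ * (1 + |(l : ℝ)|) := by positivity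
          have e4 : C₁ * d / (c / e) * (4 * (1 + |(l : ℝ)|)) = C₂ * (1 + |(l : ℝ)|) := by
            simp only [C₂]; ring
          rw [e4, add_mul]
          linarith
  · have hce : 0 < c / e := by positivity
    have h1 : |1 / (2 * I)| ≤ 1 / (2 * (c / e)) * √n / D := by
      by_cases hi : IntegrableOn (fun r => r ^ p * Real.exp (-n * V r)) (Ioi 0)
      · have hIl := hIlow hi
        have hI0 : 0 < I := lt_of_lt_of_le (by positivity) hIl
        rw [abs_of_pos (by positivity)]
        calc 1 / (2 * I) ≤ 1 / (2 * (c / e / √n * D)) := by gcongr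
          _ = _ := by
            generalize c / e = ce at *
            field_simp
      -- A divergent integral is 0 and its reciprocal is 0, matching the convention that a monomial
      -- of infinite norm contributes nothing.
      · have : I = 0 := integral_undef hi
        rw [this]
        simp only [mul_zero, div_zero, abs_zero]
        positivity
    calc |1 / (2 * I) - g / D| ≤ |1 / (2 * I)| + |g / D| := abs_sub _ _
      _ ≤ 1 / (2 * (c / e)) * √n / D + √n / D := by
          rw [abs_of_pos (div_pos hg0 hD0)]
          gcongr
      _ = C₃ * √n / D := by simp only [C₃]; ring
      _ ≤ (C₂ + C₃) * (1 + |(l : ℝ)|) / D := by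
          have : 0 ≤ C₂ := by positivity
          gcongr
          · linarith
          · linarith

/-- Geometric decay of the terms of the weighted Szegő kernel. -/
lemma rpow_div_szegoDenom_le {r₁ r₂ Δ₁ Δ₂ ρ : ℝ} (hr1 : 0 < r₁) (hr2 : 0 < r₂)
    (h1 : 0 < Δ₁) (h2 : 0 < Δ₂) (hρ0 : 0 < ρ) (hρ1 : ρ < 1) {Y : ℝ} (hY1 : r₁ ^ 2 / ρ ≤ Y)
    (hY2 : Y ≤ ρ * r₂ ^ 2) {x : ℝ} (hx0 : 0 ≤ x) (hx1 : x ≤ 1) (l : ℤ) :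
    Y ^ ((l : ℝ) - x) / szegoDenom r₁ r₂ Δ₁ Δ₂ (2 * (l : ℝ) + 1 - 2 * x) ≤
      (√Δ₂ / r₂ * (r₂ ^ 2 / r₁ ^ 2) + √Δ₁ / r₁) * ρ ^ l.natAbs := by
  have s1 := Real.sqrt_pos.2 h1
  have s2 := Real.sqrt_pos.2 h2
  have hY0 : 0 < Y := lt_of_lt_of_le (by positivity) hY1
  have hYr : r₁ ^ 2 ≤ Y := by
    refine le_trans ?_ hY1
    rw [le_div_iff₀ hρ0]
    nlinarith [sq_nonneg r₁]
  set p := 2 * (l : ℝ) + 1 - 2 * x with hp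
  have hpow : ∀ r : ℝ, 0 < r → r ^ p = r * (r ^ 2) ^ ((l : ℝ) - x) := by
    intro r hr
    rw [← Real.rpow_natCast r 2, ← Real.rpow_mul hr.le]
    nth_rewrite 2 [← Real.rpow_one r]
    rw [← Real.rpow_add hr]
    congr 1
    push_cast
    rw [hp]; ring
  have hp1 : 0 < r₁ ^ p := Real.rpow_pos_of_pos hr1 p
  have hp2 : 0 < r₂ ^ p := Real.rpow_pos_of_pos hr2 p
  have hYp : 0 < Y ^ ((l : ℝ) - x) := Real.rpow_pos_of_pos hY0 _
  have hρl : 0 < ρ ^ l.natAbs := by positivity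
  -- Keep only the r₂ term of the denominator for ℓ ≥ 0 and only the r₁ term for ℓ < 0. In the first
  -- case the shift -x works against the decay and costs at most (r₂/r₁)².
  rcases le_or_gt 0 l with hl | hl
  · have hnat : (l : ℝ) = (l.natAbs : ℝ) := by
      rw [← Int.cast_natCast, Int.natAbs_of_nonneg hl]
    have hu0 : 0 < Y / r₂ ^ 2 := by positivity
    have hu1 : Y / r₂ ^ 2 ≤ ρ := by rwa [div_le_iff₀ (by positivity)]
    have hu2 : (Y / r₂ ^ 2) ^ ((l : ℝ) - x) ≤ ρ ^ l.natAbs * (r₂ ^ 2 / r₁ ^ 2) := by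
      rw [sub_eq_add_neg, Real.rpow_add hu0]
      apply mul_le_mul _ _ (Real.rpow_nonneg hu0.le _) hρl.le
      · rw [hnat, Real.rpow_natCast]
        exact pow_le_pow_left₀ hu0.le hu1 _
      · calc (Y / r₂ ^ 2) ^ (-x) ≤ (Y / r₂ ^ 2) ^ (-1 : ℝ) :=
              Real.rpow_le_rpow_of_exponent_ge hu0 (hu1.trans hρ1.le) (by linarith)
          _ = r₂ ^ 2 / Y := by rw [Real.rpow_neg_one, inv_div]
          _ ≤ r₂ ^ 2 / r₁ ^ 2 := by gcongr
    calc Y ^ ((l : ℝ) - x) / szegoDenom r₁ r₂ Δ₁ Δ₂ p ≤ Y ^ ((l : ℝ) - x) / (r₂ ^ p / √Δ₂) := by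
          gcongr
          unfold szegoDenom
          have : 0 < r₁ ^ p / √Δ₁ := by positivity
          linarith
      _ = √Δ₂ / r₂ * (Y / r₂ ^ 2) ^ ((l : ℝ) - x) := by
          rw [hpow r₂ hr2, Real.div_rpow hY0.le (by positivity)]
          have : 0 < (r₂ ^ 2) ^ ((l : ℝ) - x) := Real.rpow_pos_of_pos (by positivity) _
          field_simp
      _ ≤ √Δ₂ / r₂ * (ρ ^ l.natAbs * (r₂ ^ 2 / r₁ ^ 2)) := by gcongr
      _ ≤ _ := by
          have : 0 ≤ √Δ₁ / r₁ * ρ ^ l.natAbs := by positivity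
          rw [add_mul]
          linarith
  · have hnat : (l : ℝ) = -(l.natAbs : ℝ) := by
      have : (l.natAbs : ℤ) = -l := Int.ofNat_natAbs_of_nonpos hl.le
      rw [← Int.cast_natCast, this]
      push_cast
      ring
    have hu0 : 0 < Y / r₁ ^ 2 := by positivity
    have hu1 : 1 / ρ ≤ Y / r₁ ^ 2 := by
      rw [le_div_iff₀ (by positivity), one_div, inv_mul_eq_div]
      exact hY1
    have hu3 : 1 ≤ Y / r₁ ^ 2 := le_trans (by rw [le_div_iff₀ hρ0]; linarith) hu1
    have hu2 : (Y / r₁ ^ 2) ^ ((l : ℝ) - x) ≤ ρ ^ l.natAbs := by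
      calc (Y / r₁ ^ 2) ^ ((l : ℝ) - x) ≤ (Y / r₁ ^ 2) ^ (l : ℝ) :=
            Real.rpow_le_rpow_of_exponent_le hu3 (by linarith)
        _ ≤ (1 / ρ) ^ (l : ℝ) :=
            Real.rpow_le_rpow_of_nonpos (by positivity) hu1 (by rw [hnat]; simp)
        _ = ρ ^ l.natAbs := by
            rw [hnat, Real.rpow_neg (by positivity), Real.rpow_natCast, one_div, inv_pow, inv_inv]
    calc Y ^ ((l : ℝ) - x) / szegoDenom r₁ r₂ Δ₁ Δ₂ p ≤ Y ^ ((l : ℝ) - x) / (r₁ ^ p / √Δ₁) := by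
          gcongr
          unfold szegoDenom
          have : 0 < r₂ ^ p / √Δ₂ := by positivity
          linarith
      _ = √Δ₁ / r₁ * (Y / r₁ ^ 2) ^ ((l : ℝ) - x) := by
          rw [hpow r₁ hr1, Real.div_rpow hY0.le (by positivity)]
          have : 0 < (r₁ ^ 2) ^ ((l : ℝ) - x) := Real.rpow_pos_of_pos (by positivity) _
          field_simp
      _ ≤ √Δ₁ / r₁ * ρ ^ l.natAbs := by gcongr
      _ ≤ _ := by
          have : 0 ≤ √Δ₂ / r₂ * (r₂ ^ 2 / r₁ ^ 2) * ρ ^ l.natAbs := by positivity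
          rw [add_mul]
          linarith

lemma summable_one_add_abs_mul_geometric {ρ : ℝ} (h0 : 0 < ρ) (h1 : ρ < 1) :
    Summable fun l : ℤ => (1 + |(l : ℝ)|) * ρ ^ l.natAbs := by
  have h : Summable fun n : ℕ => (1 + (n : ℝ)) * ρ ^ n := by
    have e1 := summable_geometric_of_lt_one h0.le h1
    have e2 := summable_pow_mul_geometric_of_norm_lt_one 1 (r := ρ) (by
      rwa [Real.norm_of_nonneg h0.le])
    refine (e1.add e2).congr fun n => ?_
    simp
    ring
  apply Summable.of_nat_of_neg
  · simpa using h
  · simpa using h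

/-- The product of the moduli of two separated points near the gap lies strictly between the
squares of the radii. -/
lemma exists_separation {r₁ r₂ c : ℝ} (hr1 : 0 < r₁) (hr2 : 0 < r₂) (hc : 0 < c) :
    ∃ ρ ε : ℝ, 0 < ρ ∧ ρ < 1 ∧ 0 < ε ∧ ε < r₁ ∧ ∀ s t : ℝ, r₁ - ε < s → r₁ - ε < t → s < r₂ + ε →
      t < r₂ + ε → c < |s - t| → r₁ ^ 2 / ρ ≤ s * t ∧ s * t ≤ ρ * r₂ ^ 2 := by
  set ρ := max (1 / (1 + c / (4 * r₁))) (max (1 - c / (2 * r₂)) (1 / 2)) with hρ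
  have hρ0 : 0 < ρ := lt_max_of_lt_right (lt_max_of_lt_right (by norm_num))
  have hc1 : 0 < c / (4 * r₁) := by positivity
  have hc2 : 0 < c / (2 * r₂) := by positivity
  have hρ1 : ρ < 1 := by
    refine max_lt ?_ (max_lt (by linarith) (by norm_num))
    rw [div_lt_one (by positivity)]
    linarith
  -- For t - s > c the product lies between (r₁-ε)(r₁-ε+c) ≥ r₁² + cr₁/4 and (r₂+ε-c)(r₂+ε) ≤ r₂² -
  -- cr₂/2; ρ is chosen to fit these two margins.
  set ε := min (r₁ / 4) (c / 4)
  have hε0 : 0 < ε := lt_min (by linarith) (by linarith)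
  have hε1 : ε ≤ r₁ / 4 := min_le_left _ _
  have hε2 : ε ≤ c / 4 := min_le_right _ _
  have main : ∀ s t : ℝ, r₁ - ε < s → t < r₂ + ε → c < t - s →
      r₁ ^ 2 / ρ ≤ s * t ∧ s * t ≤ ρ * r₂ ^ 2 := by
    intro s t hs ht hst
    have hs0 : 0 < s := by linarith
    have ht0 : 0 < t := by linarith
    constructor
    · have e1 : 1 / (1 + c / (4 * r₁)) ≤ ρ := le_max_left _ _
      rw [div_le_iff₀ (by positivity)] at e1
      rw [div_le_iff₀ hρ0]
      have e2 : (r₁ - ε) * (r₁ - ε + c) ≤ s * t := by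
        apply mul_le_mul hs.le (by linarith) (by linarith) hs0.le
      have e3 : r₁ ^ 2 * (1 + c / (4 * r₁)) ≤ (r₁ - ε) * (r₁ - ε + c) := by
        have : r₁ ^ 2 * (1 + c / (4 * r₁)) = r₁ ^ 2 + c * r₁ / 4 := by field_simp
        rw [this]
        nlinarith [mul_nonneg hε0.le (sub_nonneg.2 hε1), mul_le_mul_of_nonneg_left hε2 hr1.le,
          mul_le_mul_of_nonneg_left hε1 hc.le, sq_nonneg ε]
      calc r₁ ^ 2 = r₁ ^ 2 * 1 := by ring
        _ ≤ r₁ ^ 2 * (ρ * (1 + c / (4 * r₁))) := by gcongr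
        _ = r₁ ^ 2 * (1 + c / (4 * r₁)) * ρ := by ring
        _ ≤ s * t * ρ := mul_le_mul_of_nonneg_right (e3.trans e2) hρ0.le
    · have e1 : 1 - c / (2 * r₂) ≤ ρ := (le_max_left _ _).trans (le_max_right _ _)
      have e2 : s * t ≤ (r₂ + ε - c) * (r₂ + ε) :=
        mul_le_mul (by linarith) ht.le ht0.le (by linarith)
      have e3 : (r₂ + ε - c) * (r₂ + ε) ≤ (1 - c / (2 * r₂)) * r₂ ^ 2 := by
        have : (1 - c / (2 * r₂)) * r₂ ^ 2 = r₂ ^ 2 - c * r₂ / 2 := by field_simp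
        rw [this]
        nlinarith [mul_le_mul_of_nonneg_left hε2 hr2.le, mul_le_mul_of_nonneg_left hε2 hε0.le,
          mul_pos hc hε0]
      refine e2.trans (e3.trans ?_)
      gcongr
  refine ⟨ρ, ε, hρ0, hρ1, hε0, by linarith, fun s t hs1 ht1 hs2 ht2 hst => ?_⟩
  rcases lt_abs.1 hst with h | h
  · have := main t s ht1 hs2 h
    rwa [mul_comm t s] at this
  · exact main s t hs1 ht2 (by linarith)

/-! ### Comparison of the two kernels -/

/-- Joins the e^{nA} from the norms to the weights at z and w, leaving the reciprocals estimated by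
`IsTwoPeak.reciprocal`. -/
lemma corrKernel_eq_sum {Q : ℂ → ℝ} (hrad : ∀ z : ℂ, Q z = Q ((‖z‖ : ℝ) : ℂ)) (A B : ℝ)
    (n : ℕ) (z w : ℂ) :
    corrKernel Q n z w = ∑ j ∈ Finset.range n, (z * conj w) ^ j *
      ((Real.exp (n * A - (n : ℝ) / 2 * (Q z + Q w)) *
        (1 / (2 * ∫ r in Ioi (0 : ℝ), r ^ (2 * (j : ℝ) + 1 - n * B) *
          Real.exp (-(n : ℝ) * (Q (r : ℂ) - A - B * Real.log r)))) : ℝ) : ℂ) := by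
  unfold corrKernel
  refine Finset.sum_congr rfl fun j _ => ?_
  rw [weightedMonomialNormSq_eq hrad A B]
  set I := ∫ r in Ioi (0 : ℝ), r ^ (2 * (j : ℝ) + 1 - n * B) *
          Real.exp (-(n : ℝ) * (Q (r : ℂ) - A - B * Real.log r))
  have h1 : Real.exp (n * A - (n : ℝ) / 2 * (Q z + Q w)) = Real.exp (-((n : ℝ) / 2) * Q z) *
      Real.exp (-((n : ℝ) / 2) * Q w) / Real.exp (-(n * A)) := by
    rw [← Real.exp_add, ← Real.exp_sub]
    congr 1
    ring
  rw [h1]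
  simp only [weightedMonomial, map_mul, map_pow, Complex.conj_ofReal, mul_pow]
  push_cast
  simp only [div_eq_mul_inv, mul_inv]
  ring

lemma szegoTerm_eq {Q : ℂ → ℝ} {r₁ r₂ B : ℝ} {n : ℕ} {z w : ℂ} (hy : z * conj w ≠ 0) (c : ℝ)
    (l : ℤ) :
    (z * conj w) ^ (⌊B * n / 2⌋ + l) *
      ((c / szegoDenom r₁ r₂ (lap Q r₁) (lap Q r₂)
        (2 * (l : ℝ) + 1 - 2 * Int.fract (B * n / 2)) : ℝ) : ℂ) =
      (z * conj w) ^ ⌊B * n / 2⌋ * (c : ℂ) * szegoTerm Q r₁ r₂ B n z w l := by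
  rw [zpow_add₀ hy]
  simp only [szegoTerm, szegoDenom]
  push_cast
  ring

/-- Q(r₁) and Q(r₂) are values of A + B log, so the powers of r₁r₂ cancel and only e^{nA} survives.
-/
lemma weight_eq {Q : ℂ → ℝ} {r₁ r₂ A B : ℝ} (hr1 : 0 < r₁) (hr2 : 0 < r₂)
    (h01 : Q (r₁ : ℂ) = A + B * Real.log r₁) (h02 : Q (r₂ : ℂ) = A + B * Real.log r₂)
    (n : ℕ) (z w : ℂ) :
    (r₁ * r₂) ^ (-(B * n / 2)) * Real.exp ((n : ℝ) / 2 * (Q (r₁ : ℂ) - Q z) +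
      (n : ℝ) / 2 * (Q (r₂ : ℂ) - Q w)) = Real.exp (n * A - (n : ℝ) / 2 * (Q z + Q w)) := by
  rw [Real.rpow_def_of_pos (mul_pos hr1 hr2), ← Real.exp_add, Real.log_mul hr1.ne' hr2.ne', h01,
    h02]
  congr 1
  ring

/-- The weighted monomials are bounded by powers with the fractional exponent. -/
lemma zpow_mul_weight_le {Q : ℂ → ℝ} (hrad : ∀ z : ℂ, Q z = Q ((‖z‖ : ℝ) : ℂ)) {A B : ℝ}
    (hge : ∀ r : ℝ, 0 < r → A + B * Real.log r ≤ Q (r : ℂ)) (n : ℕ) {z w : ℂ} (hz : 0 < ‖z‖)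
    (hw : 0 < ‖w‖) (l : ℤ) :
    ‖z * conj w‖ ^ (⌊B * n / 2⌋ + l) * Real.exp (n * A - (n : ℝ) / 2 * (Q z + Q w)) ≤
      (‖z‖ * ‖w‖) ^ ((l : ℝ) - Int.fract (B * n / 2)) := by
  have hY : 0 < ‖z‖ * ‖w‖ := mul_pos hz hw
  rw [norm_mul, Complex.norm_conj, ← Real.rpow_intCast]
  have h1 : ((⌊B * n / 2⌋ + l : ℤ) : ℝ) = ((l : ℝ) - Int.fract (B * n / 2)) + B * n / 2 := by
    have := Int.floor_add_fract (B * n / 2)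
    push_cast
    linarith
  rw [h1, Real.rpow_add hY, mul_assoc]
  -- The remaining factor is e^{-n(V(|z|) + V(|w|))/2}, and V ≥ 0.
  refine mul_le_of_le_one_right (Real.rpow_nonneg hY.le _) ?_
  rw [Real.rpow_def_of_pos hY, ← Real.exp_add, Real.exp_le_one_iff,
    Real.log_mul hz.ne' hw.ne']
  have h2 := hge _ hz
  have h3 := hge _ hw
  rw [← hrad] at h2 h3
  have hn : 0 ≤ (n : ℝ) / 2 := by positivity
  nlinarith [mul_le_mul_of_nonneg_left h2 hn, mul_le_mul_of_nonneg_left h3 hn]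

/-- A sum over an initial segment of the natural numbers as a shifted sum over the integers. -/
lemma hasSum_shift_range (n : ℕ) (m : ℤ) (f : ℤ → ℂ) :
    HasSum (fun l : ℤ => if 0 ≤ m + l ∧ m + l < n then f (m + l) else 0)
      (∑ j ∈ Finset.range n, f j) := by
  have hinj : Function.Injective fun j : ℕ => (j : ℤ) - m := fun i j hij => by
    have : (i : ℤ) - m = j - m := hij
    omega
  rw [← hinj.hasSum_iff]
  · have h1 : ∀ j ∉ Finset.range n, ((fun l : ℤ => if 0 ≤ m + l ∧ m + l < n then f (m + l) else 0) ∘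
        fun j : ℕ => (j : ℤ) - m) j = 0 := by
      intro j hj
      rw [Finset.mem_range] at hj
      simp only [Function.comp_apply, add_sub_cancel]
      exact if_neg (by omega)
    have h2 := hasSum_sum_of_ne_finset_zero h1 (L := SummationFilter.unconditional ℕ)
    rwa [Finset.sum_congr rfl fun j hj => ?_] at h2
    rw [Finset.mem_range] at hj
    simp only [Function.comp_apply, add_sub_cancel]
    rw [if_pos (by omega)]
  · intro l hl
    refine if_neg fun h => hl ⟨(m + l).toNat, ?_⟩
    have := Int.toNat_of_nonneg h.1
    simp only [this, add_sub_cancel_left]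

/-- Comparison of the correlation kernel and the weighted Szegő kernel, for a fixed `n`. -/
lemma norm_corrKernel_sub_le {Q : ℂ → ℝ} (hrad : ∀ z : ℂ, Q z = Q ((‖z‖ : ℝ) : ℂ))
    {r₁ r₂ A B : ℝ} (hr1 : 0 < r₁) (hr2 : 0 < r₂) (hΔ1 : 0 < lap Q r₁) (hΔ2 : 0 < lap Q r₂)
    (h01 : Q (r₁ : ℂ) = A + B * Real.log r₁) (h02 : Q (r₂ : ℂ) = A + B * Real.log r₂)
    (hge : ∀ r : ℝ, 0 < r → A + B * Real.log r ≤ Q (r : ℂ)) {C : ℝ} (hC : 0 ≤ C) {n : ℕ}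
    (hn : 0 < n)
    (hrec : ∀ l : ℤ, |1 / (2 * ∫ r in Ioi (0 : ℝ),
        r ^ (2 * (l : ℝ) + 1 - 2 * Int.fract (B * n / 2)) *
          Real.exp (-(n : ℝ) * (Q (r : ℂ) - A - B * Real.log r))) -
        √(2 * Real.pi * n) / (2 * Real.pi) / szegoDenom r₁ r₂ (lap Q r₁) (lap Q r₂)
          (2 * (l : ℝ) + 1 - 2 * Int.fract (B * n / 2))| ≤
      C * (1 + |(l : ℝ)|) / szegoDenom r₁ r₂ (lap Q r₁) (lap Q r₂)
          (2 * (l : ℝ) + 1 - 2 * Int.fract (B * n / 2)))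
    (hnB : √(n : ℝ) ≤ B * n / 2) (hnB' : √(n : ℝ) ≤ n - B * n / 2)
    {ρ : ℝ} (hρ0 : 0 < ρ) (hρ1 : ρ < 1) {z w : ℂ} (hz : 0 < ‖z‖) (hw : 0 < ‖w‖)
    (hY1 : r₁ ^ 2 / ρ ≤ ‖z‖ * ‖w‖) (hY2 : ‖z‖ * ‖w‖ ≤ ρ * r₂ ^ 2) :
    Summable (szegoTerm Q r₁ r₂ B n z w) ∧
    ‖corrKernel Q n z w - ((√(2 * Real.pi * n) : ℝ) : ℂ) * szegoKernel Q r₁ r₂ B n z w *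
        (z * conj w) ^ ⌊B * n / 2⌋ * (((r₁ * r₂) ^ (-(B * n / 2)) : ℝ) : ℂ) *
        ((Real.exp ((n : ℝ) / 2 * (Q (r₁ : ℂ) - Q z) +
          (n : ℝ) / 2 * (Q (r₂ : ℂ) - Q w)) : ℝ) : ℂ)‖ ≤
      ∑' l : ℤ, (C + 1) * (√(lap Q r₂) / r₂ * (r₂ ^ 2 / r₁ ^ 2) + √(lap Q r₁) / r₁) *
        ((1 + |(l : ℝ)|) * ρ ^ l.natAbs) := by
  set m := ⌊B * n / 2⌋ with hm
  set x := Int.fract (B * n / 2) with hx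
  have hmx : (m : ℝ) + x = B * n / 2 := Int.floor_add_fract _
  have hx0 : 0 ≤ x := Int.fract_nonneg _
  have hx1 : x < 1 := Int.fract_lt_one _
  set D : ℤ → ℝ := fun l =>
    szegoDenom r₁ r₂ (lap Q r₁) (lap Q r₂) (2 * (l : ℝ) + 1 - 2 * x) with hD
  have hD0 : ∀ l, 0 < D l := fun l => szegoDenom_pos hr1 hr2 hΔ1 hΔ2 _
  set R : ℝ → ℝ := fun p => 1 / (2 * ∫ r in Ioi (0 : ℝ), r ^ p *
          Real.exp (-(n : ℝ) * (Q (r : ℂ) - A - B * Real.log r))) with hR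
  set g := √(2 * Real.pi * n) / (2 * Real.pi) with hg
  set E := Real.exp (n * A - (n : ℝ) / 2 * (Q z + Q w)) with hE
  have hE0 : 0 < E := Real.exp_pos _
  have hnR : 0 < (n : ℝ) := by exact_mod_cast hn
  have hg0 : 0 < g := by positivity
  have hgn : g ≤ √n := sqrt_two_pi_mul_div_le
  set y := z * conj w with hy
  have hy0 : y ≠ 0 := by
    rw [hy]
    simp only [ne_eq, mul_eq_zero, map_eq_zero, not_or]
    exact ⟨norm_pos_iff.1 hz, norm_pos_iff.1 hw⟩
  -- S₁ is the kernel reindexed by ℓ = j - m and extended by zero; S₂ is its model over all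
  -- integers.
  set S₁ : ℤ → ℂ := fun l => if 0 ≤ m + l ∧ m + l < n then
    y ^ (m + l) * ((E * R (2 * (((m + l : ℤ) : ℝ)) + 1 - n * B) : ℝ) : ℂ) else 0 with hS1
  set S₂ : ℤ → ℂ := fun l => y ^ (m + l) * (((E * g) / D l : ℝ) : ℂ) with hS2
  set b : ℤ → ℝ := fun l => (C + 1) * (√(lap Q r₂) / r₂ * (r₂ ^ 2 / r₁ ^ 2) +
    √(lap Q r₁) / r₁) * ((1 + |(l : ℝ)|) * ρ ^ l.natAbs) with hb
  have hbs : Summable b := (summable_one_add_abs_mul_geometric hρ0 hρ1).mul_left _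
  have hsum1 : HasSum S₁ (corrKernel Q n z w) := by
    rw [corrKernel_eq_sum hrad A B]
    have := hasSum_shift_range n m
      (fun j => y ^ j * ((E * R (2 * (j : ℝ) + 1 - n * B) : ℝ) : ℂ))
    simpa only [zpow_natCast, Int.cast_natCast] using this
  have hterm : ∀ l, ‖S₁ l - S₂ l‖ ≤ b l := by
    intro l
    have hl0 : 0 ≤ |(l : ℝ)| := abs_nonneg _
    have key : ‖S₁ l - S₂ l‖ ≤ ‖y‖ ^ (m + l) * E * ((C + 1) * (1 + |(l : ℝ)|) / D l) := by
      have hp : 0 ≤ ‖y‖ ^ (m + l) * E := by positivity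
      by_cases h : 0 ≤ m + l ∧ m + l < n
      · have e1 : S₁ l - S₂ l = y ^ (m + l) *
            ((E * (R (2 * (l : ℝ) + 1 - 2 * x) - g / D l) : ℝ) : ℂ) := by
          simp only [hS1, hS2, if_pos h]
          have : 2 * (((m + l : ℤ) : ℝ)) + 1 - n * B = 2 * (l : ℝ) + 1 - 2 * x := by
            push_cast
            linarith
          rw [this]
          push_cast
          ring
        rw [e1, norm_mul, norm_zpow, Complex.norm_real, norm_mul E, Real.norm_of_nonneg hE0.le,
          Real.norm_eq_abs, ← mul_assoc]
        refine mul_le_mul_of_nonneg_left ((hrec l).trans ?_) hp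
        refine div_le_div_of_nonneg_right ?_ (hD0 l).le
        nlinarith
      · have e1 : S₁ l - S₂ l = -(y ^ (m + l) * ((E * (g / D l) : ℝ) : ℂ)) := by
          simp only [hS1, hS2, if_neg h]
          push_cast
          ring
        rw [e1, norm_neg, norm_mul, norm_zpow, Complex.norm_real, norm_mul E,
          Real.norm_of_nonneg hE0.le, Real.norm_of_nonneg (div_pos hg0 (hD0 l)).le, ← mul_assoc]
        refine mul_le_mul_of_nonneg_left ?_ hp
        refine div_le_div_of_nonneg_right ?_ (hD0 l).le
        -- Outside the range of degrees only the model term is present, of size at most √n/D_ℓ. The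
        -- index is then so far from 0 that √n is absorbed by 1 + |ℓ|.
        have e2 : √(n : ℝ) ≤ 1 + |(l : ℝ)| := by
          by_cases h0 : 0 ≤ m + l
          · have h1 : (n : ℝ) ≤ m + l := by
              have : (n : ℤ) ≤ m + l := by
                by_contra h2
                exact h ⟨h0, by omega⟩
              exact_mod_cast this
            have := le_abs_self (l : ℝ)
            linarith
          · have h1 : (m : ℝ) + l + 1 ≤ 0 := by
              have : m + l + 1 ≤ 0 := by omega
              exact_mod_cast this
            have := neg_abs_le (l : ℝ)
            linarith
        nlinarith
    refine key.trans ?_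
    have e1 := zpow_mul_weight_le hrad hge n hz hw l
    have e2 := rpow_div_szegoDenom_le hr1 hr2 hΔ1 hΔ2 hρ0 hρ1 hY1 hY2 hx0 hx1.le l
    calc ‖y‖ ^ (m + l) * E * ((C + 1) * (1 + |(l : ℝ)|) / D l)
        ≤ (‖z‖ * ‖w‖) ^ ((l : ℝ) - x) * ((C + 1) * (1 + |(l : ℝ)|) / D l) :=
          mul_le_mul_of_nonneg_right e1 (div_nonneg (by positivity) (hD0 l).le)
      _ = (C + 1) * (1 + |(l : ℝ)|) * ((‖z‖ * ‖w‖) ^ ((l : ℝ) - x) / D l) := by ring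
      _ ≤ (C + 1) * (1 + |(l : ℝ)|) * _ := mul_le_mul_of_nonneg_left e2 (by positivity)
      _ = b l := by simp only [hb]; ring
  have hdiff : Summable fun l => S₁ l - S₂ l := Summable.of_norm_bounded hbs hterm
  -- S₁ has finite support, so convergence of the Szegő series follows from that of the difference.
  have hsum2 : Summable S₂ := by
    have := hsum1.summable.sub hdiff
    simpa using this
  have hS2eq : S₂ = fun l => y ^ m * ((E * g : ℝ) : ℂ) * szegoTerm Q r₁ r₂ B n z w l :=
    funext fun l => szegoTerm_eq hy0 _ l
  have hconst : y ^ m * ((E * g : ℝ) : ℂ) ≠ 0 :=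
    mul_ne_zero (zpow_ne_zero _ hy0) (Complex.ofReal_ne_zero.2 (mul_pos hE0 hg0).ne')
  refine ⟨?_, ?_⟩
  · rw [hS2eq] at hsum2
    exact (summable_mul_left_iff hconst).1 hsum2
  · have hmain : ((√(2 * Real.pi * n) : ℝ) : ℂ) * szegoKernel Q r₁ r₂ B n z w *
        y ^ m * (((r₁ * r₂) ^ (-(B * n / 2)) : ℝ) : ℂ) *
        ((Real.exp ((n : ℝ) / 2 * (Q (r₁ : ℂ) - Q z) +
          (n : ℝ) / 2 * (Q (r₂ : ℂ) - Q w)) : ℝ) : ℂ) = ∑' l, S₂ l := by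
      rw [mul_assoc _ (((r₁ * r₂) ^ (-(B * n / 2)) : ℝ) : ℂ), ← Complex.ofReal_mul,
        weight_eq hr1 hr2 h01 h02, ← hE, hS2eq, tsum_mul_left, szegoKernel, hg]
      push_cast
      ring
    rw [hmain, ← hsum1.tsum_eq, ← hsum1.summable.tsum_sub hsum2]
    exact tsum_of_norm_bounded hbs.hasSum hterm

/-- Asymptotics of the correlation kernel for two points of different moduli near a gap. -/
theorem corrKernel_near_gap {Q : ℂ → ℝ} (hrad : ∀ z : ℂ, Q z = Q ((‖z‖ : ℝ) : ℂ))
    {r₁ r₂ A B δ M η : ℝ} (hΔ1 : 0 < lap Q r₁) (hΔ2 : 0 < lap Q r₂) (hB0 : 0 < B) (hB2 : B < 2)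
    (h01 : Q (r₁ : ℂ) = A + B * Real.log r₁) (h02 : Q (r₂ : ℂ) = A + B * Real.log r₂)
    (hge : ∀ r : ℝ, 0 < r → A + B * Real.log r ≤ Q (r : ℂ))
    (hpeak : IsTwoPeak (fun r => Q (r : ℂ) - A - B * Real.log r)
      r₁ (2 * lap Q r₁) r₂ (2 * lap Q r₂) δ M η) {c : ℝ} (hc : 0 < c) :
    ∃ (C : ℝ) (n₀ : ℕ), ∀ n : ℕ, n₀ ≤ n → ∀ z w : ℂ,
      z ∈ Metric.thickening (Real.log n / √(n : ℝ)) (annulus r₁ r₂) →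
      w ∈ Metric.thickening (Real.log n / √(n : ℝ)) (annulus r₁ r₂) →
      c < |‖z‖ - ‖w‖| →
        Summable (szegoTerm Q r₁ r₂ B n z w) ∧
        ‖corrKernel Q n z w - ((√(2 * Real.pi * n) : ℝ) : ℂ) * szegoKernel Q r₁ r₂ B n z w *
            (z * conj w) ^ ⌊B * n / 2⌋ * (((r₁ * r₂) ^ (-(B * n / 2)) : ℝ) : ℂ) *
            ((Real.exp ((n : ℝ) / 2 * (Q (r₁ : ℂ) - Q z) +
              (n : ℝ) / 2 * (Q (r₂ : ℂ) - Q w)) : ℝ) : ℂ)‖ ≤ C * Real.log n ^ 3 := by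
  have hr1 := hpeak.left.pos
  have hr2 := hpeak.right.pos
  obtain ⟨C, n₁, hC, -, hrec⟩ := hpeak.reciprocal hΔ1 hΔ2
  obtain ⟨ρ, ε, hρ0, hρ1, hε0, hε1, hsep⟩ := exists_separation hr1 hr2 hc
  have hlim : Tendsto (fun n : ℕ => Real.log n / √(n : ℝ)) atTop (𝓝 0) := by
    have h := (isLittleO_log_rpow_atTop (r := 1 / 2) (by norm_num)).tendsto_div_nhds_zero
    have h' := h.comp tendsto_natCast_atTop_atTop
    refine h'.congr fun n => ?_
    simp [Real.sqrt_eq_rpow]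
  have hsq : Tendsto (fun n : ℕ => √(n : ℝ)) atTop atTop :=
    Real.tendsto_sqrt_atTop.comp tendsto_natCast_atTop_atTop
  -- The last two conditions keep Bn/2 at distance at least √n from both 0 and n.
  have hev : ∀ᶠ n : ℕ in atTop, Real.log n / √(n : ℝ) < ε ∧ n₁ ≤ (n : ℝ) ∧ 3 ≤ n ∧
      2 / B ≤ √(n : ℝ) ∧ 2 / (2 - B) ≤ √(n : ℝ) := by
    filter_upwards [hlim.eventually_lt_const hε0,
      tendsto_natCast_atTop_atTop.eventually_ge_atTop n₁, eventually_ge_atTop 3,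
      hsq.eventually_ge_atTop (2 / B), hsq.eventually_ge_atTop (2 / (2 - B))] with n a1 a2 a3 a4 a5
    exact ⟨a1, a2, a3, a4, a5⟩
  obtain ⟨n₀, hn₀⟩ := eventually_atTop.1 hev
  set T := ∑' l : ℤ, (C + 1) * (√(lap Q r₂) / r₂ * (r₂ ^ 2 / r₁ ^ 2) + √(lap Q r₁) / r₁) *
        ((1 + |(l : ℝ)|) * ρ ^ l.natAbs) with hT
  have hT0 : 0 ≤ T := tsum_nonneg fun l => by positivity
  refine ⟨T, n₀, fun n hn z w hz hw hzw => ?_⟩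
  obtain ⟨hnε, hn1, hn3, hnB, hnB'⟩ := hn₀ n hn
  have hn0 : 0 < n := by omega
  have hnR : 0 < (n : ℝ) := by exact_mod_cast hn0
  have hsn : √(n : ℝ) * √(n : ℝ) = n := Real.mul_self_sqrt hnR.le
  have hsn0 : 0 < √(n : ℝ) := Real.sqrt_pos.2 hnR
  have hmem : ∀ u ∈ Metric.thickening (Real.log n / √(n : ℝ)) (annulus r₁ r₂),
      r₁ - ε < ‖u‖ ∧ ‖u‖ < r₂ + ε := by
    intro u hu
    obtain ⟨v, ⟨hv1, hv2⟩, huv⟩ := Metric.mem_thickening_iff.1 hu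
    rw [dist_eq_norm] at huv
    have h1 := abs_le.1 (abs_norm_sub_norm_le u v)
    constructor <;> linarith [h1.1, h1.2]
  obtain ⟨hz1, hz2⟩ := hmem z hz
  obtain ⟨hw1, hw2⟩ := hmem w hw
  obtain ⟨hY1, hY2⟩ := hsep _ _ hz1 hw1 hz2 hw2 hzw
  have hb1 : √(n : ℝ) ≤ B * n / 2 := by
    rw [div_le_iff₀ hB0] at hnB
    nlinarith
  have hb2 : √(n : ℝ) ≤ n - B * n / 2 := by
    rw [div_le_iff₀ (by linarith)] at hnB'
    nlinarith
  obtain ⟨hs, hle⟩ := norm_corrKernel_sub_le hrad hr1 hr2 hΔ1 hΔ2 h01 h02 hge hC hn0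
    (hrec n _ hn1 (Int.fract_nonneg _) (Int.fract_lt_one _).le) hb1 hb2 hρ0 hρ1
    (by linarith) (by linarith) hY1 hY2
  refine ⟨hs, hle.trans ?_⟩
  -- The error is already bounded by the constant T; log³ n ≥ 1 holds from n = 3 > e on.
  have hlog : 1 ≤ Real.log n := by
    rw [Real.le_log_iff_exp_le hnR]
    have : (3 : ℝ) ≤ n := by exact_mod_cast hn3
    linarith [Real.exp_one_lt_d9]
  exact le_mul_of_one_le_right hT0 (one_le_pow₀ hlog)

/-! ### The geometry of the droplet -/

lemma lt_of_lt_index {N : ℕ} {a b : ℕ → ℝ} (hab : ∀ j ≤ N, a j < b j)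
    (hba : ∀ j < N, b j < a (j + 1)) {i j : ℕ} (hij : i < j) (hj : j ≤ N) : b i < a j := by
  induction j, hij using Nat.le_induction with
  | base => exact hba i (by omega)
  | succ j _ ih =>
    exact (ih (by omega)).trans ((hab j (by omega)).trans (hba j (by omega)))

lemma isOpen_annulus (r₁ r₂ : ℝ) : IsOpen (annulus r₁ r₂) :=
  (isOpen_lt continuous_const continuous_norm).inter (isOpen_lt continuous_norm continuous_const)

lemma ofReal_mem_closure_annulus_left {r₁ r₂ : ℝ} (h0 : 0 < r₁) (h12 : r₁ < r₂) :
    (r₁ : ℂ) ∈ closure (annulus r₁ r₂) := by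
  have h1 : Tendsto (fun r : ℝ => (r : ℂ)) (𝓝[>] r₁) (𝓝 (r₁ : ℂ)) :=
    (Complex.continuous_ofReal.tendsto r₁).mono_left nhdsWithin_le_nhds
  refine mem_closure_of_tendsto h1 ?_
  filter_upwards [Ioo_mem_nhdsGT h12] with r hr
  rw [annulus, mem_ofPred_eq, Complex.norm_real, Real.norm_of_nonneg (h0.trans hr.1).le]
  exact hr

lemma ofReal_mem_closure_annulus_right {r₁ r₂ : ℝ} (h0 : 0 < r₁) (h12 : r₁ < r₂) :
    (r₂ : ℂ) ∈ closure (annulus r₁ r₂) := by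
  have h1 : Tendsto (fun r : ℝ => (r : ℂ)) (𝓝[<] r₂) (𝓝 (r₂ : ℂ)) :=
    (Complex.continuous_ofReal.tendsto r₂).mono_left nhdsWithin_le_nhds
  refine mem_closure_of_tendsto h1 ?_
  filter_upwards [Ioo_mem_nhdsLT h12] with r hr
  rw [annulus, mem_ofPred_eq, Complex.norm_real, Real.norm_of_nonneg (h0.trans hr.1).le]
  exact hr

lemma SmoothNear.contDiffAt {k : ℕ} {f : ℂ → ℝ} {E : Set ℂ} (h : SmoothNear k f E) {z : ℂ}
    (hz : z ∈ E) : ContDiffAt ℝ (k : WithTop ℕ∞) f z := by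
  obtain ⟨U, hU, hEU, hf⟩ := h
  exact hf.contDiffAt (hU.mem_nhds (hEU hz))

end CoulombGap

/-! ### The theorem: geometry of the chosen gap and conclusion. -/

theorem theorem1p14
    (Q : ℂ → ℝ)
    (hQ_lsc : LowerSemicontinuous Q)
    (hQ_inf : Tendsto (fun z : ℂ => Q z - 2 * Real.log ‖z‖) (cocompact ℂ) atTop)
    (hQ_rad : ∀ z : ℂ, Q z = Q ((‖z‖ : ℝ) : ℂ))
    -- the equilibrium measure; the droplet is its support
    (σ : Measure ℂ) (hσ : CoulombGap.IsEquilibriumMeasure Q σ)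
    (hQ_smooth : CoulombGap.SmoothNear 2 Q σ.support)
    (hQ_strict : ∀ z ∈ frontier σ.support, 0 < CoulombGap.lap Q z)
    (hQ_contact : ∀ z ∉ σ.support, CoulombGap.obstacle Q σ z < Q z)
    -- the droplet is a finite union of closed concentric annuli
    (N : ℕ) (a b : ℕ → ℝ) (ha : 0 ≤ a 0)
    (hab : ∀ j ≤ N, a j < b j) (hba : ∀ j < N, b j < a (j + 1))
    (hS : σ.support = {z : ℂ | ∃ j ≤ N, a j ≤ ‖z‖ ∧ ‖z‖ ≤ b j})
    -- the gap
    (k : ℕ) (hk : k < N) (r₁ r₂ : ℝ) (hr₁ : r₁ = b k) (hr₂ : r₂ = a (k + 1))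
    (hQ_gap : CoulombGap.SmoothNear 6 Q (frontier (CoulombGap.annulus r₁ r₂))) :
    ∃ A B : ℝ,
      (∀ z : ℂ, r₁ ≤ ‖z‖ → ‖z‖ ≤ r₂ →
        CoulombGap.obstacle Q σ z = A + B * Real.log ‖z‖) ∧
      ∀ c : ℝ, 0 < c → ∃ (C : ℝ) (n₀ : ℕ), ∀ n : ℕ, n₀ ≤ n → ∀ z w : ℂ,
        z ∈ Metric.thickening (Real.log n / √(n : ℝ)) (CoulombGap.annulus r₁ r₂) →
        w ∈ Metric.thickening (Real.log n / √(n : ℝ)) (CoulombGap.annulus r₁ r₂) →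
        c < |‖z‖ - ‖w‖| →
          Summable (CoulombGap.szegoTerm Q r₁ r₂ B n z w) ∧
          ‖CoulombGap.corrKernel Q n z w -
              ((√(2 * Real.pi * n) : ℝ) : ℂ) * CoulombGap.szegoKernel Q r₁ r₂ B n z w *
                (z * (starRingEnd ℂ) w) ^ ⌊B * n / 2⌋ *
                (((r₁ * r₂) ^ (-(B * n / 2)) : ℝ) : ℂ) *
                ((Real.exp ((n : ℝ) / 2 * (Q (r₁ : ℂ) - Q z) +
                  (n : ℝ) / 2 * (Q (r₂ : ℂ) - Q w)) : ℝ) : ℂ)‖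
            ≤ C * Real.log n ^ 3 := by
  have hak : 0 ≤ a k := by
    rcases Nat.eq_zero_or_pos k with h | h
    · rw [h]; exact ha
    · have h1 := CoulombGap.lt_of_lt_index hab hba h hk.le
      have h2 := hab 0 (Nat.zero_le _)
      linarith
  have habk := hab k hk.le
  have habk' := hab (k + 1) hk
  have h0 : 0 < r₁ := by rw [hr₁]; linarith
  have h12 : r₁ < r₂ := by rw [hr₁, hr₂]; exact hba k hk
  have h02 : 0 < r₂ := h0.trans h12
  have hnorm : ∀ r : ℝ, 0 ≤ r → ‖(r : ℂ)‖ = r := fun r hr => by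
    rw [Complex.norm_real, Real.norm_of_nonneg hr]
  have hSrad : ∀ z w : ℂ, ‖z‖ = ‖w‖ → z ∈ σ.support → w ∈ σ.support := by
    intro z w hzw hz
    rw [hS] at hz ⊢
    simpa only [mem_ofPred_eq, ← hzw] using hz
  have hgap : ∀ z ∈ σ.support, ¬ (r₁ < ‖z‖ ∧ ‖z‖ < r₂) := by
    rintro z hz ⟨hz1, hz2⟩
    rw [hS] at hz
    obtain ⟨j, hj, hj1, hj2⟩ := hz
    rcases lt_trichotomy j k with h | h | h
    · have h1 := CoulombGap.lt_of_lt_index hab hba h hk.le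
      linarith
    · rw [h] at hj2
      linarith
    · rcases Nat.lt_or_ge (k + 1) j with h' | h'
      · have h1 := CoulombGap.lt_of_lt_index hab hba h' hj
        linarith
      · have : j = k + 1 := by omega
        rw [this] at hj1
        linarith
  have hin : ∀ r < r₁, ∃ z ∈ σ.support, r < ‖z‖ ∧ ‖z‖ < r₁ := by
    intro r hr
    obtain ⟨s, hs1, hs2⟩ := exists_between (max_lt hr (hr₁ ▸ habk : a k < r₁))
    have hs3 := max_lt_iff.1 hs1
    refine ⟨(s : ℂ), ?_, ?_, ?_⟩
    · rw [hS]
      refine ⟨k, hk.le, ?_, ?_⟩ <;> rw [hnorm s (by linarith)] <;> linarith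
    all_goals rw [hnorm s (by linarith)]; linarith
  have hout : ∀ r > r₂, ∃ z ∈ σ.support, r₂ < ‖z‖ ∧ ‖z‖ < r := by
    intro r hr
    obtain ⟨s, hs1, hs2⟩ := exists_between (lt_min hr (hr₂ ▸ habk' : r₂ < b (k + 1)))
    have hs3 := lt_min_iff.1 hs2
    refine ⟨(s : ℂ), ?_, ?_, ?_⟩
    · rw [hS]
      refine ⟨k + 1, hk, ?_, ?_⟩ <;> rw [hnorm s (by linarith)] <;> linarith
    all_goals rw [hnorm s (by linarith)]; linarith
  have hS1 : (r₁ : ℂ) ∈ σ.support := by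
    rw [hS]
    refine ⟨k, hk.le, ?_, ?_⟩ <;> rw [hnorm r₁ h0.le] <;> linarith
  have hS2 : (r₂ : ℂ) ∈ σ.support := by
    rw [hS]
    refine ⟨k + 1, hk, ?_, ?_⟩ <;> rw [hnorm r₂ h02.le] <;> linarith
  have hcl1 := CoulombGap.ofReal_mem_closure_annulus_left h0 h12
  have hcl2 := CoulombGap.ofReal_mem_closure_annulus_right h0 h12
  -- Points of the gap lie off the droplet and accumulate at r₁ and r₂, so both are boundary points
  -- of the droplet and ΔQ > 0 there.
  have hsub : CoulombGap.annulus r₁ r₂ ⊆ (σ.support)ᶜ := fun z hz hz' => hgap z hz' hz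
  have hfr1 : (r₁ : ℂ) ∈ frontier σ.support := by
    rw [frontier_eq_closure_inter_closure]
    exact ⟨subset_closure hS1, closure_mono hsub hcl1⟩
  have hfr2 : (r₂ : ℂ) ∈ frontier σ.support := by
    rw [frontier_eq_closure_inter_closure]
    exact ⟨subset_closure hS2, closure_mono hsub hcl2⟩
  have hfa1 : (r₁ : ℂ) ∈ frontier (CoulombGap.annulus r₁ r₂) := by
    rw [(CoulombGap.isOpen_annulus r₁ r₂).frontier_eq]
    refine ⟨hcl1, fun h => ?_⟩
    have := h.1
    rw [hnorm r₁ h0.le] at this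
    exact lt_irrefl _ this
  have hfa2 : (r₂ : ℂ) ∈ frontier (CoulombGap.annulus r₁ r₂) := by
    rw [(CoulombGap.isOpen_annulus r₁ r₂).frontier_eq]
    refine ⟨hcl2, fun h => ?_⟩
    have := h.2
    rw [hnorm r₂ h02.le] at this
    exact lt_irrefl _ this
  have h36 : (3 : WithTop ℕ∞) ≤ ((6 : ℕ) : WithTop ℕ∞) := by norm_cast
  obtain ⟨U, hU, hSU, hQU⟩ := hQ_smooth
  obtain ⟨A, B, hB0, hB2, hobs, hA1, hA2, hgt⟩ := CoulombGap.obstacle_gap hQ_lsc hQ_rad hσ hU hSU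
    hQU.continuousOn hQ_contact hSrad h0 h12 hgap hS1 hS2 hin hout
  refine ⟨A, B, hobs, fun c hc => ?_⟩
  have hΔ1 := hQ_strict _ hfr1
  have hΔ2 := hQ_strict _ hfr2
  obtain ⟨δ, M, η, hpeak⟩ := CoulombGap.exists_isTwoPeak hQ_lsc hQ_inf hQ_rad h0 h12
    ((hQ_gap.contDiffAt hfa1).of_le h36) ((hQ_gap.contDiffAt hfa2).of_le h36) hΔ1 hΔ2 hB0 hB2
    hA1 hA2 hgt
  refine CoulombGap.corrKernel_near_gap hQ_rad hΔ1 hΔ2 hB0 hB2 hA1 hA2 (fun r hr => ?_) hpeak hc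
  by_cases e1 : r = r₁
  · rw [e1, hA1]
  by_cases e2 : r = r₂
  · rw [e2, hA2]
  exact (hgt r hr e1 e2).le
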